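/- **Problem (LBkSRO).** An instance consists of a finite set $\mathcal F$ of facilities with lower bounds $L_i\in\mathbb Z_{\ge 0}$ ($i\in\mathcal F$) and a finite set $\mathcal D$ of clients, located in a common metric space with distances $c(u,v)$, $u,v\in\mathcal F\cup\mathcal D$ (points may share a location), and bounds $k,m\in\mathbb Z_{\ge 0}$. A feasible solution is a pair $(S,\sigma)$ with $S\subseteq\mathcal F$ and $\sigma:\mathcal D\to S\cup\{\mathsf{out}\}$ such that $|S|\le k$, $|\sigma^{-1}(i)|\ge L_i$ for all $i\in S$, and $|\sigma^{-1}(\mathsf{out})|\le m$. Its cost is $\sum_{i\in S}\max_{j\in\sigma^{-1}(i)}c(i,j)$, where the maximum over the empty set is $0$. Let $O^*$ denote the minimum cost of a feasible solution, and let $n=|\mathcal F|+|\mathcal D|$. **Theorem.** There is a $(12.365+O(\epsilon))$-approximation algorithm for LBkSRO that runs in time $n^{O(1/\epsilon)}$ for any $\epsilon>0$. Precisely, there are an algorithm, which takes as input an instance and a real number $\epsilon>0$, and an absolute constant $C$ such that, for every $\epsilon>0$ and every instance, the algorithm halts after at most $\max(n,2)^{C\lceil 1/\epsilon\rceil}$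 elementary steps, and, if the instance has a feasible solution, it outputs a feasible solution of cost at most $(12.365+C\epsilon)\,O^*$. Here an algorithm is a program for a random access machine with memory cells for natural numbers and for real numbers and with indirect addressing. Its elementary steps, each of unit cost, are reading, writing and branching, addition, truncated subtraction and comparison of natural numbers, addition, subtraction and comparison of real numbers, conversion of a natural number to a real number, and multiplication and division of a real number by a natural number. -/

import Mathlib

/-! ### The lower-bounded min-sum-of-radii problem with outliers -/

/-- An instance: `nF` facilities with lower bounds `L`, `nD` clients, all located in a common
metric space (distinct facilities and clients may share a location, hence a pseudometric on the
labels), at most `k` facilities may be chosen and at most `m` clients may be outliers. -/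
structure LBkSRO where
  nF : ℕ
  nD : ℕ
  L : Fin nF → ℕ
  k : ℕ
  m : ℕ
  metric : PseudoMetricSpace (Fin nF ⊕ Fin nD)

namespace LBkSRO

/-- The size parameter `n`, the number of facilities plus the number of clients. -/
def size (I : LBkSRO) : ℕ := I.nF + I.nD

/-- The distance `c(u, v)`. -/
def c (I : LBkSRO) (u v : Fin I.nF ⊕ Fin I.nD) : ℝ := I.metric.dist u v

/-- A candidate solution: chosen facilities `S` and an assignment `σ`, where `σ j = none` means
that the client `j` is an outlier. -/
structure Solution (I : LBkSRO) where
  S : Finset (Fin I.nF)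
  σ : Fin I.nD → Option (Fin I.nF)

/-- Feasibility: clients are only assigned to chosen facilities, at most `k` facilities are
chosen, all lower bounds of chosen facilities hold, and there are at most `m` outliers. -/
structure Feasible (I : LBkSRO) (x : I.Solution) : Prop where
  assigned : ∀ j i, x.σ j = some i → i ∈ x.S
  card_le : x.S.card ≤ I.k
  lower : ∀ i ∈ x.S, I.L i ≤ (Finset.univ.filter fun j => x.σ j = some i).card
  outliers : (Finset.univ.filter fun j => x.σ j = none).card ≤ I.m

/-- The radius of facility `i`: the largest distance from `i` to a client assigned to it.
The supremum ranges over a finite set of nonnegative reals; it is `0` if that set is empty. -/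
noncomputable def radius (I : LBkSRO) (x : I.Solution) (i : Fin I.nF) : ℝ :=
  ⨆ j : {j : Fin I.nD // x.σ j = some i}, I.c (Sum.inl i) (Sum.inr j.1)

/-- The cost of a solution: the sum of the radii of the chosen facilities. -/
noncomputable def cost (I : LBkSRO) (x : I.Solution) : ℝ := ∑ i ∈ x.S, I.radius x i

end LBkSRO

/-! ### The machine model

A random access machine with two kinds of memory cells, for natural numbers and for real numbers.
Memory is divided into arrays; the name of an array is a constant of the program, the index of a
cell is computed at run time (indirect addressing).  Elementary operations cost one step each.
On natural numbers these are addition, truncated subtraction and comparison; on real numbers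
addition, subtraction, comparison, and multiplication and division by a natural number.  There is
no rounding, no product of two reals and no product of two natural numbers. -/

namespace RAM

/-- A memory state: `nat a i` and `real a i` are the `i`-th cells of the arrays named `a`. -/
structure State where
  nat : ℕ → ℕ → ℕ
  real : ℕ → ℕ → ℝ

/-- Write `v` into cell `i` of the natural-number array `a`. -/
def State.setNat (s : State) (a i v : ℕ) : State :=
  { s with nat := Function.update s.nat a (Function.update (s.nat a) i v) }

/-- Write `v` into cell `i` of the real array `a`. -/
def State.setReal (s : State) (a i : ℕ) (v : ℝ) : State :=
  { s with real := Function.update s.real a (Function.update (s.real a) i v) }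

/-- Natural-number expressions. -/
inductive NExp where
  | lit (c : ℕ)
  | get (a : ℕ) (i : NExp)
  | add (e f : NExp)
  | sub (e f : NExp)

def NExp.eval (s : State) : NExp → ℕ
  | .lit c => c
  | .get a i => s.nat a (i.eval s)
  | .add e f => e.eval s + f.eval s
  | .sub e f => e.eval s - f.eval s

/-- The number of elementary operations needed to evaluate an expression. -/
def NExp.ops : NExp → ℕ
  | .lit _ => 1
  | .get _ i => i.ops + 1
  | .add e f => e.ops + f.ops + 1
  | .sub e f => e.ops + f.ops + 1

/-- Real expressions.  `mul e f` and `div e f` multiply and divide a real by a natural number. -/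
inductive RExp where
  | ofNat (e : NExp)
  | get (a : ℕ) (i : NExp)
  | add (e f : RExp)
  | sub (e f : RExp)
  | mul (e : RExp) (f : NExp)
  | div (e : RExp) (f : NExp)

noncomputable def RExp.eval (s : State) : RExp → ℝ
  | .ofNat e => (e.eval s : ℝ)
  | .get a i => s.real a (i.eval s)
  | .add e f => e.eval s + f.eval s
  | .sub e f => e.eval s - f.eval s
  | .mul e f => e.eval s * (f.eval s : ℝ)
  | .div e f => e.eval s / (f.eval s : ℝ)

def RExp.ops : RExp → ℕ
  | .ofNat e => e.ops + 1
  | .get _ i => i.ops + 1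
  | .add e f => e.ops + f.ops + 1
  | .sub e f => e.ops + f.ops + 1
  | .mul e f => e.ops + f.ops + 1
  | .div e f => e.ops + f.ops + 1

/-- Tests. -/
inductive Test where
  | natLe (e f : NExp)
  | realLe (e f : RExp)
  | not (b : Test)
  | and (b d : Test)

def Test.holds (s : State) : Test → Prop
  | .natLe e f => e.eval s ≤ f.eval s
  | .realLe e f => e.eval s ≤ f.eval s
  | .not b => ¬ b.holds s
  | .and b d => b.holds s ∧ d.holds s

def Test.ops : Test → ℕ
  | .natLe e f => e.ops + f.ops + 1
  | .realLe e f => e.ops + f.ops + 1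
  | .not b => b.ops + 1
  | .and b d => b.ops + d.ops + 1

/-- Programs.  `setNat a i e` assigns the value of `e` to cell `i` of the natural-number array
`a`, and `setReal` does the same for real arrays. -/
inductive Prog where
  | skip
  | setNat (a : ℕ) (i e : NExp)
  | setReal (a : ℕ) (i : NExp) (e : RExp)
  | seq (p q : Prog)
  | ite (b : Test) (p q : Prog)
  | while (b : Test) (p : Prog)

/-- `Exec p s T s'`: started in state `s`, the program `p` halts after exactly `T` steps, in
state `s'`. -/
inductive Exec : Prog → State → ℕ → State → Prop
  | skip (s : State) : Exec .skip s 1 s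
  | setNat (a : ℕ) (i e : NExp) (s : State) :
      Exec (.setNat a i e) s (i.ops + e.ops + 1) (s.setNat a (i.eval s) (e.eval s))
  | setReal (a : ℕ) (i : NExp) (e : RExp) (s : State) :
      Exec (.setReal a i e) s (i.ops + e.ops + 1) (s.setReal a (i.eval s) (e.eval s))
  | seq {p q : Prog} {s s' s'' : State} {T T' : ℕ} :
      Exec p s T s' → Exec q s' T' s'' → Exec (.seq p q) s (T + T') s''
  | iteTrue {b : Test} {p q : Prog} {s s' : State} {T : ℕ} :
      b.holds s → Exec p s T s' → Exec (.ite b p q) s (b.ops + T + 1) s'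
  | iteFalse {b : Test} {p q : Prog} {s s' : State} {T : ℕ} :
      ¬ b.holds s → Exec q s T s' → Exec (.ite b p q) s (b.ops + T + 1) s'
  | whileTrue {b : Test} {p : Prog} {s s' s'' : State} {T T' : ℕ} :
      b.holds s → Exec p s T s' → Exec (.while b p) s' T' s'' →
      Exec (.while b p) s (b.ops + T + T' + 1) s''
  | whileFalse {b : Test} {p : Prog} {s : State} :
      ¬ b.holds s → Exec (.while b p) s (b.ops + 1) s

end RAM

namespace LBkSRO

/-- The point with number `u`: facilities come first, then clients. -/
def point (I : LBkSRO) (u : ℕ) : Option (Fin I.nF ⊕ Fin I.nD) :=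
  if h : u < I.nF then some (Sum.inl ⟨u, h⟩)
  else if h : u - I.nF < I.nD then some (Sum.inr ⟨u - I.nF, h⟩)
  else none

/-- The initial memory on input `I` and `ε`.
Natural-number array `0` holds `nF, nD, k, m`, natural-number array `1` holds the lower bounds;
real array `0` holds `ε`, real array `1` holds the distance matrix row by row, the entry `c(u, v)`
in cell `u * n + v`.  All other cells are `0`. -/
noncomputable def input (I : LBkSRO) (ε : ℝ) : RAM.State where
  nat a i :=
    if a = 0 then [I.nF, I.nD, I.k, I.m].getD i 0
    else if a = 1 then (if h : i < I.nF then I.L ⟨i, h⟩ else 0)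
    else 0
  real a i :=
    if a = 0 then (if i = 0 then ε else 0)
    else if a = 1 then
      match I.point (i / I.size), I.point (i % I.size) with
      | some u, some v => I.c u v
      | _, _ => 0
    else 0

/-- The final memory `s` presents the solution `x`: natural-number array `2` is the indicator
vector of `S`, and natural-number array `3` holds the assignment, with `0` for an outlier and
`i + 1` for facility `i`. -/
def Presents (I : LBkSRO) (s : RAM.State) (x : I.Solution) : Prop :=
  (∀ i : Fin I.nF, s.nat 2 i = if i ∈ x.S then 1 else 0) ∧
  (∀ j : Fin I.nD, s.nat 3 j = match x.σ j with
    | none => 0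
    | some i => (i : ℕ) + 1)

end LBkSRO

/-! The proof gives the factor 12 in time polynomial in `n`, whatever `ε` is: 12 ≤ 12.365 + Cε, and
of the exponent only ⌈1/ε⌉ ≥ 1 is used.

Guess `R`, the largest radius of an optimal solution, and replace the bound `k` by an opening cost λ
per facility. A ball is valid if its radius is at most `R` and it holds enough clients for its
centre. A primal-dual run raises the dual values of all clients together; when a valid ball becomes
tight, its clients freeze. Cut the dual off at a time when more than `m` clients are still
uncovered. Weak duality then shows that disjoint balls M which were tight before that time satisfy
Σ(rad + λ) ≤ OPT + kλ, up to a small error (`dual_bound`). If |M| ≥ k, the opening costs cancel and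
Σ rad ≤ OPT.

Conversely, a family of valid balls gives a clustering: each connected component of the union is a
cluster, centred at one of its own balls, so lower bounds hold. It is feasible if there are at most
`k` components and at most `m` uncovered clients. If M is chosen greedily by radius inside a family
G, the clustering of G with two extra balls costs at most 6 Σ_M rad + 4R
(`IsClustering.cost_le_of_subfamily`).

So at least `k` components are wanted for the bound and at most `k` for feasibility. Bisection
yields opening costs l₁ ≤ l₂, exponentially close, such that the early balls (those before which
more than `m` clients are uncovered) have more than `k` components for l₁ (or l₁ = 0, where nothing
has to cancel) and at most `k` for l₂. The two dual solutions differ by at most (l₂ - l₁)·2^nD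
(`IsRun.abs_sub_le`), so the balls of both runs may be mixed in one order of time. Turn the first
run into the second by inserting and deleting single balls (`exists_balanced_window`). Where the
number of components crosses `k`, `exists_balanced_of_insert` finds a prefix which has at least `k`
components and leaves more than `m` clients uncovered, and which, after removal of at most one
isolated ball, is made feasible by two further balls. The cost is at most 6(OPT + R/3) + 4R ≤
12·OPT, as R ≤ OPT (`exists_candidate`).

The program does not locate the crossing: for each guess it tries all windows, prefixes and pairs of
extra balls, (2nD)^5 candidates, and keeps the cheapest feasible one. It is written with counting
loops whose bounds are linear in the input sizes, so its running time is polynomial (`exec_compile`,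
`time_le_pow`), and its correctness is a matter of loop invariants (`loop_spec`). -/

/-! ### Programs with bounded loops -/

namespace RAM

/-- Expressions which only read the numbers of facilities and clients. -/
def NExp.isBound : NExp → Bool
  | .lit _ => true
  | .get a (.lit c) => a == 0 && decide (c ≤ 1)
  | .add e f => e.isBound && f.isBound
  | _ => false

/-- `e.weight * N` bounds the value of `e` if `N` bounds the input sizes. -/
def NExp.weight : NExp → ℕ
  | .lit c => c
  | .get _ _ => 1
  | .add e f => e.weight + f.weight
  | .sub _ _ => 0

theorem NExp.eval_congr_of_isBound : ∀ {e : NExp}, e.isBound = true →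
    ∀ {s t : State}, t.nat 0 = s.nat 0 → e.eval t = e.eval s
  | .lit _, _, _, _, _ => rfl
  | .get a (.lit c), h, s, t, hst => by
    simp only [isBound, Bool.and_eq_true, beq_iff_eq] at h
    simp [eval, h.1, hst]
  | .add e f, h, s, t, hst => by
    simp only [isBound, Bool.and_eq_true] at h
    simp [eval, eval_congr_of_isBound h.1 hst, eval_congr_of_isBound h.2 hst]

theorem NExp.eval_le_weight : ∀ {e : NExp}, e.isBound = true →
    ∀ {s : State} {N : ℕ}, 1 ≤ N → s.nat 0 0 ≤ N → s.nat 0 1 ≤ N → e.eval s ≤ e.weight * N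
  | .lit c, _, s, N, hN, _, _ => by
    simpa [eval, weight] using Nat.le_mul_of_pos_right c hN
  | .get a (.lit c), h, s, N, _, h0, h1 => by
    simp only [isBound, Bool.and_eq_true, beq_iff_eq, decide_eq_true_eq] at h
    obtain ⟨rfl, hc⟩ := h
    interval_cases c <;> simpa [eval, weight]
  | .add e f, h, s, N, hN, h0, h1 => by
    simp only [isBound, Bool.and_eq_true] at h
    have := eval_le_weight h.1 hN h0 h1
    have := eval_le_weight h.2 hN h0 h1
    simp only [eval, weight, Nat.add_mul]
    omega

/-- Programs in which every loop is a counting loop. `loop v e p` runs `p` for the values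
`0, …, e - 1` of the counter, which is cell `0` of the array `v`. -/
inductive LProg where
  | skip
  | setNat (a : ℕ) (i e : NExp)
  | setReal (a : ℕ) (i : NExp) (e : RExp)
  | seq (p q : LProg)
  | ite (b : Test) (p q : LProg)
  | loop (v : ℕ) (e : NExp) (p : LProg)

namespace LProg

/-- Increasing a scalar. -/
def incr (v : ℕ) : Prog := .setNat v (.lit 0) (.add (.get v (.lit 0)) (.lit 1))

def compile : LProg → Prog
  | skip => .skip
  | setNat a i e => .setNat a i e
  | setReal a i e => .setReal a i e
  | seq p q => .seq p.compile q.compile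
  | ite b p q => .ite b p.compile q.compile
  | loop v e p => .seq (.setNat v (.lit 0) (.lit 0))
      (.while (.natLe (.add (.get v (.lit 0)) (.lit 1)) e) (.seq p.compile (incr v)))

open Classical in
/-- The state transformation computed by a program. -/
noncomputable def den : LProg → State → State
  | skip => fun s => s
  | setNat a i e => fun s => s.setNat a (i.eval s) (e.eval s)
  | setReal a i e => fun s => s.setReal a (i.eval s) (e.eval s)
  | seq p q => fun s => q.den (p.den s)
  | ite b p q => fun s => if b.holds s then p.den s else q.den s
  | loop v e p => fun s =>
      Nat.rec (s.setNat v 0 0) (fun i t => (p.den t).setNat v 0 (i + 1)) (e.eval s)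

/-- The natural-number arrays a program may write. -/
def natWrites : LProg → List ℕ
  | skip => []
  | setNat a _ _ => [a]
  | setReal _ _ _ => []
  | seq p q => p.natWrites ++ q.natWrites
  | ite _ p q => p.natWrites ++ q.natWrites
  | loop v _ p => v :: p.natWrites

/-- The real arrays a program may write. -/
def realWrites : LProg → List ℕ
  | skip => []
  | setNat _ _ _ => []
  | setReal a _ _ => [a]
  | seq p q => p.realWrites ++ q.realWrites
  | ite _ p q => p.realWrites ++ q.realWrites
  | loop _ _ p => p.realWrites

/-- Loop bounds are input sizes, and loop bodies do not touch their counters. -/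
def ok : LProg → Bool
  | skip => true
  | setNat _ _ _ => true
  | setReal _ _ _ => true
  | seq p q => p.ok && q.ok
  | ite _ p q => p.ok && q.ok
  | loop v e p => p.ok && e.isBound && !(p.natWrites.contains v)

/-- A bound for the running time if `N` bounds the input sizes. -/
def time (N : ℕ) : LProg → ℕ
  | skip => 1
  | setNat _ i e => i.ops + e.ops + 1
  | setReal _ i e => i.ops + e.ops + 1
  | seq p q => p.time N + q.time N
  | ite b p q => b.ops + p.time N + q.time N + 1
  | loop _ e p => e.ops + 10 + e.weight * N * (p.time N + e.ops + 12)

end LProg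

@[simp] theorem State.setNat_real (s : State) (a i v : ℕ) : (s.setNat a i v).real = s.real := rfl
@[simp] theorem State.setReal_nat (s : State) (a i : ℕ) (v : ℝ) :
    (s.setReal a i v).nat = s.nat := rfl

theorem State.setNat_nat (s : State) (a i v b j : ℕ) :
    (s.setNat a i v).nat b j = if b = a ∧ j = i then v else s.nat b j := by
  by_cases hb : b = a
  · subst hb
    by_cases hj : j = i <;> simp [State.setNat, Function.update, hj]
  · simp [State.setNat, hb]

theorem State.setReal_real (s : State) (a i b j : ℕ) (v : ℝ) :
    (s.setReal a i v).real b j = if b = a ∧ j = i then v else s.real b j := by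
  by_cases hb : b = a
  · subst hb
    by_cases hj : j = i <;> simp [State.setReal, Function.update, hj]
  · simp [State.setReal, hb]

theorem State.setNat_nat_ne (s : State) {a i v b : ℕ} (h : b ≠ a) :
    (s.setNat a i v).nat b = s.nat b := by
  simp [State.setNat, h]

theorem State.setReal_real_ne (s : State) {a i b : ℕ} {v : ℝ} (h : b ≠ a) :
    (s.setReal a i v).real b = s.real b := by
  simp [State.setReal, h]

/-! ### Frame rules, loop invariants and running time of bounded loops. -/

namespace LProg

/-- The frame rule. For a concrete program the side condition is settled by `decide`, which is how
unrelated memory is carried through all later proofs. -/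
theorem den_nat : ∀ (p : LProg) (s : State) {a : ℕ}, a ∉ p.natWrites →
    (p.den s).nat a = s.nat a
  | skip, _, _, _ => rfl
  | setNat b i e, s, a, h => by
    simp only [natWrites, List.mem_singleton] at h
    exact s.setNat_nat_ne h
  | setReal _ _ _, _, _, _ => rfl
  | seq p q, s, a, h => by
    simp only [natWrites, List.mem_append, not_or] at h
    rw [den, den_nat q _ h.2, den_nat p _ h.1]
  | ite b p q, s, a, h => by
    simp only [natWrites, List.mem_append, not_or] at h
    simp only [den]
    split_ifs
    exacts [den_nat p _ h.1, den_nat q _ h.2]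
  | loop v e p, s, a, h => by
    simp only [natWrites, List.mem_cons, not_or] at h
    simp only [den]
    induction e.eval s with
    | zero => exact s.setNat_nat_ne h.1
    | succ i ih => exact (State.setNat_nat_ne _ h.1).trans ((den_nat p _ h.2).trans ih)

theorem den_real : ∀ (p : LProg) (s : State) {a : ℕ}, a ∉ p.realWrites →
    (p.den s).real a = s.real a
  | skip, _, _, _ => rfl
  | setNat _ _ _, _, _, _ => rfl
  | setReal b i e, s, a, h => by
    simp only [realWrites, List.mem_singleton] at h
    exact s.setReal_real_ne h
  | seq p q, s, a, h => by
    simp only [realWrites, List.mem_append, not_or] at h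
    rw [den, den_real q _ h.2, den_real p _ h.1]
  | ite b p q, s, a, h => by
    simp only [realWrites, List.mem_append, not_or] at h
    simp only [den]
    split_ifs
    exacts [den_real p _ h.1, den_real q _ h.2]
  | loop v e p, s, a, h => by
    simp only [realWrites] at h
    simp only [den]
    induction e.eval s with
    | zero => rfl
    | succ i ih => exact (den_real p _ h).trans ih

/-- Invariants of counting loops. -/
theorem loop_induction {v : ℕ} {e : NExp} {p : LProg} {s : State} (J : ℕ → State → Prop)
    (zero : J 0 (s.setNat v 0 0))
    (succ : ∀ i t, i < e.eval s → t.nat v 0 = i →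
      (∀ a, a ∉ v :: p.natWrites → t.nat a = s.nat a) →
      (∀ a, a ∉ p.realWrites → t.real a = s.real a) → J i t →
      J (i + 1) ((p.den t).setNat v 0 (i + 1))) :
    J (e.eval s) ((loop v e p).den s) := by
  have key : ∀ i, i ≤ e.eval s →
      let t : State := Nat.rec (s.setNat v 0 0) (fun i t => (p.den t).setNat v 0 (i + 1)) i
      J i t ∧ t.nat v 0 = i ∧ (∀ a, a ∉ v :: p.natWrites → t.nat a = s.nat a) ∧
        (∀ a, a ∉ p.realWrites → t.real a = s.real a) := by
    intro i
    induction i with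
    | zero =>
      intro _
      refine ⟨zero, by simp [State.setNat_nat], fun a ha => ?_, fun a _ => rfl⟩
      exact s.setNat_nat_ne (by simp at ha; exact ha.1)
    | succ i ih =>
      intro hi
      obtain ⟨h1, h2, h3, h4⟩ := ih (by omega)
      refine ⟨succ i _ (by omega) h2 h3 h4 h1, by simp [State.setNat_nat], fun a ha => ?_,
        fun a ha => ?_⟩
      · have ha' := ha
        simp only [List.mem_cons, not_or] at ha'
        exact (State.setNat_nat_ne _ ha'.1).trans ((den_nat p _ ha'.2).trans (h3 a ha))
      · exact (den_real p _ ha).trans (h4 a ha)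
  exact (key _ le_rfl).1

/-- The working form of the invariant rule: the number of iterations is named, and the step receives
the frame facts, so that the invariant `J` need only mention what the body changes. -/
theorem loop_spec {v : ℕ} {e : NExp} {p : LProg} {s : State} (N : ℕ) (J : ℕ → State → Prop)
    (hN : e.eval s = N) (zero : J 0 (s.setNat v 0 0))
    (succ : ∀ i t, i < N → t.nat v 0 = i →
      (∀ a, a ∉ v :: p.natWrites → t.nat a = s.nat a) →
      (∀ a, a ∉ p.realWrites → t.real a = s.real a) → J i t →
      J (i + 1) ((p.den t).setNat v 0 (i + 1))) :
    J N ((loop v e p).den s) := by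
  subst hN
  exact loop_induction J zero succ

/-- Connects denotations with machine runs. Array `0` is never written, so a loop bound keeps its
value during the loop and the `while` performs exactly that many rounds. -/
theorem exec_compile : ∀ (p : LProg), p.ok = true → 0 ∉ p.natWrites → ∀ (N : ℕ) (s : State),
    1 ≤ N → s.nat 0 0 ≤ N → s.nat 0 1 ≤ N → ∃ T, Exec p.compile s T (p.den s) ∧ T ≤ p.time N
  | skip, _, _, N, s, _, _, _ => ⟨1, .skip s, le_rfl⟩
  | setNat a i e, _, _, N, s, _, _, _ => ⟨_, .setNat a i e s, le_rfl⟩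
  | setReal a i e, _, _, N, s, _, _, _ => ⟨_, .setReal a i e s, le_rfl⟩
  | seq p q, h, hw, N, s, hN, h0, h1 => by
    simp only [ok, Bool.and_eq_true] at h
    simp only [natWrites, List.mem_append, not_or] at hw
    obtain ⟨T, hT, hT'⟩ := exec_compile p h.1 hw.1 N s hN h0 h1
    have hp := den_nat p s hw.1
    obtain ⟨T2, hT2, hT2'⟩ := exec_compile q h.2 hw.2 N (p.den s) hN (by rwa [hp]) (by rwa [hp])
    exact ⟨_, .seq hT hT2, Nat.add_le_add hT' hT2'⟩
  | ite b p q, h, hw, N, s, hN, h0, h1 => by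
    simp only [ok, Bool.and_eq_true] at h
    simp only [natWrites, List.mem_append, not_or] at hw
    by_cases hb : b.holds s
    · obtain ⟨T, hT, hT'⟩ := exec_compile p h.1 hw.1 N s hN h0 h1
      refine ⟨b.ops + T + 1, ?_, by simp only [time]; omega⟩
      simp only [den, if_pos hb]
      exact .iteTrue hb hT
    · obtain ⟨T, hT, hT'⟩ := exec_compile q h.2 hw.2 N s hN h0 h1
      refine ⟨b.ops + T + 1, ?_, by simp only [time]; omega⟩
      simp only [den, if_neg hb]
      exact .iteFalse hb hT
  | loop v e p, h, hw, N, s, hN, h0, h1 => by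
    simp only [ok, Bool.and_eq_true, Bool.not_eq_true', List.contains_eq_mem,
      decide_eq_false_iff_not] at h
    simp only [natWrites, List.mem_cons, not_or] at hw
    obtain ⟨⟨hp, he⟩, hv⟩ := h
    obtain ⟨hv0, hw⟩ := hw
    have ih := exec_compile p hp hw N
    set it : ℕ → State := fun i =>
      Nat.rec (s.setNat v 0 0) (fun i t => (p.den t).setNat v 0 (i + 1)) i with hit
    have hsucc : ∀ i, it (i + 1) = (p.den (it i)).setNat v 0 (i + 1) := fun i => rfl
    have hcnt : ∀ i, (it i).nat v 0 = i := by
      intro i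
      cases i <;> simp [hit, State.setNat_nat]
    have hfr : ∀ i, (it i).nat 0 = s.nat 0 := by
      intro i
      induction i with
      | zero => exact s.setNat_nat_ne hv0
      | succ i ih => rw [hsucc, State.setNat_nat_ne _ hv0, den_nat p _ hw, ih]
    have hev : ∀ i, e.eval (it i) = e.eval s := fun i =>
      NExp.eval_congr_of_isBound he (hfr i)
    set b : Test := .natLe (.add (.get v (.lit 0)) (.lit 1)) e with hb
    have hbops : b.ops = e.ops + 5 := by simp [hb, Test.ops, NExp.ops]; omega
    -- `d` rounds remain. A round costs the test (`e.ops + 5`), the body, the increment (6) and 1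
    -- for the `while`; the failing last test costs `e.ops + 6`.
    have hwhile : ∀ d i, i + d = e.eval s → ∃ T,
        Exec (.while b (.seq p.compile (incr v))) (it i) T (it (e.eval s)) ∧
          T ≤ d * (p.time N + e.ops + 12) + e.ops + 6 := by
      intro d
      induction d with
      | zero =>
        intro i hi
        obtain rfl : i = e.eval s := by omega
        refine ⟨b.ops + 1, .whileFalse ?_, by omega⟩
        simp [hb, Test.holds, NExp.eval, hcnt, hev]
      | succ d ihd =>
        intro i hi
        obtain ⟨T, hT, hT'⟩ := ih (it i) hN (by rwa [hfr]) (by rwa [hfr])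
        obtain ⟨T2, hT2, hT2'⟩ := ihd (i + 1) (by omega)
        have hin : Exec (incr v) (p.den (it i)) 6 (it (i + 1)) := by
          have := Exec.setNat v (.lit 0) (.add (.get v (.lit 0)) (.lit 1)) (p.den (it i))
          rw [hsucc]
          simpa [incr, NExp.ops, NExp.eval, den_nat p (it i) hv, hcnt] using this
        refine ⟨b.ops + (T + 6) + T2 + 1, .whileTrue ?_ (.seq hT hin) hT2, ?_⟩
        · simp [hb, Test.holds, NExp.eval, hcnt, hev]; omega
        · rw [Nat.succ_mul]; omega
    obtain ⟨T, hT, hT'⟩ := hwhile (e.eval s) 0 (by omega)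
    refine ⟨_, .seq (.setNat v (.lit 0) (.lit 0) s) hT, ?_⟩
    have := Nat.mul_le_mul_right (p.time N + e.ops + 12) (NExp.eval_le_weight he hN h0 h1)
    simp only [NExp.ops, time]
    omega

/-- A loop multiplies the time by a factor linear in `N`; the degree is not optimised. -/
theorem time_le_pow : ∀ p : LProg, ∃ K d, ∀ N, 1 ≤ N → p.time N ≤ K * N ^ d
  | skip => ⟨1, 0, by simp [time]⟩
  | setNat a i e => ⟨i.ops + e.ops + 1, 0, by simp [time]⟩
  | setReal a i e => ⟨i.ops + e.ops + 1, 0, by simp [time]⟩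
  | seq p q => by
    obtain ⟨K, d, h⟩ := time_le_pow p
    obtain ⟨K', d', h'⟩ := time_le_pow q
    refine ⟨K + K', d + d', fun N hN => ?_⟩
    have h1 : N ^ d ≤ N ^ (d + d') := Nat.pow_le_pow_right hN (by omega)
    have h2 : N ^ d' ≤ N ^ (d + d') := Nat.pow_le_pow_right hN (by omega)
    simp only [time, Nat.add_mul]
    exact Nat.add_le_add ((h N hN).trans (Nat.mul_le_mul_left _ h1))
      ((h' N hN).trans (Nat.mul_le_mul_left _ h2))
  | ite b p q => by
    obtain ⟨K, d, h⟩ := time_le_pow p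
    obtain ⟨K', d', h'⟩ := time_le_pow q
    refine ⟨K + K' + (b.ops + 1), d + d', fun N hN => ?_⟩
    have h1 : N ^ d ≤ N ^ (d + d') := Nat.pow_le_pow_right hN (by omega)
    have h2 : N ^ d' ≤ N ^ (d + d') := Nat.pow_le_pow_right hN (by omega)
    have h3 := (h N hN).trans (Nat.mul_le_mul_left _ h1)
    have h4 := (h' N hN).trans (Nat.mul_le_mul_left _ h2)
    have h5 : b.ops + 1 ≤ (b.ops + 1) * N ^ (d + d') :=
      Nat.le_mul_of_pos_right _ (Nat.pow_pos hN)
    simp only [time, Nat.add_mul] at h5 ⊢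
    omega
  | loop v e p => by
    obtain ⟨K, d, h⟩ := time_le_pow p
    refine ⟨e.ops + 10 + e.weight * (K + (e.ops + 12)), d + 1, fun N hN => ?_⟩
    have h1 : 1 ≤ N ^ d := Nat.pow_pos hN
    have h2 : 1 ≤ N ^ (d + 1) := Nat.pow_pos hN
    have h3 : p.time N + e.ops + 12 ≤ (K + (e.ops + 12)) * N ^ d := by
      have := Nat.le_mul_of_pos_right (e.ops + 12) h1
      have := h N hN
      rw [Nat.add_mul]
      omega
    calc e.ops + 10 + e.weight * N * (p.time N + e.ops + 12)
        ≤ (e.ops + 10) * N ^ (d + 1) + e.weight * N * ((K + (e.ops + 12)) * N ^ d) :=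
          Nat.add_le_add (Nat.le_mul_of_pos_right _ h2) (Nat.mul_le_mul_left _ h3)
      _ = _ := by ring

end LProg
end RAM

/-! ### Families of sets: components and prefixes -/

namespace SetFamily

open Finset

variable {P : Type*} [DecidableEq P]

/-- The union of the family `F` has at least `n` connected components. -/
def CompsGE (B : ℕ → Finset P) (F : Finset ℕ) (n : ℕ) : Prop :=
  ∃ g : P → ℕ, (∀ q ∈ F, ∀ x ∈ B q, ∀ y ∈ B q, g x = g y) ∧ n ≤ ((F.biUnion B).image g).card

/-- A set carries a single value of the labelling, so removing it loses at most one component. -/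
theorem CompsGE.of_insert {B : ℕ → Finset P} {F : Finset ℕ} {e n : ℕ}
    (h : CompsGE B (insert e F) (n + 1)) : CompsGE B F n := by
  obtain ⟨g, h1, h2⟩ := h
  refine ⟨g, fun q hq => h1 q (mem_insert_of_mem hq), ?_⟩
  have h3 : ((insert e F).biUnion B).image g ⊆ (B e).image g ∪ (F.biUnion B).image g := by
    rw [biUnion_insert, image_union]
  have h4 : ((B e).image g).card ≤ 1 := by
    rw [card_le_one]
    intro a ha b hb
    obtain ⟨x, hx, rfl⟩ := mem_image.1 ha
    obtain ⟨y, hy, rfl⟩ := mem_image.1 hb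
    exact h1 e (mem_insert_self _ _) x hx y hy
  have := (card_le_card h3).trans (card_union_le _ _)
  omega

/-- A set that meets the others contributes no new label value; hence a set which raises the number
of components is isolated. -/
theorem CompsGE.disjoint_of_insert {B : ℕ → Finset P} {F : Finset ℕ} {e n : ℕ}
    (h : CompsGE B (insert e F) n) (hF : ¬ CompsGE B F n) : Disjoint (B e) (F.biUnion B) := by
  by_contra hd
  obtain ⟨g, h1, h2⟩ := h
  obtain ⟨z, hz, hz'⟩ := not_disjoint_iff.1 hd
  refine hF ⟨g, fun q hq => h1 q (mem_insert_of_mem hq), h2.trans (card_le_card ?_)⟩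
  intro a ha
  obtain ⟨x, hx, rfl⟩ := mem_image.1 ha
  rw [biUnion_insert, mem_union] at hx
  rcases hx with hx | hx
  · exact mem_image.2 ⟨z, hz', h1 e (mem_insert_self _ _) z hz x hx⟩
  · exact mem_image_of_mem g hx

/-- Every member of `F` meets a member of `M`, so each label value occurs on a member of `M`. This
turns a number of components into a number of disjoint balls. -/
theorem CompsGE.le_card {B : ℕ → Finset P} {F M : Finset ℕ} {n : ℕ} (h : CompsGE B F n)
    (hM : M ⊆ F) (hne : ∀ q ∈ M, (B q).Nonempty)
    (hint : ∀ q ∈ F, ∃ p ∈ M, ¬ Disjoint (B q) (B p)) : n ≤ M.card := by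
  obtain ⟨g, h1, h2⟩ := h
  classical
  refine h2.trans ?_
  have : (F.biUnion B).image g ⊆
      M.image (fun q => if hq : (B q).Nonempty then g hq.choose else 0) := by
    intro a ha
    obtain ⟨x, hx, rfl⟩ := mem_image.1 ha
    obtain ⟨q, hq, hxq⟩ := mem_biUnion.1 hx
    obtain ⟨p, hp, hd⟩ := hint q hq
    obtain ⟨z, hz, hz'⟩ := not_disjoint_iff.1 hd
    refine mem_image.2 ⟨p, hp, ?_⟩
    rw [dif_pos (hne p hp)]
    rw [h1 p (hM hp) _ (hne p hp).choose_spec z hz', h1 q hq z hz x hxq]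
  exact (card_le_card this).trans card_image_le

/-- A maximal disjoint subfamily in which every set of the family meets a set at least as large. -/
theorem exists_disjoint_subfamily (B : ℕ → Finset P) (r : ℕ → ℝ) (F : Finset ℕ)
    (hne : ∀ q ∈ F, (B q).Nonempty) :
    ∃ M ⊆ F, (∀ p ∈ M, ∀ q ∈ M, p ≠ q → Disjoint (B p) (B q)) ∧
      ∀ q ∈ F, ∃ p ∈ M, ¬ Disjoint (B q) (B p) ∧ r q ≤ r p := by
  -- This induction adds the sets in order of decreasing `r`: the greedy choice.
  induction F using Finset.induction_on_min_value r with
  | empty => exact ⟨∅, by simp⟩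
  | insert a s ha hmin ih =>
    obtain ⟨M, hM, h1, h2⟩ := ih fun q hq => hne q (mem_insert_of_mem hq)
    by_cases hd : ∃ p ∈ M, ¬ Disjoint (B a) (B p)
    · refine ⟨M, hM.trans (subset_insert _ _), h1, fun q hq => ?_⟩
      rcases mem_insert.1 hq with rfl | hq
      · obtain ⟨p, hp, hp'⟩ := hd
        exact ⟨p, hp, hp', hmin p (hM hp)⟩
      · exact h2 q hq
    · push Not at hd
      refine ⟨insert a M, insert_subset_insert _ hM, ?_, fun q hq => ?_⟩
      · intro p hp q hq hpq
        rcases mem_insert.1 hp with rfl | hp' <;> rcases mem_insert.1 hq with rfl | hq'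
        · exact absurd rfl hpq
        · exact hd q hq'
        · exact (hd p hp').symm
        · exact h1 p hp' q hq' hpq
      · rcases mem_insert.1 hq with rfl | hq
        · refine ⟨q, mem_insert_self _ _, ?_, le_rfl⟩
          rw [disjoint_self]
          exact (hne q (mem_insert_self _ _)).ne_empty
        · obtain ⟨p, hp, hp'⟩ := h2 q hq
          exact ⟨p, mem_insert_of_mem hp, hp'⟩

/-! ### Prefixes of an ordered family, and the crossing of the number of components. -/

variable [Fintype P] {O : Type*} [LinearOrder O]

/-- The number of points not covered by the family `F`. -/
def unc (B : ℕ → Finset P) (F : Finset ℕ) : ℕ := ((F.biUnion B)ᶜ).card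

theorem unc_anti {B : ℕ → Finset P} {F G : Finset ℕ} (h : F ⊆ G) : unc B G ≤ unc B F :=
  card_le_card (compl_subset_compl.2 (biUnion_subset_biUnion_of_subset_left B h))

/-- The members of `H` with smaller key than `x`. -/
def pre (κ : ℕ → O) (H : Finset ℕ) (x : ℕ) : Finset ℕ := H.filter fun q => κ q < κ x

/-- The members of `H` at which more than `m` points are not covered by earlier members. -/
def early (B : ℕ → Finset P) (κ : ℕ → O) (m : ℕ) (H : Finset ℕ) : Finset ℕ :=
  H.filter fun q => m < unc B (pre κ H q)

section Prefix

variable {B : ℕ → Finset P} {κ : ℕ → O} {m : ℕ} {H : Finset ℕ}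

theorem pre_subset {x : ℕ} : pre κ H x ⊆ H := filter_subset _ _

theorem pre_mono {x y : ℕ} (h : κ x ≤ κ y) : pre κ H x ⊆ pre κ H y := fun q hq => by
  simp only [pre, mem_filter] at hq ⊢
  exact ⟨hq.1, hq.2.trans_le h⟩

theorem mem_early_of_le {x y : ℕ} (hy : y ∈ early B κ m H) (hx : x ∈ H) (h : κ x ≤ κ y) :
    x ∈ early B κ m H := by
  simp only [early, mem_filter] at hy ⊢
  exact ⟨hx, hy.2.trans_le (unc_anti (pre_mono h))⟩

theorem exists_pre_eq_insert (hκ : Function.Injective κ) {x : ℕ}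
    (h : (pre κ H x).Nonempty) :
    ∃ z ∈ pre κ H x, (∀ q ∈ pre κ H x, κ q ≤ κ z) ∧ pre κ H x = insert z (pre κ H z) := by
  obtain ⟨z, hz, hmax⟩ := exists_max_image _ κ h
  refine ⟨z, hz, hmax, ?_⟩
  ext q
  simp only [pre, mem_insert, mem_filter] at hz hmax ⊢
  constructor
  · rintro ⟨hq, hqx⟩
    rcases (hmax q ⟨hq, hqx⟩).lt_or_eq with h | h
    · exact .inr ⟨hq, h⟩
    · exact .inl (hκ h)
  · rintro (rfl | ⟨hq, hqz⟩)
    · exact hz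
    · exact ⟨hq, hqz.trans hz.2⟩

theorem early_nonempty (hm : m < Fintype.card P) (hH : unc B H ≤ m) :
    (early B κ m H).Nonempty := by
  have hne : H.Nonempty := by
    rw [nonempty_iff_ne_empty]
    rintro rfl
    simp [unc, card_univ] at hH
    omega
  obtain ⟨x, hx, hmin⟩ := exists_min_image H κ hne
  refine ⟨x, mem_filter.2 ⟨hx, ?_⟩⟩
  have : pre κ H x = ∅ := filter_eq_empty_iff.2 fun q hq => (hmin q hq).not_gt
  simpa [this, unc, card_univ] using hm

/-- All members before the first member that is not early are early, and they already leave at most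
`m` points uncovered. -/
theorem unc_early_le (hH : unc B H ≤ m) : unc B (early B κ m H) ≤ m := by
  rcases (H \ early B κ m H).eq_empty_or_nonempty with h | h
  · exact (unc_anti (sdiff_eq_empty_iff_subset.1 h)).trans hH
  · obtain ⟨x, hx, hmin⟩ := exists_min_image _ κ h
    rw [mem_sdiff] at hx
    have h1 : pre κ H x ⊆ early B κ m H := by
      intro q hq
      by_contra hq'
      rw [pre, mem_filter] at hq
      exact (hmin q (mem_sdiff.2 ⟨hq.1, hq'⟩)).not_gt hq.2
    have h2 : unc B (pre κ H x) ≤ m := by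
      by_contra h3
      exact hx.2 (mem_filter.2 ⟨hx.1, not_le.1 h3⟩)
    exact (unc_anti h1).trans h2

/-- The early members form an initial segment. Without its last member `l` it still leaves more than
`m` points uncovered, as the dual bound requires; with `l` it leaves at most `m`. -/
theorem exists_early_eq_insert (hκ : Function.Injective κ) (hm : m < Fintype.card P)
    (hH : unc B H ≤ m) :
    ∃ l ∈ early B κ m H, (∀ q ∈ early B κ m H, κ q ≤ κ l) ∧
      early B κ m H = insert l (pre κ H l) := by
  obtain ⟨l, hl, hmax⟩ := exists_max_image _ κ (early_nonempty (κ := κ) hm hH)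
  refine ⟨l, hl, hmax, ?_⟩
  ext q
  simp only [mem_insert, pre, mem_filter]
  constructor
  · intro hq
    rcases (hmax q hq).lt_or_eq with h | h
    · exact .inr ⟨(mem_filter.1 hq).1, h⟩
    · exact .inl (hκ h)
  · rintro (rfl | ⟨hq, hql⟩)
    · exact hl
    · exact mem_early_of_le hl hq hql.le

theorem exists_next (hκ : Function.Injective κ) {x l : ℕ} (hx : x ∈ early B κ m H)
    (hl : l ∈ early B κ m H) (hxl : κ x < κ l) :
    ∃ y ∈ early B κ m H, pre κ H y = insert x (pre κ H x) := by
  obtain ⟨y, hy, hmin⟩ := exists_min_image (H.filter fun q => κ x < κ q) κ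
    ⟨l, mem_filter.2 ⟨(mem_filter.1 hl).1, hxl⟩⟩
  have hyl := hmin l (mem_filter.2 ⟨(mem_filter.1 hl).1, hxl⟩)
  rw [mem_filter] at hy
  refine ⟨y, mem_early_of_le hl hy.1 hyl, ?_⟩
  ext q
  simp only [mem_insert, pre, mem_filter]
  constructor
  · rintro ⟨hq, hqy⟩
    rcases lt_trichotomy (κ q) (κ x) with h | h | h
    · exact .inr ⟨hq, h⟩
    · exact .inl (hκ h)
    · exact absurd hqy (hmin q (mem_filter.2 ⟨hq, h⟩)).not_gt
  · rintro (rfl | ⟨hq, hqx⟩)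
    · exact ⟨(mem_filter.1 hx).1, hy.2⟩
    · exact ⟨hq, hqx.trans hy.2⟩

theorem pre_insert_of_lt {b x : ℕ} (h : κ b < κ x) :
    pre κ (insert b H) x = insert b (pre κ H x) := by
  rw [pre, filter_insert, if_pos h]; rfl

theorem pre_insert_of_le {b x : ℕ} (h : κ x ≤ κ b) :
    pre κ (insert b H) x = pre κ H x := by
  rw [pre, filter_insert, if_neg h.not_gt]; rfl

end Prefix

/-- A prefix `D` of `W` which leaves more than `m` points uncovered and has at least `k`
components, and a prefix of `W'` which equals `D` up to an isolated set, and which together with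
two sets of `A` leaves at most `m` points uncovered and has at most `k` components. -/
def Balanced (B : ℕ → Finset P) (κ : ℕ → O) (m k : ℕ) (A W W' : Finset ℕ) : Prop :=
  ∃ y ∈ W, ∃ x ∈ W', ∃ e₁ ∈ A, ∃ e₂ ∈ A, m < unc B (pre κ W y) ∧
    CompsGE B (pre κ W y) k ∧
    (pre κ W y = pre κ W' x ∨ ∃ d, pre κ W y = insert d (pre κ W' x) ∧
      Disjoint (B d) ((pre κ W' x).biUnion B)) ∧
    unc B (insert e₁ (insert e₂ (pre κ W' x))) ≤ m ∧
    ¬ CompsGE B (insert e₁ (insert e₂ (pre κ W' x))) (k + 1)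

/-- Write T and T' for the early members before and after the insertion. The new set `b` is early,
and the members of T outside T' form an upper segment of T, at each of which `b` together with the
prefix covers enough (`hy1`). Hence `insert b (insert x (pre κ H x))`, for x in T \ T', leads from
T' to `insert b T` one set at a time, and some step of the way from T to T' crosses `k`. A set whose
addition raises the count is isolated; this is the exceptional set in `Balanced`. -/
theorem exists_balanced_of_insert {B : ℕ → Finset P} {κ : ℕ → O} (hκ : Function.Injective κ)
    {m k b : ℕ} {H : Finset ℕ} (hb : b ∉ H) (hm : m < Fintype.card P) (hH : unc B H ≤ m)
    (hcross : (CompsGE B (early B κ m H) (k + 1) ∧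
        ¬ CompsGE B (early B κ m (insert b H)) (k + 1)) ∨
      (¬ CompsGE B (early B κ m H) (k + 1) ∧ CompsGE B (early B κ m (insert b H)) (k + 1))) :
    ∃ W W', (W = H ∨ W = insert b H) ∧ (W' = H ∨ W' = insert b H) ∧ 
      Balanced B κ m k (insert b H) W W' := by
  set H' := insert b H with hH'
  set T := early B κ m H with hT
  set T' := early B κ m H' with hT'
  have hTH : T ⊆ H := filter_subset _ _
  have hTH' : ∀ {q}, q ∈ T → q ∈ H' := fun hq => mem_insert_of_mem (hTH hq)
  have hbH' : b ∈ H' := mem_insert_self _ _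
  have hbT : b ∉ T := fun h => hb (hTH h)
  have hpb : pre κ H' b = pre κ H b := pre_insert_of_le le_rfl
  have hpsub : ∀ x, pre κ H x ⊆ pre κ H' x := fun x => filter_subset_filter _ (subset_insert _ _)
  have hT'T : ∀ x ∈ T', x ≠ b → x ∈ T := by
    intro x hx hxb
    rw [hT', early, mem_filter] at hx
    rw [hT, early, mem_filter]
    exact ⟨(mem_insert.1 hx.1).resolve_left hxb, hx.2.trans_le (unc_anti (hpsub x))⟩
  -- If `b` were not early, at most `m` points would be uncovered before it, the early members would
  -- not change, and there would be no crossing.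
  have hbT' : b ∈ T' := by
    by_contra hbT'
    have hub : unc B (pre κ H b) ≤ m := by
      by_contra h
      exact hbT' (mem_filter.2 ⟨mem_insert_self _ _, by rw [hpb]; omega⟩)
    have : T' = T := by
      ext x
      refine ⟨fun hx => hT'T x hx fun h => hbT' (h ▸ hx), fun hx => ?_⟩
      rw [hT, early, mem_filter] at hx
      refine mem_filter.2 ⟨mem_insert_of_mem hx.1, ?_⟩
      rcases le_or_gt (κ x) (κ b) with h | h
      · rw [pre_insert_of_le h]; exact hx.2
      · have := unc_anti (B := B) (pre_mono (H := H) h.le)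
        omega
    rw [this] at hcross
    tauto
  have hTm : unc B T ≤ m := unc_early_le hH
  obtain ⟨l, hlT, hlmax, hTl⟩ := exists_early_eq_insert hκ hm hH
  rw [← hT] at hlT hlmax hTl
  have hpreT : ∀ x ∈ T, m < unc B (pre κ H x) := fun x hx => (mem_filter.1 hx).2
  -- members of `T` outside `T'`
  have hy1 : ∀ x ∈ T, x ∉ T' → κ b < κ x ∧ unc B (insert b (pre κ H x)) ≤ m := by
    intro x hx hx'
    have h1 : unc B (pre κ H' x) ≤ m := by
      by_contra h
      exact hx' (mem_filter.2 ⟨mem_insert_of_mem (hTH hx), by omega⟩)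
    rcases le_or_gt (κ x) (κ b) with h | h
    · rw [pre_insert_of_le h] at h1
      have := hpreT x hx
      omega
    · rw [pre_insert_of_lt h] at h1
      exact ⟨h, h1⟩
  have hup : ∀ x ∈ T, x ∉ T' → ∀ z ∈ T, κ x ≤ κ z → z ∉ T' := fun x hx hx' z hz hxz hz' =>
    hx' (mem_early_of_le hz' (mem_insert_of_mem (hTH hx)) hxz)
  -- The first member `x` of T \ T' has exactly T' without `b` before it; any other one has an
  -- immediate predecessor in T \ T'.
  have hdich : ∀ x ∈ T, x ∉ T' → insert b (pre κ H x) = T' ∨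
      ∃ z ∈ T, z ∉ T' ∧ κ z < κ x ∧ pre κ H x = insert z (pre κ H z) := by
    intro x hx hx'
    have hxT : ∀ q ∈ pre κ H x, q ∈ T := fun q hq => by
      rw [pre, mem_filter] at hq
      exact mem_early_of_le hx hq.1 hq.2.le
    by_cases h : ∃ z ∈ pre κ H x, z ∉ T'
    · right
      obtain ⟨z, hz, hz'⟩ := h
      obtain ⟨w, hw, hwmax, hweq⟩ := exists_pre_eq_insert hκ ⟨z, hz⟩
      exact ⟨w, hxT w hw, hup z (hxT z hz) hz' w (hxT w hw) (hwmax z hz), (mem_filter.1 hw).2, hweq⟩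
    · left
      push Not at h
      ext q
      rw [mem_insert]
      constructor
      · rintro (rfl | hq)
        exacts [hbT', h q hq]
      · intro hq
        by_cases hqb : q = b
        · exact .inl hqb
        · right
          have hqT := hT'T q hq hqb
          refine mem_filter.2 ⟨hTH hqT, ?_⟩
          by_contra hlt
          exact hup x hx hx' q hqT (not_lt.1 hlt) hq
  rcases hcross with ⟨hge, hlt⟩ | ⟨hlt, hge⟩
  · have hlk : CompsGE B (pre κ H l) k := by
      rw [hTl] at hge
      exact hge.of_insert
    -- If `insert b T` already has at most `k` components, the prefix before `l` with the extra sets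
    -- `b` and `l` will do.
    by_cases hbT2 : CompsGE B (insert b T) (k + 1)
    · have hlT' : l ∉ T' := by
        intro hl'
        have : T' = insert b T := by
          ext q
          rw [mem_insert]
          refine ⟨fun hq => ?_, ?_⟩
          · by_cases hqb : q = b
            exacts [.inl hqb, .inr (hT'T q hq hqb)]
          · rintro (rfl | hq)
            · exact hbT'
            · exact mem_early_of_le hl' (mem_insert_of_mem (hTH hq)) (hlmax q hq)
        rw [this] at hlt
        exact hlt hbT2
      classical
      -- At the first `x` whose addition brings the count above `k`, the prefix before `x` together
      -- with `b` is feasible, and `x` is isolated from it. The prefix through `x` has at least `k`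
      -- components and is the prefix of the next early member, if there is one.
      obtain ⟨x, hx, hmin⟩ := exists_min_image (T.filter fun x => x ∉ T' ∧
        CompsGE B (insert b (insert x (pre κ H x))) (k + 1)) κ
        ⟨l, mem_filter.2 ⟨hlT, hlT', by rwa [← hTl]⟩⟩
      rw [mem_filter] at hx
      obtain ⟨hxT, hxT', hxk⟩ := hx
      have hnot : ¬ CompsGE B (insert b (pre κ H x)) (k + 1) := by
        rcases hdich x hxT hxT' with h | ⟨z, hz, hz', hzx, h⟩
        · rwa [h]
        · intro hc
          rw [h] at hc
          exact (hmin z (mem_filter.2 ⟨hz, hz', hc⟩)).not_gt hzx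
      have hdis : Disjoint (B x) ((insert b (pre κ H x)).biUnion B) := by
        rw [insert_comm] at hxk
        exact hxk.disjoint_of_insert hnot
      have hdis' : Disjoint (B x) ((pre κ H x).biUnion B) :=
        hdis.mono_right (biUnion_subset_biUnion_of_subset_left B (subset_insert _ _))
      have hcov : unc B (insert b (insert b (pre κ H x))) ≤ m := by
        simpa using (hy1 x hxT hxT').2
      have hcomp : ¬ CompsGE B (insert b (insert b (pre κ H x))) (k + 1) := by simpa using hnot
      rcases (hlmax x hxT).lt_or_eq with hxl | hxl
      · obtain ⟨y, hy, hyeq⟩ := exists_next hκ hxT hlT hxl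
        exact ⟨H, H, .inl rfl, .inl rfl, y, hTH hy, x, hTH hxT, b, hbH', b, hbH', hpreT y hy,
          by rw [hyeq]; exact hxk.of_insert, .inr ⟨x, hyeq, hdis'⟩, hcov, hcomp⟩
      · obtain rfl := hκ hxl
        exact ⟨H, H, .inl rfl, .inl rfl, x, hTH hxT, x, hTH hxT, b, hbH', b, hbH', hpreT x hxT,
          hlk, .inl rfl, hcov, hcomp⟩
    · exact ⟨H, H, .inl rfl, .inl rfl, l, hTH hlT, l, hTH hlT, b, hbH', l, hTH' hlT, hpreT l hlT,
        hlk, .inl rfl, by rw [← hTl]; exact (unc_anti (subset_insert _ _)).trans hTm,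
        by rwa [← hTl]⟩
  · have hcovl : unc B (insert l (insert l (pre κ H l))) ≤ m := by
      rwa [insert_eq_of_mem (mem_insert_self _ _), ← hTl]
    have hcompl : ¬ CompsGE B (insert l (insert l (pre κ H l))) (k + 1) := by
      rwa [insert_eq_of_mem (mem_insert_self _ _), ← hTl]
    by_cases hY : ∃ x ∈ T, x ∉ T'
    · obtain ⟨x₀, hx₀, hx₀'⟩ := hY
      have hlT' : l ∉ T' := hup x₀ hx₀ hx₀' l hlT (hlmax x₀ hx₀)
      classical
      -- The first `x` at which the count falls to `k`: until then `b` with the prefix has more than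
      -- `k` components, so the prefix alone has at least `k`. If there is no such `x`, the same
      -- holds at `l`, and T itself is the feasible family.
      rcases (T.filter fun x => x ∉ T' ∧
        ¬ CompsGE B (insert b (insert x (pre κ H x))) (k + 1)).eq_empty_or_nonempty with hem | hem
      · have hall : ∀ z ∈ T, z ∉ T' → CompsGE B (insert b (insert z (pre κ H z))) (k + 1) := by
          intro z hz hz'
          by_contra hc
          exact filter_eq_empty_iff.1 hem hz ⟨hz', hc⟩
        have hlk : CompsGE B (insert b (pre κ H l)) (k + 1) := by
          rcases hdich l hlT hlT' with h | ⟨z, hz, hz', -, h⟩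
          · rwa [h]
          · rw [h]; exact hall z hz hz'
        exact ⟨H, H, .inl rfl, .inl rfl, l, hTH hlT, l, hTH hlT, l, hTH' hlT, l, hTH' hlT,
          hpreT l hlT, hlk.of_insert, .inl rfl, hcovl, hcompl⟩
      · obtain ⟨x, hx, hmin⟩ := exists_min_image _ κ hem
        rw [mem_filter] at hx
        obtain ⟨hxT, hxT', hxk⟩ := hx
        have hxk' : CompsGE B (insert b (pre κ H x)) (k + 1) := by
          rcases hdich x hxT hxT' with h | ⟨z, hz, hz', hzx, h⟩
          · rwa [h]
          · by_contra hc
            rw [h] at hc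
            exact (hmin z (mem_filter.2 ⟨hz, hz', hc⟩)).not_gt hzx
        exact ⟨H, H, .inl rfl, .inl rfl, x, hTH hxT, x, hTH hxT, b, hbH', x, hTH' hxT,
          hpreT x hxT, hxk'.of_insert, .inl rfl,
          (unc_anti (insert_subset_insert _ (subset_insert _ _))).trans (hy1 x hxT hxT').2, hxk⟩
    · push Not at hY
      have hTeq : T' = insert b T := by
        ext q
        rw [mem_insert]
        refine ⟨fun hq => ?_, ?_⟩
        · by_cases hqb : q = b
          exacts [.inl hqb, .inr (hT'T q hq hqb)]
        · rintro (rfl | hq)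
          exacts [hbT', hY q hq]
      -- Otherwise all of T would precede `b`, leaving at most `m` points uncovered before the early
      -- member `b`.
      have hbl : κ b < κ l := by
        by_contra hc
        have h1 : T ⊆ pre κ H b := fun q hq => mem_filter.2 ⟨hTH hq,
          ((hlmax q hq).trans (not_lt.1 hc)).lt_of_ne fun h => hbT (hκ h ▸ hq)⟩
        have h2 := (mem_filter.1 hbT').2
        rw [hpb] at h2
        have := unc_anti (B := B) h1
        omega
      have hpl : pre κ H' l = insert b (pre κ H l) := pre_insert_of_lt hbl
      rw [hTeq] at hge
      have hdis := hge.disjoint_of_insert hlt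
      -- Here `b` itself raised the count and is isolated: the prefix of `l` after the insertion is
      -- the old prefix plus `b`, and the old prefix plus `l` is T.
      refine ⟨H', H, .inr rfl, .inl rfl, l, hTH' hlT, l, hTH hlT, l, hTH' hlT, l, hTH' hlT,
        (mem_filter.1 (hY l hlT)).2, ?_, .inr ⟨b, hpl, hdis.mono_right
          (biUnion_subset_biUnion_of_subset_left B fun q hq => ?_)⟩, hcovl, hcompl⟩
      · rw [hpl]
        rw [hTl, insert_comm] at hge
        exact hge.of_insert
      · rw [hTl]; exact mem_insert_of_mem hq

theorem exists_crossing {p : ℕ → Prop} {n : ℕ} (h0 : p 0) (hn : ¬ p n) :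
    ∃ i < n, p i ∧ ¬ p (i + 1) := by
  by_contra! h
  have : ∀ i, i ≤ n → p i := fun i => by
    induction i with
    | zero => exact fun _ => h0
    | succ i ih => exact fun hi => h i hi (ih (by omega))
  exact hn (this n le_rfl)

/-- The members of `A` between `a` and `b`. -/
def window (A : Finset ℕ) (a b : ℕ) : Finset ℕ := A.filter fun q => a ≤ q ∧ q ≤ b

/-- The window grows from the first run to both runs and then shrinks to the second; a deletion is
an insertion read backwards. Every window on the way contains one of the two runs entirely, so it
leaves at most `m` points uncovered and is usable in `dual_bound`. -/
theorem exists_balanced_window {B : ℕ → Finset P} {κ : ℕ → O} (hκ : Function.Injective κ)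
    {m k n : ℕ} (hn : 0 < n) {A : Finset ℕ}
    (hm : m < Fintype.card P)
    (h1 : unc B (window A 0 (n - 1)) ≤ m) (h2 : unc B (window A n (n + n - 1)) ≤ m)
    (hc1 : CompsGE B (early B κ m (window A 0 (n - 1))) (k + 1))
    (hc2 : ¬ CompsGE B (early B κ m (window A n (n + n - 1))) (k + 1)) :
    ∃ a b a' b', a < n + n ∧ b < n + n ∧ a' < n + n ∧ b' < n + n ∧
      ((a = 0 ∧ n - 1 ≤ b) ∨ (a ≤ n ∧ b = n + n - 1)) ∧
      Balanced B κ m k A (window A a b) (window A a' b') := by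
  have key : ∀ a b a' b' c, a < n + n → b < n + n → a' < n + n → b' < n + n →
      ((a = 0 ∧ n - 1 ≤ b) ∨ (a ≤ n ∧ b = n + n - 1)) →
      ((a' = 0 ∧ n - 1 ≤ b') ∨ (a' ≤ n ∧ b' = n + n - 1)) →
      c ∉ window A a b → window A a' b' = insert c (window A a b) →
      ((CompsGE B (early B κ m (window A a b)) (k + 1) ∧
        ¬ CompsGE B (early B κ m (window A a' b')) (k + 1)) ∨
      (¬ CompsGE B (early B κ m (window A a b)) (k + 1) ∧
        CompsGE B (early B κ m (window A a' b')) (k + 1))) →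
      ∃ a b a' b', a < n + n ∧ b < n + n ∧ a' < n + n ∧ b' < n + n ∧
      ((a = 0 ∧ n - 1 ≤ b) ∨ (a ≤ n ∧ b = n + n - 1)) ∧
      Balanced B κ m k A (window A a b) (window A a' b') := by
    intro a b a' b' c ha hb ha' hb' hab hab' hc heq hcr
    have hcov : unc B (window A a b) ≤ m := by
      rcases hab with h | h
      · refine (unc_anti fun q hq => ?_).trans h1
        simp only [window, mem_filter] at hq ⊢
        exact ⟨hq.1, by omega⟩
      · refine (unc_anti fun q hq => ?_).trans h2
        simp only [window, mem_filter] at hq ⊢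
        exact ⟨hq.1, by omega⟩
    rw [heq] at hcr
    obtain ⟨W, W', hW, hW', y, hy, x, hx, e₁, he₁, e₂, he₂, hrest⟩ :=
      exists_balanced_of_insert hκ hc hm hcov hcr
    have hsub : insert c (window A a b) ⊆ A := by rw [← heq]; exact filter_subset _ _
    have hbal : Balanced B κ m k A W W' :=
      ⟨y, hy, x, hx, e₁, hsub he₁, e₂, hsub he₂, hrest⟩
    rw [← heq] at hW hW'
    rcases hW with rfl | rfl <;> rcases hW' with rfl | rfl
    · exact ⟨a, b, a, b, ha, hb, ha, hb, hab, hbal⟩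
    · exact ⟨a, b, a', b', ha, hb, ha', hb', hab, hbal⟩
    · exact ⟨a', b', a, b, ha', hb', ha, hb, hab', hbal⟩
    · exact ⟨a', b', a', b', ha', hb', ha', hb', hab', hbal⟩
  by_cases hmid : CompsGE B (early B κ m (window A 0 (n + n - 1))) (k + 1)
  · obtain ⟨i, hi, hp, hnp⟩ := exists_crossing
      (p := fun i => CompsGE B (early B κ m (window A i (n + n - 1))) (k + 1)) hmid hc2
    by_cases hiA : i ∈ A
    · refine key (i + 1) (n + n - 1) i (n + n - 1) i (by omega) (by omega) (by omega) (by omega)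
        (.inr ⟨by omega, rfl⟩) (.inr ⟨by omega, rfl⟩) (by simp [window]) ?_ (.inr ⟨hnp, hp⟩)
      ext q
      simp only [window, mem_filter, mem_insert]
      constructor
      · rintro ⟨h, h'⟩
        by_cases hq : q = i
        · exact .inl hq
        · exact .inr ⟨h, by omega⟩
      · rintro (rfl | h)
        · exact ⟨hiA, by omega⟩
        · exact ⟨h.1, by omega⟩
    · refine absurd hp ?_
      convert hnp using 3
      ext q
      simp only [window, mem_filter]
      refine and_congr_right fun h => ?_
      have : q ≠ i := fun h' => hiA (h' ▸ h)
      omega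
  · obtain ⟨i, hi, hp, hnp⟩ := exists_crossing (n := n)
      (p := fun i => CompsGE B (early B κ m (window A 0 (n - 1 + i))) (k + 1)) hc1
      (by rwa [show n - 1 + n = n + n - 1 by omega])
    by_cases hiA : n + i ∈ A
    · refine key 0 (n - 1 + i) 0 (n - 1 + (i + 1)) (n + i) (by omega) (by omega) (by omega)
        (by omega) (.inl ⟨rfl, by omega⟩) (.inl ⟨rfl, by omega⟩) (by simp [window]; omega) ?_
        (.inl ⟨hp, hnp⟩)
      ext q
      simp only [window, mem_filter, mem_insert]
      constructor
      · rintro ⟨h, h'⟩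
        by_cases hq : q = n + i
        · exact .inl hq
        · exact .inr ⟨h, by omega⟩
      · rintro (rfl | h)
        · exact ⟨hiA, by omega⟩
        · exact ⟨h.1, by omega⟩
    · refine absurd hp ?_
      convert hnp using 3
      ext q
      simp only [window, mem_filter]
      refine and_congr_right fun h => ?_
      have : q ≠ n + i := fun h' => hiA (h' ▸ h)
      omega

end SetFamily

/-! ### Balls, runs of the primal-dual method, and the dual bound -/

namespace LBkSRO

open Finset SetFamily

variable (I : LBkSRO)

/-- The distance between a facility and a client. -/
def d (i : Fin I.nF) (j : Fin I.nD) : ℝ := I.c (.inl i) (.inr j)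

theorem d_nonneg (i : Fin I.nF) (j : Fin I.nD) : 0 ≤ I.d i j :=
  @dist_nonneg _ I.metric (.inl i) (.inr j)

/-- A ball is given by its centre and by a client on its boundary. -/
abbrev Ball : Type := Fin I.nF × Fin I.nD

/-- The radius of a ball. -/
def rad (v : I.Ball) : ℝ := I.d v.1 v.2

/-- The clients in a ball. -/
noncomputable def pts (v : I.Ball) : Finset (Fin I.nD) :=
  univ.filter fun p => I.d v.1 p ≤ I.d v.1 v.2

variable {I}

theorem mem_pts {v : I.Ball} {p : Fin I.nD} : p ∈ I.pts v ↔ I.d v.1 p ≤ I.rad v := by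
  simp [pts, rad]

theorem pts_nonempty (v : I.Ball) : (I.pts v).Nonempty := ⟨v.2, mem_pts.2 le_rfl⟩

theorem rad_nonneg (v : I.Ball) : 0 ≤ I.rad v := I.d_nonneg _ _

/-- A ball of radius at most `R` which satisfies the lower bound of its centre. -/
def Valid (R : ℝ) (v : I.Ball) : Prop := I.rad v ≤ R ∧ I.L v.1 ≤ (I.pts v).card

/-- The outcome of the primal-dual method with opening cost `lam`: the balls `b q`, `q ∈ A`, became
tight at the times `t q`, and `α` is the resulting dual solution. -/
structure IsRun (R lam : ℝ) (A : Finset ℕ) (b : ℕ → I.Ball) (t : ℕ → ℝ) (α : Fin I.nD → ℝ) :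
    Prop where
  valid : ∀ q ∈ A, Valid R (b q)
  tight : ∀ q ∈ A, ∑ j ∈ I.pts (b q), α j = I.rad (b q) + lam
  le_time : ∀ q ∈ A, ∀ j ∈ I.pts (b q), α j ≤ t q
  time_nonneg : ∀ q ∈ A, 0 ≤ t q
  time_mono : ∀ x ∈ A, ∀ y ∈ A, x < y → t x ≤ t y
  covers : ∀ v, Valid R v → ∀ j ∈ I.pts v, ∃ q ∈ A, j ∈ I.pts (b q) ∧ α j = t q
  feasible : ∀ v, Valid R v → ∑ j ∈ I.pts v, α j ≤ I.rad v + lam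

theorem IsRun.nonneg {R lam : ℝ} {A : Finset ℕ} {b : ℕ → I.Ball} {t : ℕ → ℝ}
    {α : Fin I.nD → ℝ} (h : IsRun R lam A b t α) {v : I.Ball} (hv : Valid R v) {j : Fin I.nD}
    (hj : j ∈ I.pts v) : 0 ≤ α j := by
  obtain ⟨q, hq, -, hq'⟩ := h.covers v hv j hj
  exact hq' ▸ h.time_nonneg q hq

/-- Used to place two runs in one index set, the second one shifted behind the first. -/
theorem IsRun.map {R lam : ℝ} {A : Finset ℕ} {b b' : ℕ → I.Ball} {t t' : ℕ → ℝ}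
    {α : Fin I.nD → ℝ} (h : IsRun R lam A b t α) {f : ℕ → ℕ} (hf : StrictMono f)
    (hb : ∀ q ∈ A, b' (f q) = b q) (ht : ∀ q ∈ A, t' (f q) = t q) :
    IsRun R lam (A.image f) b' t' α where
  valid q hq := by
    obtain ⟨x, hx, rfl⟩ := mem_image.1 hq
    rw [hb x hx]; exact h.valid x hx
  tight q hq := by
    obtain ⟨x, hx, rfl⟩ := mem_image.1 hq
    rw [hb x hx]; exact h.tight x hx
  le_time q hq := by
    obtain ⟨x, hx, rfl⟩ := mem_image.1 hq
    rw [hb x hx, ht x hx]; exact h.le_time x hx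
  time_nonneg q hq := by
    obtain ⟨x, hx, rfl⟩ := mem_image.1 hq
    rw [ht x hx]; exact h.time_nonneg x hx
  time_mono x hx y hy := by
    obtain ⟨x', hx', rfl⟩ := mem_image.1 hx
    obtain ⟨y', hy', rfl⟩ := mem_image.1 hy
    rw [ht x' hx', ht y' hy', hf.lt_iff_lt]; exact h.time_mono x' hx' y' hy'
  covers v hv j hj := by
    obtain ⟨q, hq, h1, h2⟩ := h.covers v hv j hj
    exact ⟨f q, mem_image_of_mem f hq, by rwa [hb q hq], by rwa [ht q hq]⟩
  feasible := h.feasible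

/-- Geometric sum over ranks; ties only lower the left-hand side. It adds up the errors in
`IsRun.abs_sub_le`. -/
theorem sum_two_pow_card_lt {ι : Type*} [DecidableEq ι] (s : Finset ι) (f : ι → ℝ) :
    ∑ i ∈ s, (2 : ℝ) ^ (s.filter fun x => f x < f i).card ≤ 2 ^ s.card - 1 := by
  induction s using Finset.induction_on_max_value f with
  | empty => simp
  | insert a s ha hmax ih =>
    rw [sum_insert ha, card_insert_of_notMem ha, pow_succ]
    have h1 : ∀ i ∈ s, ((insert a s).filter fun x => f x < f i) = s.filter fun x => f x < f i :=
      fun i hi => by rw [filter_insert, if_neg (hmax i hi).not_gt]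
    rw [sum_congr rfl fun i hi => by rw [h1 i hi]]
    have h2 : ((insert a s).filter fun x => f x < f a).card ≤ s.card := by
      rw [filter_insert, if_neg (lt_irrefl _)]
      exact card_filter_le _ _
    have h3 : (2 : ℝ) ^ ((insert a s).filter fun x => f x < f a).card ≤ 2 ^ s.card :=
      pow_le_pow_right₀ one_le_two h2
    linarith

/-- The dual solution depends continuously on the opening cost. -/
theorem IsRun.abs_sub_le {R l₁ l₂ δ : ℝ} {A₁ A₂ : Finset ℕ} {b₁ b₂ : ℕ → I.Ball}
    {t₁ t₂ : ℕ → ℝ} {α₁ α₂ : Fin I.nD → ℝ} (h₁ : IsRun R l₁ A₁ b₁ t₁ α₁)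
    (h₂ : IsRun R l₂ A₂ b₂ t₂ α₂) (hl : |l₁ - l₂| ≤ δ) {v : I.Ball} (hv : Valid R v)
    {j : Fin I.nD} (hj : j ∈ I.pts v) : |α₁ j - α₂ j| ≤ δ * 2 ^ I.nD := by
  classical
  have hδ : 0 ≤ δ := (abs_nonneg _).trans hl
  set C : Finset (Fin I.nD) := univ.filter fun j => ∃ v, Valid R v ∧ j ∈ I.pts v with hC
  set μ : Fin I.nD → ℝ := fun j => min (α₁ j) (α₂ j) with hμ
  set N : Fin I.nD → ℕ := fun j => (C.filter fun i => μ i < μ j).card with hN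
  have hCmem : ∀ {j}, j ∈ C ↔ ∃ v, Valid R v ∧ j ∈ I.pts v := by simp [hC]
  -- Induction on the rank of `j` with respect to the smaller of its two dual values.
  have key : ∀ n, ∀ j ∈ C, N j = n → |α₁ j - α₂ j| ≤ δ * 2 ^ n := by
    intro n
    induction n using Nat.strong_induction_on with
    | _ n ih =>
      intro j hj hjn
      obtain ⟨v, hv, hjv⟩ := hCmem.1 hj
      -- Let `q` be the ball at whose time `j` froze in the run with the smaller value at `j`. Its
      -- constraint is tight for `α` and holds for `α'`, so the excess of `α'` at `j` is at most `δ`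
      -- plus the excesses of `α` over `α'` on the rest of the ball. A client `i` with such an
      -- excess has α' i < α i ≤ t q = α j, hence smaller rank.
      have one_side : ∀ {l l' : ℝ} {A A' : Finset ℕ} {b b' : ℕ → I.Ball}
          {t t' : ℕ → ℝ} {α α' : Fin I.nD → ℝ}, IsRun R l A b t α → IsRun R l' A' b' t' α' →
          |l - l'| ≤ δ → (∀ i, |α i - α' i| = |α₁ i - α₂ i|) → (∀ i, μ i = min (α i) (α' i)) →
          α j ≤ α' j → α' j - α j ≤ δ * 2 ^ n := by
        intro l l' A A' b b' t t' α α' h h' hll habs hmin hle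
        obtain ⟨q, hq, hjq, hjt⟩ := h.covers v hv j hjv
        have h3 := h.tight q hq
        have h4 := h'.feasible _ (h.valid q hq)
        have h5 : ∀ i ∈ I.pts (b q), α i - α' i ≤
            if μ i < μ j then δ * 2 ^ N i else (if i = j then α j - α' j else 0) := by
          intro i hi
          split_ifs with hij hij'
          · have hiC : i ∈ C := hCmem.2 ⟨_, h.valid q hq, hi⟩
            have hlt : N i < n := by
              rw [← hjn]
              refine card_lt_card ⟨fun x hx => ?_, fun hsub => ?_⟩
              · simp only [mem_filter] at hx ⊢
                exact ⟨hx.1, hx.2.trans hij⟩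
              · have := hsub (mem_filter.2 ⟨hiC, hij⟩)
                exact lt_irrefl _ (mem_filter.1 this).2
            have := ih _ hlt i hiC rfl
            rw [← habs] at this
            exact (le_abs_self _).trans this
          · rw [hij']
          · have h6 := h.le_time q hq i hi
            rw [← hjt] at h6
            rw [hmin, hmin, min_eq_left hle] at hij
            by_contra hc
            push Not at hc
            have : min (α i) (α' i) = α' i := min_eq_right (by linarith)
            rw [this] at hij
            linarith
        have h6 := sum_le_sum h5
        rw [sum_sub_distrib, h3] at h6
        have h7 : ∑ i ∈ I.pts (b q), (if μ i < μ j then δ * 2 ^ N i else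
            (if i = j then α j - α' j else 0)) ≤
            (α j - α' j) + ∑ i ∈ C.filter (fun i => μ i < μ j), δ * 2 ^ N i := by
          rw [← add_sum_erase _ _ hjq, if_neg (lt_irrefl _), if_pos rfl]
          refine add_le_add le_rfl ?_
          rw [sum_filter]
          calc ∑ i ∈ (I.pts (b q)).erase j, (if μ i < μ j then δ * 2 ^ N i else
                (if i = j then α j - α' j else 0))
              = ∑ i ∈ (I.pts (b q)).erase j, (if μ i < μ j then δ * 2 ^ N i else 0) :=
                sum_congr rfl fun i hi => by rw [if_neg (ne_of_mem_erase hi)]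
            _ ≤ _ := sum_le_sum_of_subset_of_nonneg (fun i hi => hCmem.2
                ⟨_, h.valid q hq, mem_of_mem_erase hi⟩) fun i _ _ => by
                  split_ifs <;> positivity
        have h8 : ∑ i ∈ C.filter (fun i => μ i < μ j), δ * 2 ^ N i ≤ δ * (2 ^ n - 1) := by
          rw [← mul_sum]
          refine mul_le_mul_of_nonneg_left ?_ hδ
          have := sum_two_pow_card_lt (C.filter fun i => μ i < μ j) μ
          rw [show (C.filter fun i => μ i < μ j).card = n from hjn] at this
          refine le_trans (le_of_eq (sum_congr rfl fun i hi => ?_)) this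
          rw [filter_filter]
          refine congrArg (fun s : Finset _ => (2 : ℝ) ^ s.card) ?_
          ext x
          simp only [mem_filter, and_congr_right_iff]
          exact fun _ => ⟨fun h => ⟨h.trans (mem_filter.1 hi).2, h⟩, fun h => h.2⟩
        have := (abs_le.1 hll).1
        linarith
      rcases le_total (α₁ j) (α₂ j) with hle | hle
      · have := one_side h₁ h₂ hl (fun _ => rfl) (fun _ => rfl) hle
        rw [abs_sub_comm, abs_of_nonneg (by linarith)]
        exact this
      · have := one_side h₂ h₁ (by rwa [abs_sub_comm]) (fun _ => abs_sub_comm _ _)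
          (fun _ => min_comm _ _) hle
        rw [abs_of_nonneg (by linarith)]
        exact this
  refine (key _ j (hCmem.2 ⟨v, hv, hj⟩) rfl).trans (mul_le_mul_of_nonneg_left ?_ hδ)
  refine pow_le_pow_right₀ one_le_two ?_
  simpa using card_le_univ (C.filter fun i => μ i < μ j)

/-! #### Optimal clusters -/

theorem radius_nonneg (y : I.Solution) (i : Fin I.nF) : 0 ≤ I.radius y i :=
  Real.iSup_nonneg fun j => I.d_nonneg i j.1

theorem d_le_radius (y : I.Solution) {i : Fin I.nF} {j : Fin I.nD} (h : y.σ j = some i) :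
    I.d i j ≤ I.radius y i :=
  le_ciSup (f := fun j : {j : Fin I.nD // y.σ j = some i} => I.c (.inl i) (.inr j.1))
    (Set.finite_range _).bddAbove ⟨j, h⟩

/-- The farthest client of a cluster spans a ball around the whole cluster, which therefore inherits
its lower bound. -/
theorem exists_ball_of_feasible {y : I.Solution} (hy : I.Feasible y) {R : ℝ} {i : Fin I.nF}
    (hR : I.radius y i ≤ R) {j : Fin I.nD} (hj : y.σ j = some i) :
    ∃ v : I.Ball, Valid R v ∧ v.1 = i ∧ I.rad v = I.radius y i ∧
      ∀ p, y.σ p = some i → p ∈ I.pts v := by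
  have : Nonempty {j : Fin I.nD // y.σ j = some i} := ⟨⟨j, hj⟩⟩
  obtain ⟨⟨p, hp⟩, hpmax⟩ := exists_eq_ciSup_of_finite
    (f := fun j : {j : Fin I.nD // y.σ j = some i} => I.c (.inl i) (.inr j.1))
  have h1 : I.rad (i, p) = I.radius y i := hpmax
  have h2 : ∀ p', y.σ p' = some i → p' ∈ I.pts (i, p) := fun p' hp' =>
    mem_pts.2 ((d_le_radius y hp').trans h1.ge)
  refine ⟨(i, p), ⟨h1.trans_le hR, ?_⟩, rfl, h1, h2⟩
  refine (hy.lower i (hy.assigned j i hj)).trans (card_le_card fun p' hp' => ?_)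
  exact h2 p' (mem_filter.1 hp').2

theorem cost_nonneg (y : I.Solution) : 0 ≤ I.cost y := sum_nonneg fun i _ => radius_nonneg y i

/-- Each nonempty cluster lies in a valid ball, whose constraint bounds the dual values of its
clients. There are at most `k` clusters, and at most `m` outliers worth `γ` each. -/
theorem weak_duality {y : I.Solution} (hy : I.Feasible y) {R lam γ : ℝ} (hlam : 0 ≤ lam)
    (hR : ∀ i ∈ y.S, I.radius y i ≤ R) (hγ : 0 ≤ γ) {α : Fin I.nD → ℝ}
    (hα : ∀ v, Valid R v → ∀ j ∈ I.pts v, 0 ≤ α j) (hle : ∀ j, α j ≤ γ)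
    (hf : ∀ v, Valid R v → ∑ j ∈ I.pts v, α j ≤ I.rad v + lam) :
    ∑ j, α j ≤ I.cost y + I.k * lam + I.m * γ := by
  classical
  rw [← sum_fiberwise univ y.σ, Fintype.sum_option]
  have h1 : ∑ j with y.σ j = none, α j ≤ I.m * γ := by
    refine (sum_le_card_nsmul _ _ γ fun j _ => hle j).trans ?_
    rw [nsmul_eq_mul]
    exact mul_le_mul_of_nonneg_right (by exact_mod_cast hy.outliers) hγ
  have h2 : ∀ i, ∑ j with y.σ j = some i, α j ≤ if i ∈ y.S then I.radius y i + lam else 0 := by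
    intro i
    rcases (univ.filter fun j => y.σ j = some i).eq_empty_or_nonempty with h | ⟨j, hj⟩
    · rw [h, sum_empty]
      split_ifs
      exacts [add_nonneg (radius_nonneg y i) hlam, le_rfl]
    · have hj := (mem_filter.1 hj).2
      have hi := hy.assigned j i hj
      rw [if_pos hi]
      obtain ⟨v, hv, -, h3, h4⟩ := exists_ball_of_feasible hy (hR i hi) hj
      rw [← h3]
      refine le_trans (sum_le_sum_of_subset_of_nonneg (fun p hp => h4 p (mem_filter.1 hp).2)
        fun p hp _ => hα v hv p hp) (hf v hv)
  have h3 := sum_le_sum fun i (_ : i ∈ univ) => h2 i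
  rw [sum_ite_mem, univ_inter, sum_add_distrib, sum_const, nsmul_eq_mul] at h3
  have h4 : (y.S.card : ℝ) * lam ≤ I.k * lam :=
    mul_le_mul_of_nonneg_right (by exact_mod_cast hy.card_le) hlam
  rw [cost]
  linarith

/-! ### The dual bound for a mixture of two runs. -/

/-- The key used to order the items of two runs. -/
def key (t : ℕ → ℝ) (q : ℕ) : ℝ ×ₗ ℕ := toLex (t q, q)

theorem key_injective (t : ℕ → ℝ) : Function.Injective (key t) := fun _ _ h =>
  congrArg (fun z => (ofLex z).2) h

theorem key_lt_key {t : ℕ → ℝ} {x y : ℕ} : key t x < key t y ↔ t x < t y ∨ t x = t y ∧ x < y :=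
  Prod.Lex.toLex_lt_toLex

/-- Truncate the first dual solution at (almost) the time of `z` and apply weak duality. Balls
before `z` are paid for up to `ξ` per client, whichever run they come from, and the disjoint balls
of `M` draw on different clients. Since `W` contains one full run, a client not covered before `z`
froze no earlier than about that time. -/
theorem dual_bound {y : I.Solution} (hy : I.Feasible y) {R l₁ l₂ ξ : ℝ} (hl₁ : 0 ≤ l₁)
    (hl : l₁ ≤ l₂) (hR : ∀ i ∈ y.S, I.radius y i ≤ R) {A₁ A₂ W M : Finset ℕ} {b : ℕ → I.Ball}
    {t : ℕ → ℝ} {α₁ α₂ : Fin I.nD → ℝ} (h₁ : IsRun R l₁ A₁ b t α₁) (h₂ : IsRun R l₂ A₂ b t α₂)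
    (hξ0 : 0 ≤ ξ) (hξ : ∀ v, Valid R v → ∀ j ∈ I.pts v, |α₁ j - α₂ j| ≤ ξ)
    (hWA : W ⊆ A₁ ∪ A₂) (hAW : A₁ ⊆ W ∨ A₂ ⊆ W) {z : ℕ}
    (hunc : I.m < unc (fun q => I.pts (b q)) (pre (key t) W z)) (hM : M ⊆ pre (key t) W z)
    (hdis : ∀ p ∈ M, ∀ q ∈ M, p ≠ q → Disjoint (I.pts (b p)) (I.pts (b q))) :
    ∑ q ∈ M, (I.rad (b q) + l₁) + max 0 (t z - ξ) ≤ I.cost y + I.k * l₁ + I.nD * ξ := by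
  classical
  -- The correction `ξ` is needed because a ball of the second run at or after `z` only shows that
  -- the second dual value is at least `t z`.
  set γ := max 0 (t z - ξ) with hγ
  set D := pre (key t) W z with hD
  have hγ0 : 0 ≤ γ := le_max_left _ _
  set α : Fin I.nD → ℝ := fun j => if ∃ v, Valid R v ∧ j ∈ I.pts v then min (α₁ j) γ else γ with hα
  have hαv : ∀ v, Valid R v → ∀ j ∈ I.pts v, α j = min (α₁ j) γ := fun v hv j hj =>
    if_pos ⟨v, hv, hj⟩
  have hα0 : ∀ j, 0 ≤ α j := by
    intro j
    simp only [hα]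
    split_ifs with h
    · obtain ⟨v, hv, hj⟩ := h
      exact le_min (h₁.nonneg hv hj) hγ0
    · exact hγ0
  have hαγ : ∀ j, α j ≤ γ := by
    intro j
    simp only [hα]
    split_ifs
    exacts [min_le_right _ _, le_rfl]
  have hwd := weak_duality hy hl₁ hR hγ0 (fun v _ j _ => hα0 j) hαγ fun v hv =>
    (sum_le_sum fun j hj => (hαv v hv j hj).trans_le (min_le_left _ _)).trans (h₁.feasible v hv)
  -- uncovered clients pay `γ`
  have hun : ∀ j, j ∉ D.biUnion (fun q => I.pts (b q)) → α j = γ := by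
    intro j hj
    simp only [hα]
    split_ifs with h
    · obtain ⟨v, hv, hjv⟩ := h
      have h0 := h₁.nonneg hv hjv
      have hex : ∃ q ∈ W, j ∈ I.pts (b q) ∧ t q ≤ α₁ j + ξ := by
        rcases hAW with hA | hA
        · obtain ⟨q, hq, h1, h2⟩ := h₁.covers v hv j hjv
          exact ⟨q, hA hq, h1, by linarith⟩
        · obtain ⟨q, hq, h1, h2⟩ := h₂.covers v hv j hjv
          have := (abs_le.1 (hξ v hv j hjv)).1
          exact ⟨q, hA hq, h1, by linarith⟩
      obtain ⟨q, hq, hjq, hqt⟩ := hex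
      have hqD : ¬ key t q < key t z := fun h => hj (mem_biUnion.2 ⟨q, mem_filter.2 ⟨hq, h⟩, hjq⟩)
      rw [key_lt_key] at hqD
      push Not at hqD
      exact min_eq_right (max_le h0 (by linarith [hqD.1]))
    · rfl
  -- items of `M` are paid for up to `ξ` per client
  have hpay : ∀ q ∈ M, I.rad (b q) + l₁ ≤ ∑ j ∈ I.pts (b q), (α j + ξ) := by
    intro q hq
    have hqD := mem_filter.1 (hM hq)
    have hqz : t q ≤ t z := by
      rcases key_lt_key.1 hqD.2 with h | h
      exacts [h.le, h.1.le]
    rcases mem_union.1 (hWA hqD.1) with h | h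
    · rw [← h₁.tight q h]
      refine sum_le_sum fun j hj => ?_
      rw [hαv _ (h₁.valid q h) j hj]
      have h3 := h₁.le_time q h j hj
      have : α₁ j - ξ ≤ min (α₁ j) γ :=
        le_min (by linarith) (le_trans (by linarith) (le_max_right _ _))
      linarith
    -- A ball of the second run even collects `l₂ ≥ l₁`.
    · refine le_trans (by linarith) (h₂.tight q h).ge |>.trans ?_
      refine sum_le_sum fun j hj => ?_
      rw [hαv _ (h₂.valid q h) j hj]
      have h3 := h₂.le_time q h j hj
      have h4 := (abs_le.1 (hξ _ (h₂.valid q h) j hj)).1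
      have : α₂ j - ξ ≤ min (α₁ j) γ :=
        le_min (by linarith) (le_trans (by linarith) (le_max_right _ _))
      linarith
  have hsum := sum_le_sum hpay
  rw [← sum_biUnion (fun p hp q hq hpq => hdis p hp q hq hpq), sum_add_distrib (f := α),
    sum_const, nsmul_eq_mul] at hsum
  have hcard : ((M.biUnion fun q => I.pts (b q)).card : ℝ) * ξ ≤ I.nD * ξ := by
    refine mul_le_mul_of_nonneg_right ?_ hξ0
    exact_mod_cast (card_le_univ _).trans (Fintype.card_fin _).le
  have hsplit := sum_add_sum_compl (D.biUnion fun q => I.pts (b q)) α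
  have hcov : ∑ j ∈ M.biUnion (fun q => I.pts (b q)), α j ≤
      ∑ j ∈ D.biUnion (fun q => I.pts (b q)), α j :=
    sum_le_sum_of_subset_of_nonneg (biUnion_subset_biUnion_of_subset_left _ hM) fun j _ _ => hα0 j
  -- At least `m + 1` clients pay `γ`, while weak duality gives away only `m * γ`; the surplus is
  -- the term `max 0 (t z - ξ)`.
  have huncov : ((I.m : ℝ) + 1) * γ ≤ ∑ j ∈ (D.biUnion fun q => I.pts (b q))ᶜ, α j := by
    rw [sum_congr rfl fun j hj => hun j (mem_compl.1 hj), sum_const, nsmul_eq_mul]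
    exact mul_le_mul_of_nonneg_right (by exact_mod_cast hunc) hγ0
  linarith

end LBkSRO

/-! ### Clusterings given by families of balls -/

namespace LBkSRO

open Finset SetFamily

variable {I : LBkSRO}

/-- The point sets of a sequence of balls. -/
noncomputable abbrev sets (b : ℕ → I.Ball) (q : ℕ) : Finset (Fin I.nD) := I.pts (b q)

/-- `σ` labels every connected component of the family `F` by the centre of one of its balls. -/
structure IsClustering (b : ℕ → I.Ball) (F : Finset ℕ) (σ : Fin I.nD → Option (Fin I.nF)) :
    Prop where
  covered : ∀ p, σ p ≠ none ↔ ∃ q ∈ F, p ∈ I.pts (b q)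
  const : ∀ q ∈ F, ∀ x ∈ I.pts (b q), ∀ y ∈ I.pts (b q), σ x = σ y
  conn : ∀ g : Fin I.nD → ℕ, (∀ q ∈ F, ∀ x ∈ I.pts (b q), ∀ y ∈ I.pts (b q), g x = g y) →
    ∀ x y, σ x ≠ none → σ x = σ y → g x = g y
  center : ∀ p i, σ p = some i → ∃ q ∈ F, (b q).1 = i ∧ ∀ x ∈ I.pts (b q), σ x = some i

theorem isClustering_empty (b : ℕ → I.Ball) : IsClustering b ∅ fun _ => none := by
  constructor <;> simp

open Classical in
/-- All clusters which meet the ball `v` are merged with it. -/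
noncomputable def merge (v : I.Ball) (σ : Fin I.nD → Option (Fin I.nF)) (p : Fin I.nD) :
    Option (Fin I.nF) :=
  if p ∈ I.pts v ∨ (σ p ≠ none ∧ ∃ p' ∈ I.pts v, σ p' = σ p) then some v.1 else σ p

/-- The danger is that the label `v.1` is already in use by a component not meeting `v`. But balls
with the same centre are nested, so a component with this label does meet `v` (`hlabel`). -/
theorem IsClustering.merge {b : ℕ → I.Ball} {F : Finset ℕ} {σ : Fin I.nD → Option (Fin I.nF)}
    (h : IsClustering b F σ) (q : ℕ) : IsClustering b (insert q F) (merge (b q) σ) := by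
  set v := b q with hv
  set Q : Fin I.nD → Prop := fun p => p ∈ I.pts v ∨ (σ p ≠ none ∧ ∃ p' ∈ I.pts v, σ p' = σ p)
    with hQ
  have hpos : ∀ {p}, Q p → LBkSRO.merge v σ p = some v.1 := fun hp => if_pos hp
  have hneg : ∀ {p}, ¬ Q p → LBkSRO.merge v σ p = σ p := fun hp => if_neg hp
  have hball : ∀ q' ∈ F, ∀ x ∈ I.pts (b q'), σ x ≠ none := fun q' hq' x hx =>
    (h.covered x).2 ⟨q', hq', hx⟩
  have hclass : ∀ x y, σ x ≠ none → σ x = σ y → Q x → Q y := by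
    rintro x y hx hxy (h' | ⟨-, p', hp', h'⟩)
    · exact .inr ⟨hxy ▸ hx, x, h', hxy⟩
    · exact .inr ⟨hxy ▸ hx, p', hp', h'.trans hxy⟩
  have hlabel : ∀ y, σ y = some v.1 → Q y := by
    intro y hy
    obtain ⟨q', hq', hc, hl⟩ := h.center y _ hy
    refine .inr ⟨by simp [hy], ?_⟩
    rcases le_total (I.rad v) (I.rad (b q')) with hr | hr
    · refine ⟨v.2, mem_pts.2 le_rfl, ?_⟩
      rw [hy]
      refine hl _ (mem_pts.2 ?_)
      rw [hc]; exact hr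
    · refine ⟨(b q').2, mem_pts.2 ?_, ?_⟩
      · rw [← hc]; exact hr
      · rw [hy]; exact hl _ (mem_pts.2 le_rfl)
  constructor
  · intro p
    by_cases hp : Q p
    · rw [hpos hp]
      simp only [ne_eq, reduceCtorEq, not_false_eq_true, mem_insert, exists_eq_or_imp, true_iff]
      rcases hp with hp | hp
      · exact .inl hp
      · exact .inr ((h.covered p).1 hp.1)
    · rw [hneg hp, h.covered]
      simp only [mem_insert, exists_eq_or_imp]
      exact ⟨.inr, fun h' => h'.resolve_left fun h' => hp (.inl h')⟩
  · intro q' hq' x hx y hy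
    rcases mem_insert.1 hq' with rfl | hq'
    · rw [hpos (.inl hx), hpos (.inl hy)]
    · have hxy := h.const q' hq' x hx y hy
      by_cases hQx : Q x
      · rw [hpos hQx, hpos (hclass x y (hball q' hq' x hx) hxy hQx)]
      · rw [hneg hQx, hneg fun hQy => hQx (hclass y x (hball q' hq' y hy) hxy.symm hQy), hxy]
  · intro g hg x y hx hxy
    have hgv : ∀ p, Q p → g p = g v.2 := by
      rintro p (hp | ⟨hp, p', hp', hpp⟩)
      · exact hg q (mem_insert_self _ _) p hp _ (mem_pts.2 le_rfl)
      · rw [← h.conn g (fun q' hq' => hg q' (mem_insert_of_mem hq')) p' p (hpp ▸ hp) hpp]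
        exact hg q (mem_insert_self _ _) p' hp' _ (mem_pts.2 le_rfl)
    by_cases hQx : Q x <;> by_cases hQy : Q y
    · rw [hgv x hQx, hgv y hQy]
    · rw [hpos hQx, hneg hQy] at hxy
      exact absurd (hlabel y hxy.symm) hQy
    · rw [hneg hQx, hpos hQy] at hxy
      exact absurd (hlabel x hxy) hQx
    · rw [hneg hQx] at hx
      rw [hneg hQx, hneg hQy] at hxy
      exact h.conn g (fun q' hq' => hg q' (mem_insert_of_mem hq')) x y hx hxy
  · intro p i hp
    by_cases hQp : Q p
    · rw [hpos hQp, Option.some_inj] at hp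
      exact ⟨q, mem_insert_self _ _, hp, fun x hx => by rw [hpos (.inl hx), hp]⟩
    · rw [hneg hQp] at hp
      obtain ⟨q', hq', hc, hl⟩ := h.center p i hp
      refine ⟨q', mem_insert_of_mem hq', hc, fun x hx => ?_⟩
      rw [hneg fun hQx => hQp (hclass x p (hball q' hq' x hx) (by rw [hl x hx, hp]) hQx), hl x hx]

/-- The labels in use. -/
def labels (σ : Fin I.nD → Option (Fin I.nF)) : Finset (Fin I.nF) :=
  univ.filter fun i => ∃ p, σ p = some i

theorem mem_labels {σ : Fin I.nD → Option (Fin I.nF)} {i : Fin I.nF} :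
    i ∈ labels σ ↔ ∃ p, σ p = some i := by simp [labels]

/-- The solution which opens the facilities used as labels. -/
def solutionOf (σ : Fin I.nD → Option (Fin I.nF)) : I.Solution := ⟨labels σ, σ⟩

namespace IsClustering

variable {b : ℕ → I.Ball} {F : Finset ℕ} {σ : Fin I.nD → Option (Fin I.nF)}

/-- `σ` is itself an admissible labelling, and by `conn` every other one factors through it. -/
theorem compsGE_iff (h : IsClustering b F σ) {n : ℕ} :
    CompsGE (sets b) F n ↔ n ≤ (labels σ).card := by
  classical
  constructor
  · rintro ⟨g, hg, hn⟩
    refine hn.trans ?_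
    have : (F.biUnion (sets b)).image g ⊆
        (labels σ).image fun i => if hi : ∃ p, σ p = some i then g hi.choose else 0 := by
      intro a ha
      obtain ⟨x, hx, rfl⟩ := mem_image.1 ha
      obtain ⟨q, hq, hxq⟩ := mem_biUnion.1 hx
      obtain ⟨i, hi⟩ := Option.ne_none_iff_exists'.1 ((h.covered x).2 ⟨q, hq, hxq⟩)
      have hex : ∃ p, σ p = some i := ⟨x, hi⟩
      refine mem_image.2 ⟨i, mem_labels.2 hex, ?_⟩
      rw [dif_pos hex]
      exact h.conn g hg _ _ (by rw [hex.choose_spec]; simp) (by rw [hex.choose_spec, hi])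
    exact (card_le_card this).trans card_image_le
  · intro hn
    refine ⟨fun p => (σ p).elim 0 fun i => i, fun q hq x hx y hy => by
      simp only; rw [h.const q hq x hx y hy], hn.trans ?_⟩
    rw [← card_image_of_injective (labels σ) Fin.val_injective]
    refine card_le_card fun a ha => ?_
    obtain ⟨i, hi, rfl⟩ := mem_image.1 ha
    obtain ⟨p, hp⟩ := mem_labels.1 hi
    obtain ⟨q, hq, hpq⟩ := (h.covered p).1 (by rw [hp]; simp)
    exact mem_image.2 ⟨p, mem_biUnion.2 ⟨q, hq, hpq⟩, by simp [hp]⟩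

theorem unc_eq (h : IsClustering b F σ) :
    unc (sets b) F = (univ.filter fun p => σ p = none).card := by
  unfold unc
  congr 1
  ext p
  have := h.covered p
  simp only [mem_compl, mem_biUnion, mem_filter, mem_univ, true_and]
  rw [← not_iff_not, not_not]
  exact this.symm

/-- A cluster contains a whole valid ball around its centre, so the lower bound of the centre is
met. -/
theorem feasible (h : IsClustering b F σ) {R : ℝ} (hv : ∀ q ∈ F, Valid R (b q))
    (hk : (labels σ).card ≤ I.k) (hm : (univ.filter fun p => σ p = none).card ≤ I.m) :
    I.Feasible (solutionOf σ) where
  assigned j i hj := mem_labels.2 ⟨j, hj⟩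
  card_le := hk
  lower i hi := by
    obtain ⟨p, hp⟩ := mem_labels.1 hi
    obtain ⟨q, hq, rfl, hl⟩ := h.center p i hp
    exact (hv q hq).2.trans (card_le_card fun x hx => mem_filter.2 ⟨mem_univ _, hl x hx⟩)
  outliers := hm

/-- Project the cluster to the line by the distance from `i`. Each host `x` and the balls it hosts
land in an interval of length `2 * w x` around `K x`. As the cluster is connected, these intervals
leave no gap between 0 and `I.d i p`, so their lengths add up to at least `I.d i p`. -/
theorem d_le_sum (h : IsClustering b F σ) {W : Finset ℕ} (hW : W ⊆ F) {w : ℕ → ℝ}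
    (hw : ∀ q ∈ W, 0 ≤ w q)
    (host : ∀ q ∈ F, ∃ x ∈ W, ¬ Disjoint (I.pts (b q)) (I.pts (b x)) ∧
      I.c (.inl (b x).1) (.inl (b q).1) ≤ w x ∧
      ∀ p ∈ I.pts (b q), I.c (.inl (b x).1) (.inr p) ≤ w x)
    {i : Fin I.nF} {p : Fin I.nD} (hp : σ p = some i) :
    I.d i p ≤ ∑ x ∈ W with σ (b x).2 = some i, 2 * w x := by
  classical
  let _ : PseudoMetricSpace _ := I.metric
  set K : ℕ → ℝ := fun x => I.c (.inl i) (.inl (b x).1) with hK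
  have hcl : ∀ q ∈ F, ∀ x ∈ W, ¬ Disjoint (I.pts (b q)) (I.pts (b x)) →
      ∀ z ∈ I.pts (b q), σ (b x).2 = σ z := by
    intro q hq x hx hd z hz
    obtain ⟨z', hz1, hz2⟩ := not_disjoint_iff.1 hd
    rw [h.const x (hW hx) _ (mem_pts.2 le_rfl) z' hz2, h.const q hq z' hz1 z hz]
  have hcover : Set.Icc 0 (I.d i p) ⊆
      ⋃ x ∈ W.filter (fun x => σ (b x).2 = some i), Set.Icc (K x - w x) (K x + w x) := by
    intro s hs
    by_contra hns
    have hns' : ∀ x ∈ W, σ (b x).2 = some i → ∀ u, |u - K x| ≤ w x → u ≠ s := by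
      rintro x hx hxi u hu rfl
      refine hns (Set.mem_iUnion₂.2 ⟨x, mem_filter.2 ⟨hx, hxi⟩, ?_⟩)
      rw [abs_le] at hu
      exact ⟨by linarith, by linarith⟩
    have hsep : ∀ x ∈ W, σ (b x).2 = some i → ∀ u u', |u - K x| ≤ w x → |u' - K x| ≤ w x →
        u < s → u' < s := by
      intro x hx hxi u u' hu hu' hus
      by_contra hc
      refine hns' x hx hxi s ?_ rfl
      rw [abs_le] at hu hu' ⊢
      exact ⟨by linarith, by linarith⟩
    have hdK : ∀ x p', I.c (.inl (b x).1) (.inr p') ≤ w x → |I.d i p' - K x| ≤ w x := by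
      intro x p' hle
      have h1 : I.d i p' ≤ K x + I.c (.inl (b x).1) (.inr p') := dist_triangle _ _ _
      have h2 : K x ≤ I.d i p' + I.c (.inr p') (.inl (b x).1) := dist_triangle _ _ _
      have h3 : I.c (.inr p') (.inl (b x).1) = I.c (.inl (b x).1) (.inr p') := dist_comm _ _
      rw [abs_le]
      exact ⟨by linarith, by linarith⟩
    -- A gap `s` would split the cluster: no ball straddles `s`, so `g` is constant on balls, which
    -- `conn` turns into a contradiction.
    set g : Fin I.nD → ℕ := fun p' => if σ p' = some i ∧ I.d i p' < s then 1 else 0 with hg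
    have hgc : ∀ q ∈ F, ∀ x ∈ I.pts (b q), ∀ y ∈ I.pts (b q), g x = g y := by
      intro q hq y hy z hz
      have hyz := h.const q hq y hy z hz
      obtain ⟨x, hx, hd, -, hxp⟩ := host q hq
      by_cases hyi : σ y = some i
      · have hzi : σ z = some i := hyz ▸ hyi
        have hxi := (hcl q hq x hx hd y hy).trans hyi
        have : I.d i y < s ↔ I.d i z < s :=
          ⟨hsep x hx hxi _ _ (hdK x y (hxp y hy)) (hdK x z (hxp z hz)),
            hsep x hx hxi _ _ (hdK x z (hxp z hz)) (hdK x y (hxp y hy))⟩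
        simp only [hg, hyi, hzi, this]
      · have hzi : ¬ σ z = some i := hyz ▸ hyi
        simp only [hg, hyi, hzi, false_and]
    obtain ⟨q, hq, hqi, hql⟩ := h.center p i hp
    have hz := hql _ (mem_pts.2 (le_refl (I.rad (b q))))
    have hgz := h.conn g hgc (b q).2 p (by rw [hz]; simp) (by rw [hz, hp])
    have h1 : g p = 0 := if_neg fun h => absurd h.2 (not_lt.2 hs.2)
    -- The ball centred at `i` lies on the near side: its host's interval contains 0, the distance
    -- of `i` from itself. Hence the condition on centres in `host`.
    have h2 : g (b q).2 = 1 := by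
      obtain ⟨x, hx, hd, hxc, hxp⟩ := host q hq
      have hxi := (hcl q hq x hx hd _ (mem_pts.2 (le_refl (I.rad (b q))))).trans hz
      have h0 : |(0 : ℝ) - K x| ≤ w x := by
        rw [hqi] at hxc
        have h3 : K x = I.c (.inl (b x).1) (.inl i) := dist_comm _ _
        rw [zero_sub, abs_neg, abs_of_nonneg (show 0 ≤ K x from dist_nonneg), h3]
        exact hxc
      refine if_pos ⟨hz, hsep x hx hxi 0 _ h0 (hdK x _ (hxp _ (mem_pts.2 le_rfl))) ?_⟩
      exact lt_of_le_of_ne hs.1 (hns' x hx hxi 0 h0)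
    omega
  have hvol := (MeasureTheory.measure_mono (μ := MeasureTheory.volume) hcover).trans
    (MeasureTheory.measure_biUnion_finset_le _ _)
  simp only [Real.volume_Icc, sub_zero] at hvol
  have hw' : ∀ x ∈ W.filter (fun x => σ (b x).2 = some i), 0 ≤ 2 * w x := fun x hx =>
    mul_nonneg zero_le_two (hw x (mem_filter.1 hx).1)
  rw [sum_congr rfl fun x _ => by rw [show K x + w x - (K x - w x) = 2 * w x by ring],
    ← ENNReal.ofReal_sum_of_nonneg hw', ENNReal.ofReal_le_ofReal_iff (sum_nonneg hw')] at hvol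
  exact hvol

/-- A host lies in a single cluster, so summing `d_le_sum` over the clusters counts it at most once.
-/
theorem cost_le_sum (h : IsClustering b F σ) {W : Finset ℕ} (hW : W ⊆ F) {w : ℕ → ℝ}
    (hw : ∀ q ∈ W, 0 ≤ w q)
    (host : ∀ q ∈ F, ∃ x ∈ W, ¬ Disjoint (I.pts (b q)) (I.pts (b x)) ∧
      I.c (.inl (b x).1) (.inl (b q).1) ≤ w x ∧
      ∀ p ∈ I.pts (b q), I.c (.inl (b x).1) (.inr p) ≤ w x) :
    I.cost (solutionOf σ) ≤ ∑ x ∈ W, 2 * w x := by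
  have hw2 : ∀ x ∈ W, 0 ≤ 2 * w x := fun x hx => mul_nonneg zero_le_two (hw x hx)
  have h1 : ∀ i ∈ labels σ, I.radius (solutionOf σ) i ≤
      ∑ x ∈ W with σ (b x).2 = some i, 2 * w x := fun i _ =>
    Real.iSup_le (fun p => h.d_le_sum hW hw host p.2)
      (sum_nonneg fun x hx => hw2 x (mem_filter.1 hx).1)
  refine (sum_le_sum h1).trans ?_
  simp_rw [sum_filter]
  rw [sum_comm]
  refine sum_le_sum fun x hx => ?_
  rcases hσ : σ (b x).2 with _ | i
  · simpa using hw2 x hx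
  · simp only [Option.some_inj, sum_ite_eq]
    split_ifs
    exacts [le_rfl, hw2 x hx]

/-- A ball meeting a ball `x` at least as large lies within three radii of the centre of `x`. So the
members of `M`, tripled, host `G`, while `e₁` and `e₂` host themselves and add at most `2 * R` each.
-/
theorem cost_le_of_subfamily {G : Finset ℕ} {e₁ e₂ : ℕ}
    (h : IsClustering b (insert e₁ (insert e₂ G)) σ) {R : ℝ} (h₁ : I.rad (b e₁) ≤ R)
    (h₂ : I.rad (b e₂) ≤ R) {M : Finset ℕ} (hM : M ⊆ G)
    (hint : ∀ q ∈ G, ∃ x ∈ M, ¬ Disjoint (I.pts (b q)) (I.pts (b x)) ∧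
      I.rad (b q) ≤ I.rad (b x)) :
    I.cost (solutionOf σ) ≤ 6 * ∑ q ∈ M, I.rad (b q) + 4 * R := by
  classical
  let _ : PseudoMetricSpace _ := I.metric
  have hr : ∀ q, 0 ≤ I.rad (b q) := fun q => rad_nonneg _
  have hself : ∀ q, ¬ Disjoint (I.pts (b q)) (I.pts (b q)) := fun q => by
    rw [disjoint_self]; exact (pts_nonempty _).ne_empty
  set w : ℕ → ℝ := fun q => if q ∈ M then 3 * I.rad (b q) else I.rad (b q) with hw
  have hwr : ∀ q, I.rad (b q) ≤ w q := by
    intro q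
    simp only [hw]
    split_ifs
    · linarith [hr q]
    · exact le_rfl
  have hw0 : ∀ q, 0 ≤ w q := fun q => (hr q).trans (hwr q)
  have hsub : insert e₁ (insert e₂ M) ⊆ insert e₁ (insert e₂ G) :=
    insert_subset_insert _ (insert_subset_insert _ hM)
  have hE : ∀ q ∈ insert e₁ (insert e₂ M), ∃ x ∈ insert e₁ (insert e₂ M),
      ¬ Disjoint (I.pts (b q)) (I.pts (b x)) ∧
      I.c (.inl (b x).1) (.inl (b q).1) ≤ w x ∧
      ∀ p ∈ I.pts (b q), I.c (.inl (b x).1) (.inr p) ≤ w x := fun q hq =>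
    ⟨q, hq, hself q, (dist_self _).trans_le (hw0 q), fun p hp => (mem_pts.1 hp).trans (hwr q)⟩
  have hmain := h.cost_le_sum hsub (fun q _ => hw0 q) (fun q hq => by
    rcases mem_insert.1 hq with rfl | hq'
    · exact hE q (mem_insert_self _ _)
    rcases mem_insert.1 hq' with rfl | hq''
    · exact hE q (mem_insert_of_mem (mem_insert_self _ _))
    obtain ⟨x, hx, hd, hle⟩ := hint q hq''
    have hwx : w x = 3 * I.rad (b x) := if_pos hx
    obtain ⟨z, hz1, hz2⟩ := not_disjoint_iff.1 hd
    have hz1' : dist (Sum.inl (b q).1 : Fin I.nF ⊕ Fin I.nD) (.inr z) ≤ I.rad (b q) :=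
      mem_pts.1 hz1
    have hz2' : dist (Sum.inl (b x).1 : Fin I.nF ⊕ Fin I.nD) (.inr z) ≤ I.rad (b x) :=
      mem_pts.1 hz2
    have hcc : dist (Sum.inl (b x).1 : Fin I.nF ⊕ Fin I.nD) (.inl (b q).1) ≤
        I.rad (b x) + I.rad (b q) := by
      have := dist_triangle (Sum.inl (b x).1 : Fin I.nF ⊕ Fin I.nD) (.inr z) (.inl (b q).1)
      rw [dist_comm (Sum.inr z : Fin I.nF ⊕ Fin I.nD)] at this
      linarith
    refine ⟨x, mem_insert_of_mem (mem_insert_of_mem hx), hd, ?_, fun p hp => ?_⟩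
    · rw [hwx]
      exact hcc.trans (by linarith [hr x])
    · have hp' : dist (Sum.inl (b q).1 : Fin I.nF ⊕ Fin I.nD) (.inr p) ≤ I.rad (b q) :=
        mem_pts.1 hp
      rw [hwx]
      refine (dist_triangle _ (Sum.inl (b q).1 : Fin I.nF ⊕ Fin I.nD) _).trans ?_
      linarith)
  refine hmain.trans ?_
  have hins : ∀ (e : ℕ) (s : Finset ℕ) , I.rad (b e) ≤ R → M ⊆ s →
      ∑ x ∈ insert e s, 2 * w x ≤ 2 * R + ∑ x ∈ s, 2 * w x := by
    intro e s he hs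
    by_cases hes : e ∈ s
    · rw [insert_eq_of_mem hes]
      linarith [hr e]
    · rw [sum_insert hes]
      have : w e = I.rad (b e) := if_neg fun h => hes (hs h)
      linarith
  have h3 := hins e₁ (insert e₂ M) h₁ (subset_insert _ _)
  have h4 := hins e₂ M h₂ subset_rfl
  have h5 : ∑ x ∈ M, 2 * w x = 6 * ∑ q ∈ M, I.rad (b q) := by
    rw [mul_sum]
    refine sum_congr rfl fun q hq => ?_
    simp only [hw, if_pos hq]
    ring
  linarith

end IsClustering

/-! ### Existence of a cheap candidate. -/

theorem unc_run_le {y : I.Solution} (hy : I.Feasible y) {R lam : ℝ}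
    (hR : ∀ i ∈ y.S, I.radius y i ≤ R) {A : Finset ℕ} {b : ℕ → I.Ball} {t : ℕ → ℝ}
    {α : Fin I.nD → ℝ} (h : IsRun R lam A b t α) : unc (sets b) A ≤ I.m := by
  refine le_trans (card_le_card fun p hp => mem_filter.2 ⟨mem_univ _, ?_⟩) hy.outliers
  by_contra hne
  obtain ⟨i, hi⟩ := Option.ne_none_iff_exists'.1 hne
  obtain ⟨v, hv, -, -, hsub⟩ := exists_ball_of_feasible hy (hR i (hy.assigned p i hi)) hi
  obtain ⟨q, hq, hpq, -⟩ := h.covers v hv p (hsub p hi)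
  exact mem_compl.1 hp (mem_biUnion.2 ⟨q, hq, hpq⟩)

/-- With more than `k` components, the balls before the last early ball `l` contain `k` disjoint
ones, and the dual bound gives `t l ≤ I.cost y`. Then the clients of `l` pay at most `I.nD * I.cost
y < lam`, too little to make `l` tight. -/
theorem not_compsGE_of_large {y : I.Solution} (hy : I.Feasible y) {R lam : ℝ}
    (hR : ∀ i ∈ y.S, I.radius y i ≤ R) (hm : I.m < I.nD) (hlam : I.nD * I.cost y < lam)
    {A : Finset ℕ} {b : ℕ → I.Ball} {t : ℕ → ℝ} {α : Fin I.nD → ℝ} (h : IsRun R lam A b t α) :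
    ¬ CompsGE (sets b) (early (sets b) (key t) I.m A) (I.k + 1) := by
  intro hge
  obtain ⟨l, hl, -, heq⟩ := exists_early_eq_insert (key_injective t)
    (by simpa using hm) (unc_run_le hy hR h)
  rw [heq] at hge
  obtain ⟨M, hM, hdis, hint⟩ := exists_disjoint_subfamily (sets b) (fun q => I.rad (b q))
    (pre (key t) A l) fun q _ => pts_nonempty _
  have hcard := hge.of_insert.le_card hM (fun q _ => pts_nonempty _) fun q hq => by
    obtain ⟨p, hp, hp', -⟩ := hint q hq
    exact ⟨p, hp, hp'⟩
  have hlam0 : 0 ≤ lam :=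
    (mul_nonneg (Nat.cast_nonneg _) (cost_nonneg y)).trans hlam.le
  have hbound := dual_bound hy hlam0 le_rfl hR h h le_rfl (fun v _ j _ => by simp)
    (subset_union_left) (.inl subset_rfl) (mem_filter.1 hl).2 hM hdis
  rw [sum_add_distrib, sum_const, nsmul_eq_mul] at hbound
  have h1 : (I.k : ℝ) * lam ≤ M.card * lam :=
    mul_le_mul_of_nonneg_right (by exact_mod_cast hcard) hlam0
  have h2 : 0 ≤ ∑ q ∈ M, I.rad (b q) := sum_nonneg fun q _ => rad_nonneg _
  have h3 : t l ≤ I.cost y := by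
    have := le_max_right 0 (t l - 0)
    linarith
  have hlA := (mem_filter.1 hl).1
  have h4 := sum_le_card_nsmul _ _ _ (h.le_time l hlA)
  rw [h.tight l hlA, nsmul_eq_mul] at h4
  have h5 : ((I.pts (b l)).card : ℝ) * t l ≤ I.nD * I.cost y :=
    mul_le_mul (by exact_mod_cast (card_le_univ _).trans (Fintype.card_fin _).le) h3
      (h.time_nonneg l hlA) (Nat.cast_nonneg _)
  linarith [rad_nonneg (b l)]

/-- The family of items between `a` and `b` before `x`, together with the items `e₁` and `e₂`. -/
noncomputable def candidate (A : Finset ℕ) (t : ℕ → ℝ) (a b x e₁ e₂ : ℕ) : Finset ℕ :=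
  open Classical in A.filter fun q =>
    (a ≤ q ∧ q ≤ b ∧ (t q < t x ∨ t q = t x ∧ q < x)) ∨ q = e₁ ∨ q = e₂

theorem candidate_eq {A : Finset ℕ} {t : ℕ → ℝ} {a b x e₁ e₂ : ℕ} (h₁ : e₁ ∈ A) (h₂ : e₂ ∈ A) :
    candidate A t a b x e₁ e₂ = insert e₁ (insert e₂ (pre (key t) (window A a b) x)) := by
  ext q
  simp only [candidate, pre, window, mem_filter, mem_insert, key_lt_key]
  constructor
  · tauto
  · rintro (rfl | rfl | h)
    · tauto
    · tauto
    · tauto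

/-- The heart of the approximation: a balanced pair of prefixes, the dual bound for the larger and
the clustering bound for the smaller. Only the window of the smaller one has to be found by the
program. -/
theorem exists_candidate {y : I.Solution} (hy : I.Feasible y) {R l₁ l₂ : ℝ} (hR0 : 0 ≤ R)
    (hR : ∀ i ∈ y.S, I.radius y i ≤ R) (hRy : R ≤ I.cost y) (hm : I.m < I.nD) (hl₁ : 0 ≤ l₁)
    (hl : l₁ ≤ l₂) (hδ : R ≠ 0 → I.nD * ((l₂ - l₁) * 2 ^ I.nD) ≤ R / 3)
    {A : Finset ℕ} {b : ℕ → I.Ball} {t : ℕ → ℝ} {α₁ α₂ : Fin I.nD → ℝ}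
    (hAv : ∀ q ∈ A, Valid R (b q)) (h₁ : IsRun R l₁ (window A 0 (I.nD - 1)) b t α₁)
    (h₂ : IsRun R l₂ (window A I.nD (I.nD + I.nD - 1)) b t α₂)
    (hc₁ : CompsGE (sets b) (early (sets b) (key t) I.m (window A 0 (I.nD - 1))) (I.k + 1) ∨
      l₁ = 0)
    (hc₂ : ¬ CompsGE (sets b)
      (early (sets b) (key t) I.m (window A I.nD (I.nD + I.nD - 1))) (I.k + 1)) :
    ∃ a a' x e₁ e₂, a < I.nD + I.nD ∧ a' < I.nD + I.nD ∧ x ∈ A ∧ e₁ ∈ A ∧ e₂ ∈ A ∧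
      unc (sets b) (candidate A t a a' x e₁ e₂) ≤ I.m ∧
      ¬ CompsGE (sets b) (candidate A t a a' x e₁ e₂) (I.k + 1) ∧
      ∀ σ, IsClustering b (candidate A t a a' x e₁ e₂) σ →
        I.cost (solutionOf σ) ≤ 12 * I.cost y := by
  have hn : 0 < I.nD := by omega
  have hδ0 : |l₁ - l₂| ≤ l₂ - l₁ := by rw [abs_sub_comm, abs_of_nonneg (by linarith)]
  have hξ := fun v (hv : Valid R v) j hj => h₁.abs_sub_le h₂ hδ0 hv (j := j) hj
  have hξ0 : 0 ≤ (l₂ - l₁) * 2 ^ I.nD := mul_nonneg (by linarith) (by positivity)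
  have finish : ∀ {M : Finset ℕ} {a a' x e₁ e₂ : ℕ}, a < I.nD + I.nD → a' < I.nD + I.nD →
      x ∈ A → e₁ ∈ A → e₂ ∈ A →
      unc (sets b) (insert e₁ (insert e₂ (pre (key t) (window A a a') x))) ≤ I.m →
      ¬ CompsGE (sets b) (insert e₁ (insert e₂ (pre (key t) (window A a a') x))) (I.k + 1) →
      M ⊆ pre (key t) (window A a a') x →
      (∀ q ∈ pre (key t) (window A a a') x, ∃ p ∈ M, ¬ Disjoint (I.pts (b q)) (I.pts (b p)) ∧
        I.rad (b q) ≤ I.rad (b p)) →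
      ∑ q ∈ M, I.rad (b q) ≤ I.cost y + I.nD * ((l₂ - l₁) * 2 ^ I.nD) →
      ∃ a a' x e₁ e₂, a < I.nD + I.nD ∧ a' < I.nD + I.nD ∧ x ∈ A ∧ e₁ ∈ A ∧ e₂ ∈ A ∧
        unc (sets b) (candidate A t a a' x e₁ e₂) ≤ I.m ∧
        ¬ CompsGE (sets b) (candidate A t a a' x e₁ e₂) (I.k + 1) ∧
        ∀ σ, IsClustering b (candidate A t a a' x e₁ e₂) σ →
          I.cost (solutionOf σ) ≤ 12 * I.cost y := by
    intro M a a' x e₁ e₂ ha ha' hx he₁ he₂ hu hk hM hint hsum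
    rw [← candidate_eq he₁ he₂] at hu hk
    refine ⟨a, a', x, e₁, e₂, ha, ha', hx, he₁, he₂, hu, hk, fun σ hσ => ?_⟩
    rw [candidate_eq he₁ he₂] at hσ
    have hcost := hσ.cost_le_of_subfamily (hAv _ he₁).1 (hAv _ he₂).1 hM hint
    -- For `R ≠ 0` this is 6(cost + R/3) + 4R = 6 cost + 6R ≤ 12 cost; for `R = 0` all radii in `M`
    -- vanish and no error bound is needed.
    rcases eq_or_ne R 0 with h0 | h0
    · have hz : ∑ q ∈ M, I.rad (b q) ≤ 0 := sum_nonpos fun q hq => by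
        have : q ∈ A := (mem_filter.1 (pre_subset (hM hq))).1
        exact (hAv q this).1.trans h0.le
      have := cost_nonneg y
      linarith
    · have := hδ h0
      linarith
  have hu₁ := unc_run_le hy hR h₁
  have hu₂ := unc_run_le hy hR h₂
  have hmP : I.m < Fintype.card (Fin I.nD) := by simpa using hm
  by_cases hc : CompsGE (sets b) (early (sets b) (key t) I.m (window A 0 (I.nD - 1))) (I.k + 1)
  · obtain ⟨a, a₂, a', a₂', ha, ha₂, ha', ha₂', hwin, z, hz, x, hx, e₁, he₁, e₂, he₂, hun, hge,
      hrel, hcov, hcomp⟩ := exists_balanced_window (key_injective t) hn hmP hu₁ hu₂ hc hc₂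
    have hxA : x ∈ A := (mem_filter.1 hx).1
    set G := pre (key t) (window A a' a₂') x with hG
    obtain ⟨M, hM, hdis, hint⟩ := exists_disjoint_subfamily (sets b) (fun q => I.rad (b q)) G
      fun q _ => pts_nonempty _
    -- `N` is `M` with the isolated ball, if there is one: still disjoint, and now of size at least
    -- `k`, so that the opening costs cancel.
    obtain ⟨N, hMN, hND, hNdis, hNcard⟩ : ∃ N, M ⊆ N ∧ N ⊆ pre (key t) (window A a a₂) z ∧
        (∀ p ∈ N, ∀ q ∈ N, p ≠ q → Disjoint (I.pts (b p)) (I.pts (b q))) ∧ I.k ≤ N.card := by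
      rcases hrel with heq | ⟨d, heq, hd⟩
      · rw [heq] at hge ⊢
        refine ⟨M, subset_rfl, hM, hdis, hge.le_card hM (fun q _ => pts_nonempty _) fun q hq => ?_⟩
        obtain ⟨p, hp, hp', -⟩ := hint q hq
        exact ⟨p, hp, hp'⟩
      · rw [heq] at hge ⊢
        have hdM : ∀ p ∈ M, Disjoint (I.pts (b d)) (I.pts (b p)) := fun p hp =>
          hd.mono_right (subset_biUnion_of_mem (sets b) (hM hp))
        refine ⟨insert d M, subset_insert _ _, insert_subset_insert _ hM, ?_,
          hge.le_card (insert_subset_insert _ hM) (fun q _ => pts_nonempty _) fun q hq => ?_⟩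
        · intro p hp q hq hpq
          rcases mem_insert.1 hp with hp' | hp' <;> rcases mem_insert.1 hq with hq' | hq'
          · exact absurd (hp'.trans hq'.symm) hpq
          · rw [hp']; exact hdM q hq'
          · rw [hq']; exact (hdM p hp').symm
          · exact hdis p hp' q hq' hpq
        · rcases mem_insert.1 hq with rfl | hq'
          · refine ⟨q, mem_insert_self _ _, ?_⟩
            rw [disjoint_self]
            exact (pts_nonempty _).ne_empty
          · obtain ⟨p, hp, hp', -⟩ := hint q hq'
            exact ⟨p, mem_insert_of_mem hp, hp'⟩
    have hbound := dual_bound hy hl₁ hl hR h₁ h₂ hξ0 hξ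
      (W := window A a a₂) (fun q hq => by
        have : q < I.nD + I.nD := by
          have := (mem_filter.1 hq).2.2
          omega
        simp only [window, mem_union, mem_filter] at hq ⊢
        rcases lt_or_ge q I.nD with h | h
        · exact .inl ⟨hq.1, by omega⟩
        · exact .inr ⟨hq.1, by omega⟩)
      (by
        rcases hwin with h | h
        · refine .inl fun q hq => ?_
          simp only [window, mem_filter] at hq ⊢
          exact ⟨hq.1, by omega⟩
        · refine .inr fun q hq => ?_
          simp only [window, mem_filter] at hq ⊢
          exact ⟨hq.1, by omega⟩) hun hND hNdis
    rw [sum_add_distrib, sum_const, nsmul_eq_mul] at hbound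
    have h3 : (I.k : ℝ) * l₁ ≤ N.card * l₁ :=
      mul_le_mul_of_nonneg_right (by exact_mod_cast hNcard) hl₁
    have h4 : ∑ q ∈ M, I.rad (b q) ≤ ∑ q ∈ N, I.rad (b q) :=
      sum_le_sum_of_subset_of_nonneg hMN fun q _ _ => rad_nonneg _
    have h5 := le_max_left 0 (t z - (l₂ - l₁) * 2 ^ I.nD)
    exact finish ha' ha₂' hxA he₁ he₂ hcov hcomp hM hint (by linarith)
  -- Here `l₁ = 0`: the early balls of the first run are feasible themselves, and there are no
  -- opening costs to cancel.
  · obtain ⟨l, hl', -, heq⟩ := exists_early_eq_insert (key_injective t) hmP hu₁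
    obtain ⟨M, hM, hdis, hint⟩ := exists_disjoint_subfamily (sets b) (fun q => I.rad (b q))
      (pre (key t) (window A 0 (I.nD - 1)) l) fun q _ => pts_nonempty _
    have hlA : l ∈ A := (mem_filter.1 (mem_filter.1 hl').1).1
    have hz := hc₁.resolve_left hc
    have hbound := dual_bound hy hl₁ hl hR h₁ h₂ hξ0 hξ (subset_union_left) (.inl subset_rfl)
      (mem_filter.1 hl').2 hM hdis
    rw [hz, mul_zero] at hbound
    simp only [add_zero] at hbound
    have h5 := le_max_left 0 (t l - (l₂ - 0) * 2 ^ I.nD)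
    refine finish (by omega) (by omega) hlA hlA hlA ?_ ?_ hM hint (by rw [hz]; linarith)
    · rw [insert_eq_of_mem (mem_insert_self _ _), ← heq]
      exact unc_early_le hu₁
    · rw [insert_eq_of_mem (mem_insert_self _ _), ← heq]
      exact hc

end LBkSRO

/-! ### One step of the primal-dual method -/

namespace LBkSRO

open Finset SetFamily

variable {I : LBkSRO}

/-- The state of the primal-dual method after `n` steps: `Z` is the set of clients with a fixed
dual value, and the dual values of all other clients can be raised to `θ`. -/
structure PartialRun (R lam : ℝ) (n : ℕ) (A : Finset ℕ) (b : ℕ → I.Ball) (t : ℕ → ℝ)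
    (α : Fin I.nD → ℝ) (Z : Finset (Fin I.nD)) (θ : ℝ) : Prop where
  lt : ∀ q ∈ A, q < n
  mem_iff : ∀ p, p ∈ Z ↔ ∃ q ∈ A, p ∈ I.pts (b q)
  valid : ∀ q ∈ A, Valid R (b q)
  tight : ∀ q ∈ A, ∑ j ∈ I.pts (b q), α j = I.rad (b q) + lam
  le_time : ∀ q ∈ A, ∀ j ∈ I.pts (b q), α j ≤ t q
  time_nonneg : ∀ q ∈ A, 0 ≤ t q
  time_mono : ∀ x ∈ A, ∀ y ∈ A, x < y → t x ≤ t y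
  covers : ∀ j ∈ Z, ∃ q ∈ A, j ∈ I.pts (b q) ∧ α j = t q
  nonneg : 0 ≤ θ
  time_le : ∀ q ∈ A, t q ≤ θ
  slack : ∀ v, Valid R v →
    ∑ j ∈ I.pts v with j ∈ Z, α j + ((I.pts v).filter (· ∉ Z)).card * θ ≤ I.rad v + lam
  progress : n ≤ Z.card ∨ ∀ v, Valid R v → I.pts v ⊆ Z

theorem PartialRun.zero {R lam : ℝ} (hlam : 0 ≤ lam) (b : ℕ → I.Ball) (t : ℕ → ℝ)
    (α : Fin I.nD → ℝ) : PartialRun R lam 0 ∅ b t α ∅ 0 := by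
  constructor <;> try simp
  intro i j _
  exact add_nonneg (rad_nonneg (i, j)) hlam

namespace PartialRun

variable {R lam θ : ℝ} {n : ℕ} {A : Finset ℕ} {b : ℕ → I.Ball} {t : ℕ → ℝ}
  {α : Fin I.nD → ℝ} {Z : Finset (Fin I.nD)}

/-- Each step freezes a new client as long as some valid ball is not frozen entirely, so `I.nD`
steps complete the run. -/
theorem isRun (h : PartialRun R lam I.nD A b t α Z θ) : IsRun R lam A b t α := by
  have hZ : ∀ v, Valid R v → I.pts v ⊆ Z := by
    rcases h.progress with hp | hp
    · have : Z = univ := by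
        rw [← card_eq_iff_eq_univ, Fintype.card_fin]
        exact le_antisymm ((card_le_univ _).trans (Fintype.card_fin _).le) hp
      simp [this]
    · exact hp
  refine ⟨h.valid, h.tight, h.le_time, h.time_nonneg, h.time_mono,
    fun v hv j hj => h.covers j (hZ v hv hj), fun v hv => ?_⟩
  have h1 := h.slack v hv
  rw [filter_true_of_mem fun j hj => hZ v hv hj] at h1
  have h2 : (0 : ℝ) ≤ ((I.pts v).filter (· ∉ Z)).card * θ :=
    mul_nonneg (Nat.cast_nonneg _) h.nonneg
  linarith

theorem succ_of_forall (h : PartialRun R lam n A b t α Z θ)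
    (hv : ∀ v, Valid R v → I.pts v ⊆ Z) : PartialRun R lam (n + 1) A b t α Z θ :=
  { h with
    lt := fun q hq => (h.lt q hq).trans n.lt_succ_self
    progress := .inr hv }

/-- Raising all unfrozen clients to the smallest tight time `τ` violates no constraint and exhausts
that of `v`. -/
theorem succ (h : PartialRun R lam n A b t α Z θ) {v : I.Ball} (hv : Valid R v)
    (hvZ : 1 ≤ ((I.pts v).filter (· ∉ Z)).card) {τ : ℝ}
    (hτ : τ = (I.rad v + lam - ∑ j ∈ I.pts v with j ∈ Z, α j) /
      ((I.pts v).filter (· ∉ Z)).card)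
    (hmin : ∀ w, Valid R w → 1 ≤ ((I.pts w).filter (· ∉ Z)).card →
      τ ≤ (I.rad w + lam - ∑ j ∈ I.pts w with j ∈ Z, α j) / ((I.pts w).filter (· ∉ Z)).card) :
    PartialRun R lam (n + 1) (insert n A) (Function.update b n v) (Function.update t n τ)
      (fun p => if p ∈ I.pts v ∧ p ∉ Z then τ else α p) (Z ∪ I.pts v) τ := by
  have hnA : n ∉ A := fun hn => lt_irrefl n (h.lt n hn)
  have hne : ∀ q ∈ A, q ≠ n := fun q hq hqn => hnA (hqn ▸ hq)
  have hb : ∀ q ∈ A, Function.update b n v q = b q := fun q hq =>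
    Function.update_of_ne (hne q hq) _ _
  have ht : ∀ q ∈ A, Function.update t n τ q = t q := fun q hq =>
    Function.update_of_ne (hne q hq) _ _
  have hbZ : ∀ q ∈ A, I.pts (b q) ⊆ Z := fun q hq j hj => (h.mem_iff j).2 ⟨q, hq, hj⟩
  have hcast : ∀ {w : I.Ball}, 1 ≤ ((I.pts w).filter (· ∉ Z)).card →
      (0 : ℝ) < ((I.pts w).filter (· ∉ Z)).card := fun hw => by exact_mod_cast hw
  have hle : ∀ w, Valid R w →
      ∑ j ∈ I.pts w with j ∈ Z, α j + ((I.pts w).filter (· ∉ Z)).card * τ ≤ I.rad w + lam := by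
    intro w hw
    rcases Nat.eq_zero_or_pos ((I.pts w).filter (· ∉ Z)).card with h0 | h0
    · have := h.slack w hw
      rw [h0] at this ⊢
      simpa using this
    · have := hmin w hw h0
      rw [le_div_iff₀ (hcast h0)] at this
      linarith
  have hθτ : θ ≤ τ := by
    rw [hτ, le_div_iff₀ (hcast hvZ)]
    linarith [h.slack v hv]
  have hα : ∀ j ∈ Z, (if j ∈ I.pts v ∧ j ∉ Z then τ else α j) = α j := fun j hj =>
    if_neg fun h => h.2 hj
  -- Freezing the clients of `v` at `τ` only moves terms `τ` from the unfrozen to the frozen part.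
  have hsplit : ∀ w : I.Ball, ∑ j ∈ I.pts w with j ∈ Z ∪ I.pts v,
      (if j ∈ I.pts v ∧ j ∉ Z then τ else α j) +
        ((I.pts w).filter (· ∉ Z ∪ I.pts v)).card * τ =
      ∑ j ∈ I.pts w with j ∈ Z, α j + ((I.pts w).filter (· ∉ Z)).card * τ := by
    intro w
    simp only [card_eq_sum_ones, Nat.cast_sum, sum_mul, sum_filter,
      ← sum_add_distrib]
    refine sum_congr rfl fun j _ => ?_
    by_cases h1 : j ∈ Z <;> by_cases h2 : j ∈ I.pts v <;> simp [h1, h2]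
  constructor
  · intro q hq
    rcases mem_insert.1 hq with rfl | hq
    exacts [q.lt_succ_self, (h.lt q hq).trans n.lt_succ_self]
  · intro p
    rw [mem_union, h.mem_iff]
    simp only [mem_insert, exists_eq_or_imp, Function.update_self]
    rw [or_comm]
    refine or_congr_right ⟨?_, ?_⟩
    · rintro ⟨q, hq, hp⟩
      exact ⟨q, hq, by rwa [hb q hq]⟩
    · rintro ⟨q, hq, hp⟩
      exact ⟨q, hq, by rwa [hb q hq] at hp⟩
  · intro q hq
    rcases mem_insert.1 hq with rfl | hq
    · simpa using hv
    · rw [hb q hq]; exact h.valid q hq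
  · intro q hq
    rcases mem_insert.1 hq with rfl | hq
    · rw [Function.update_self]
      have h1 := hsplit v
      rw [filter_true_of_mem fun j hj => mem_union_right _ hj,
        filter_false_of_mem fun j hj => by simp [hj]] at h1
      rw [card_empty, Nat.cast_zero, zero_mul, add_zero] at h1
      rw [h1, hτ]
      field_simp [(hcast hvZ).ne']
      ring
    · rw [hb q hq, sum_congr rfl fun j hj => hα j (hbZ q hq hj)]
      exact h.tight q hq
  · intro q hq j hj
    rcases mem_insert.1 hq with rfl | hq
    · rw [Function.update_self] at hj ⊢
      by_cases hjZ : j ∈ Z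
      · simp only [hα j hjZ]
        obtain ⟨x, hx, -, hx'⟩ := h.covers j hjZ
        rw [hx']
        exact (h.time_le x hx).trans hθτ
      · simp [hj, hjZ]
    · rw [hb q hq] at hj
      simp only [hα j (hbZ q hq hj), ht q hq]
      exact h.le_time q hq j hj
  · intro q hq
    rcases mem_insert.1 hq with rfl | hq
    · rw [Function.update_self]; exact h.nonneg.trans hθτ
    · rw [ht q hq]; exact h.time_nonneg q hq
  · intro x hx y hy hxy
    rcases mem_insert.1 hy with rfl | hy'
    · rcases mem_insert.1 hx with rfl | hx'
      · exact le_rfl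
      · rw [ht x hx', Function.update_self]
        exact (h.time_le x hx').trans hθτ
    · rcases mem_insert.1 hx with rfl | hx'
      · exact absurd hxy (h.lt y hy').le.not_gt
      · rw [ht x hx', ht y hy']
        exact h.time_mono x hx' y hy' hxy
  · intro j hj
    by_cases hjZ : j ∈ Z
    · obtain ⟨q, hq, h1, h2⟩ := h.covers j hjZ
      refine ⟨q, mem_insert_of_mem hq, by rwa [hb q hq], ?_⟩
      exact (hα j hjZ).trans (by rw [ht q hq, h2])
    · have hjv := (mem_union.1 hj).resolve_left hjZ
      exact ⟨n, mem_insert_self _ _, by simpa using hjv, by simp [hjv, hjZ]⟩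
  · exact h.nonneg.trans hθτ
  · intro q hq
    rcases mem_insert.1 hq with rfl | hq
    · simp
    · rw [ht q hq]; exact (h.time_le q hq).trans hθτ
  · intro w hw
    rw [hsplit]
    exact hle w hw
  · rcases h.progress with hp | hp
    · left
      obtain ⟨j, hj⟩ := card_pos.1 hvZ
      rw [mem_filter] at hj
      have : Z ⊂ Z ∪ I.pts v :=
        ⟨subset_union_left, fun hs => hj.2 (hs (mem_union_right _ hj.1))⟩
      have := card_lt_card this
      omega
    · obtain ⟨j, hj⟩ := card_pos.1 hvZ
      rw [mem_filter] at hj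
      exact absurd (hp v hv hj.1) hj.2

end PartialRun

end LBkSRO

/-! ### The program -/

namespace RAM

/-- Sequential composition of a list of programs. -/
def block : List LProg → LProg
  | [] => .skip
  | [p] => p
  | p :: ps => .seq p (block ps)

/-- The value of a natural-number scalar. -/
abbrev nv (a : ℕ) : NExp := .get a (.lit 0)

/-- The value of a real scalar. -/
abbrev rv (a : ℕ) : RExp := .get a (.lit 0)

/-- Assignment to a natural-number scalar. -/
abbrev nset (a : ℕ) (e : NExp) : LProg := .setNat a (.lit 0) e

/-- Assignment to a real scalar. -/
abbrev rset (a : ℕ) (e : RExp) : LProg := .setReal a (.lit 0) e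

end RAM

namespace LBkSRO.Program

open RAM

/-- The number of facilities. -/
abbrev eF : NExp := .get 0 (.lit 0)
/-- The number of clients. -/
abbrev eD : NExp := .get 0 (.lit 1)
/-- The largest number of open facilities. -/
abbrev eK : NExp := .get 0 (.lit 2)
/-- The largest number of outliers. -/
abbrev eM : NExp := .get 0 (.lit 3)

/-- The distance between a facility and a client; array `4` holds the row offsets. -/
abbrev dist (i p : NExp) : RExp := .get 1 (.add (.add (.get 4 i) eF) p)

/-- Natural numbers cannot be multiplied by the machine, so the row offsets of the distance matrix
are accumulated once. -/
def initRows : LProg := .loop 20 eF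
  (.setNat 4 (.add (nv 20) (.lit 1)) (.add (.get 4 (nv 20)) (.add eF eD)))

def countBody : LProg :=
  .ite (.natLe (.get 5 (nv 23)) (.lit 0)) (nset 40 (.add (nv 40) (.lit 1))) .skip

/-- Scalar `40` becomes the number of clients without a fixed dual value. -/
def countUnfrozen : LProg := block [
  nset 40 (.lit 0), .loop 23 eD countBody]

def scanBody : LProg :=
  .ite (.realLe (dist (nv 24) (nv 26)) (dist (nv 24) (nv 25)))
    (block [nset 42 (.add (nv 42) (.lit 1)),
      .ite (.natLe (.get 5 (nv 26)) (.lit 0)) (nset 43 (.add (nv 43) (.lit 1)))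
        (rset 14 (.add (rv 14) (.get 2 (nv 26))))])
    .skip

/-- The size of the ball `(24, 25)`, the number of its clients without a fixed dual value, and the
sum of the fixed dual values. -/
def scanBall : LProg := block [
  nset 42 (.lit 0), nset 43 (.lit 0), rset 14 (.ofNat (.lit 0)), .loop 26 eD scanBody]

/-- Updates the ball which becomes tight first. -/
def tryBall : LProg := block [
  scanBall,
  .ite (.and (.realLe (dist (nv 24) (nv 25)) (rv 10))
      (.and (.natLe (.get 1 (nv 24)) (nv 42)) (.natLe (.lit 1) (nv 43))))
    (block [
      rset 19 (.div (.sub (.add (dist (nv 24) (nv 25)) (rv 13)) (rv 14)) (nv 43)),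
      .ite (.and (.natLe (.lit 1) (nv 41)) (.realLe (rv 15) (rv 19))) .skip
        (block [nset 41 (.lit 1), nset 44 (nv 24), nset 45 (nv 25), rset 15 (rv 19)])])
    .skip]

def findBall : LProg := block [nset 41 (.lit 0), .loop 24 eF (.loop 25 eD tryBall)]

/-- The first cell for the items of the current run. -/
abbrev scratch (q : NExp) : NExp := .add (.add eD eD) q

/-- An item consists of a presence flag (array `8`), centre and boundary client (`6`, `7`) and time
(real array `3`); `9` marks early items. The run for the lower opening cost lives in cells from 0,
that for the upper one in cells from nD, the current run in cells from 2nD. -/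
def recordBall : LProg := block [
  .setNat 8 (scratch (nv 22)) (nv 41),
  .setNat 6 (scratch (nv 22)) (nv 44),
  .setNat 7 (scratch (nv 22)) (nv 45),
  .setReal 3 (scratch (nv 22)) (rv 15),
  .ite (.and (.natLe (.lit 1) (nv 41)) (.natLe (.add eM (.lit 1)) (nv 40)))
    (.setNat 9 (scratch (nv 22)) (.lit 1)) (.setNat 9 (scratch (nv 22)) (.lit 0))]

def freezeBody : LProg :=
  .ite (.and (.realLe (dist (nv 44) (nv 27)) (dist (nv 44) (nv 45)))
      (.natLe (.get 5 (nv 27)) (.lit 0)))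
    (block [.setNat 5 (nv 27) (.lit 1), .setReal 2 (nv 27) (rv 15)]) .skip

def freezeBall : LProg := .ite (.natLe (.lit 1) (nv 41)) (.loop 27 eD freezeBody) .skip

def pdStep : LProg := block [countUnfrozen, findBall, recordBall, freezeBall]

def clearFrozen : LProg := .loop 21 eD (.setNat 5 (nv 21) (.lit 0))

/-- The primal-dual method for opening cost `13` and radius bound `10`. -/
def primalDual : LProg := block [clearFrozen, .loop 22 eD pdStep]

def copyBody : LProg := block [
    .setNat 6 (.add (nv 52) (nv 37)) (.get 6 (scratch (nv 37))),
    .setNat 7 (.add (nv 52) (nv 37)) (.get 7 (scratch (nv 37))),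
    .setNat 8 (.add (nv 52) (nv 37)) (.get 8 (scratch (nv 37))),
    .setReal 3 (.add (nv 52) (nv 37)) (.get 3 (scratch (nv 37)))]

/-- Moves the items of the current run to the cells starting at `52`. -/
def copyRun : LProg := .loop 37 eD copyBody

def relabelBody : LProg :=
  .ite (.and (.natLe (.get 11 (nv 31)) (nv 48)) (.natLe (nv 48) (.get 11 (nv 31))))
    (.setNat 11 (nv 31) (.add (nv 46) (.lit 1))) .skip

/-- Gives label `46` to all clients with label `48`. -/
def relabel : LProg := .loop 31 eD relabelBody

def mergeBody : LProg :=
  .ite (.and (.realLe (dist (nv 46) (nv 30)) (dist (nv 46) (nv 47)))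
      (.natLe (.lit 1) (.get 11 (nv 30))))
    (block [nset 48 (.get 11 (nv 30)), relabel]) .skip

def mergeClusters : LProg := .loop 30 eD mergeBody

def coverBody : LProg :=
  .ite (.realLe (dist (nv 46) (nv 32)) (dist (nv 46) (nv 47)))
    (.setNat 11 (nv 32) (.add (nv 46) (.lit 1))) .skip

def coverBall : LProg := .loop 32 eD coverBody

def mergeItem : LProg := block [
  nset 46 (.get 6 (nv 29)), nset 47 (.get 7 (nv 29)), mergeClusters, coverBall]

def buildBody : LProg := .ite (.natLe (.lit 1) (.get 10 (nv 29))) mergeItem .skip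

def clearLabels : LProg := .loop 28 eD (.setNat 11 (nv 28) (.lit 0))

/-- Clusters the clients by the items selected in array `10`. -/
def buildClusters : LProg := block [
  clearLabels, .loop 29 (.add (.add eD eD) eD) buildBody]

def outlierBody : LProg :=
  .ite (.natLe (.get 11 (nv 33)) (.lit 0)) (nset 49 (.add (nv 49) (.lit 1))) .skip

def countOutliers : LProg := block [nset 49 (.lit 0), .loop 33 eD outlierBody]

def clusterBody : LProg :=
  .ite (.and (.natLe (.get 11 (nv 35)) (.add (nv 34) (.lit 1)))
      (.natLe (.add (nv 34) (.lit 1)) (.get 11 (nv 35))))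
    (block [nset 51 (.lit 1),
      .ite (.realLe (dist (nv 34) (nv 35)) (rv 17)) .skip (rset 17 (dist (nv 34) (nv 35)))])
    .skip

/-- Whether cluster `34` is nonempty, and its radius. -/
def scanCluster : LProg := block [
  nset 51 (.lit 0), rset 17 (.ofNat (.lit 0)), .loop 35 eD clusterBody]

def evalBody : LProg := block [scanCluster, .setNat 12 (nv 34) (nv 51),
  nset 50 (.add (nv 50) (nv 51)), rset 16 (.add (rv 16) (rv 17))]

/-- Number of outliers, indicator of the open facilities, their number, and the cost. -/
def evalClusters : LProg := block [
  countOutliers,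
  nset 50 (.lit 0), rset 16 (.ofNat (.lit 0)), .loop 34 eF evalBody]

def earlyBody : LProg :=
  .ite (.and (.natLe (.add eD eD) (nv 36)) (.natLe (.lit 1) (.get 9 (nv 36))))
    (.setNat 10 (nv 36) (.lit 1)) (.setNat 10 (nv 36) (.lit 0))

def selectEarly : LProg := .loop 36 (.add (.add eD eD) eD) earlyBody

/-- Halves the interval between the opening costs `11` and `12`. -/
def bisect : LProg := block [
  rset 13 (.div (.add (rv 11) (rv 12)) (.lit 2)),
  primalDual, selectEarly, buildClusters, evalClusters,
  .ite (.natLe (nv 50) eK) (block [nset 52 eD, rset 12 (rv 13)])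
    (block [nset 52 (.lit 0), rset 11 (rv 13)]),
  copyRun]

/-- Tests have no disjunction, hence the negated conjunctions; the inner part is the lexicographic
comparison of (time, index) with item `62`. -/
def candidateBody : LProg :=
  .ite (.and (.and (.natLe (.lit 1) (.get 8 (nv 38))) (.not (.natLe (.add eD eD) (nv 38))))
      (.not (.and (.not (.and (.and (.natLe (nv 60) (nv 38)) (.natLe (nv 38) (nv 61)))
          (.and (.realLe (.get 3 (nv 38)) (.get 3 (nv 62)))
            (.not (.and (.realLe (.get 3 (nv 62)) (.get 3 (nv 38))) (.natLe (nv 62) (nv 38)))))))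
        (.and (.not (.and (.natLe (nv 38) (nv 63)) (.natLe (nv 63) (nv 38))))
          (.not (.and (.natLe (nv 38) (nv 64)) (.natLe (nv 64) (nv 38))))))))
      (.setNat 10 (nv 38) (.lit 1)) (.setNat 10 (nv 38) (.lit 0))

def selectCandidate : LProg := .loop 38 (.add (.add eD eD) eD) candidateBody

def copySolution : LProg := block [
  .loop 39 eD (.setNat 3 (nv 39) (.get 11 (nv 39))),
  .loop 65 eF (.setNat 2 (nv 65) (.get 12 (nv 65)))]

/-- Keeps the current solution if it is feasible and cheaper than the best one so far. -/
def updateBest : LProg :=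
  .ite (.and (.and (.natLe (nv 49) eM) (.natLe (nv 50) eK))
      (.not (.and (.natLe (.lit 1) (nv 53)) (.realLe (rv 18) (rv 16)))))
    (block [nset 53 (.lit 1), rset 18 (rv 16), copySolution]) .skip

def tryCandidate : LProg := block [selectCandidate, buildClusters, evalClusters, updateBest]

/-- The number of items of two runs. -/
abbrev eDD : NExp := .add eD eD

def search : LProg :=
  .loop 60 eDD (.loop 61 eDD (.loop 62 eDD (.loop 63 eDD (.loop 64 eDD tryCandidate))))

def initLower : LProg := block [
  rset 11 (.ofNat (.lit 0)), rset 13 (rv 11), primalDual, nset 52 (.lit 0), copyRun]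

def initUpper : LProg := block [
  .ite (.realLe (rv 10) (.ofNat (.lit 0))) (rset 12 (.ofNat (.lit 1)))
    (rset 12 (.add (.mul (.mul (rv 10) eD) eD) (rv 10))),
  rset 13 (rv 12), primalDual, nset 52 eD, copyRun]

/-- 7·nD halvings: nD of them absorb the factor 2^nD of `IsRun.abs_sub_le`, the others the
polynomial factors. -/
def bisectLoop : LProg :=
  .loop 70 (.add (.add (.add eD eD) (.add eD eD)) (.add (.add eD eD) eD)) bisect

/-- The algorithm for radius bound `10`. -/
def round : LProg := block [initLower, initUpper, bisectLoop, search]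

def roundBody : LProg := block [rset 10 (dist (nv 67) (nv 68)), round]

def allRounds : LProg := .loop 67 eF (.loop 68 eD roundBody)

/-- If all clients may be outliers, the zeros of the initial memory already present the empty
solution. -/
def main : LProg := block [initRows, .ite (.natLe eD eM) .skip allRounds]

theorem main_ok : main.ok = true := by decide

theorem main_writes : 0 ∉ main.natWrites := by decide

end LBkSRO.Program

/-! ### Correctness of the primal-dual program -/

namespace RAM

namespace LProg

@[simp] theorem den_skip (s : State) : skip.den s = s := rfl
@[simp] theorem den_setNat (a : ℕ) (i e : NExp) (s : State) :
    (setNat a i e).den s = s.setNat a (i.eval s) (e.eval s) := rfl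
@[simp] theorem den_setReal (a : ℕ) (i : NExp) (e : RExp) (s : State) :
    (setReal a i e).den s = s.setReal a (i.eval s) (e.eval s) := rfl
@[simp] theorem den_block_cons (p q : LProg) (ps : List LProg) (s : State) :
    (block (p :: q :: ps)).den s = (block (q :: ps)).den (p.den s) := rfl
@[simp] theorem den_block_singleton (p : LProg) (s : State) : (block [p]).den s = p.den s := rfl

theorem den_ite_pos {b : Test} {p q : LProg} {s : State} (h : b.holds s) :
    (ite b p q).den s = p.den s := if_pos h

theorem den_ite_neg {b : Test} {p q : LProg} {s : State} (h : ¬ b.holds s) :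
    (ite b p q).den s = q.den s := if_neg h

end LProg

attribute [simp] NExp.eval RExp.eval Test.holds State.setNat_nat State.setReal_real

end RAM

namespace LBkSRO

open Finset RAM

/-- Partial sums over `Fin n`. -/
def psum {M : Type*} [AddCommMonoid M] {n : ℕ} (f : Fin n → M) (i : ℕ) : M :=
  ∑ p with p.1 < i, f p

theorem psum_zero {M : Type*} [AddCommMonoid M] {n : ℕ} (f : Fin n → M) : psum f 0 = 0 := by
  simp [psum]

theorem psum_succ {M : Type*} [AddCommMonoid M] {n : ℕ} (f : Fin n → M) {i : ℕ} (h : i < n) :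
    psum f (i + 1) = psum f i + f ⟨i, h⟩ := by
  have : (univ.filter fun p : Fin n => p.1 < i + 1) =
      insert ⟨i, h⟩ (univ.filter fun p : Fin n => p.1 < i) := by
    ext p
    simp only [mem_filter, mem_univ, true_and, mem_insert, Fin.ext_iff]
    omega
  rw [psum, psum, this, sum_insert (by simp), add_comm]

theorem psum_self {M : Type*} [AddCommMonoid M] {n : ℕ} (f : Fin n → M) :
    psum f n = ∑ p, f p := by
  simp [psum]

theorem lt_succ_iff_fin {n i : ℕ} (h : i < n) {p : Fin n} :
    p.1 < i + 1 ↔ p.1 < i ∨ p = ⟨i, h⟩ := by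
  simp only [Fin.ext_iff]; omega

/-! ### Memory invariants and the search for the next tight ball. -/

/-- The memory contains the instance and the row offsets of the distance matrix. -/
structure HasInput (I : LBkSRO) (s : State) : Prop where
  nF : s.nat 0 0 = I.nF
  nD : s.nat 0 1 = I.nD
  k : s.nat 0 2 = I.k
  m : s.nat 0 3 = I.m
  L : ∀ i : Fin I.nF, s.nat 1 i = I.L i
  row : ∀ i : Fin I.nF, s.nat 4 i = i * (I.nF + I.nD)
  dist : ∀ (i : Fin I.nF) (p : Fin I.nD), s.real 1 (i * (I.nF + I.nD) + I.nF + p) = I.d i p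

theorem HasInput.congr {I : LBkSRO} {s t : State} (h : HasInput I s) (h0 : t.nat 0 = s.nat 0)
    (h1 : t.nat 1 = s.nat 1) (h4 : t.nat 4 = s.nat 4) (hr : t.real 1 = s.real 1) :
    HasInput I t := by
  constructor <;> simp only [h0, h1, h4, hr]
  exacts [h.nF, h.nD, h.k, h.m, h.L, h.row, h.dist]

theorem HasInput.den {I : LBkSRO} {s : State} (h : HasInput I s) (p : LProg)
    (h0 : 0 ∉ p.natWrites) (h1 : 1 ∉ p.natWrites) (h4 : 4 ∉ p.natWrites)
    (hr : 1 ∉ p.realWrites) : HasInput I (p.den s) :=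
  h.congr (p.den_nat s h0) (p.den_nat s h1) (p.den_nat s h4) (p.den_real s hr)

namespace Program

variable {I : LBkSRO}

theorem dist_eval {s : State} (h : HasInput I s) {i p : NExp} (i' : Fin I.nF) (p' : Fin I.nD)
    (hi : i.eval s = i') (hp : p.eval s = p') : (dist i p).eval s = I.d i' p' := by
  simp only [RExp.eval, NExp.eval, hi, hp, h.row, h.nF, h.dist]

/-- Array `5` is the indicator of `Z`. -/
def Frozen (s : State) (Z : Finset (Fin I.nD)) : Prop :=
  ∀ p : Fin I.nD, s.nat 5 p = if p ∈ Z then 1 else 0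

theorem countUnfrozen_spec {s : State} (h : HasInput I s) {Z : Finset (Fin I.nD)}
    (hZ : Frozen s Z) : (countUnfrozen.den s).nat 40 0 = (Zᶜ).card := by
  rw [countUnfrozen, LProg.den_block_cons, LProg.den_block_singleton]
  set f : Fin I.nD → ℕ := fun p => if p ∉ Z then 1 else 0 with hf
  refine (LProg.loop_spec I.nD (fun i t => t.nat 40 0 = psum f i) (by simp [h.nD])
    (by simp [psum_zero]) fun i t hi hv hn hr hJ => ?_).trans ?_
  · have hf' : t.nat 5 i = if (⟨i, hi⟩ : Fin I.nD) ∈ Z then 1 else 0 := by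
      rw [hn 5 (by decide)]; exact hZ ⟨i, hi⟩
    rw [psum_succ f hi, countBody]
    by_cases hp : (⟨i, hi⟩ : Fin I.nD) ∈ Z
    · rw [LProg.den_ite_neg (by simp [hv, hf', hp])]
      simp [hJ, hf, hp]
    · rw [LProg.den_ite_pos (by simp [hv, hf', hp])]
      simp [hJ, hf, hp]
  · rw [psum_self, hf, compl_eq_univ_sdiff, ← filter_notMem_eq_sdiff, card_filter]

theorem scanBall_spec {s : State} (h : HasInput I s) {Z : Finset (Fin I.nD)} (hZ : Frozen s Z)
    {α : Fin I.nD → ℝ} (hα : ∀ p ∈ Z, s.real 2 p = α p) (v : I.Ball) (h1 : s.nat 24 0 = v.1)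
    (h2 : s.nat 25 0 = v.2) :
    (scanBall.den s).nat 42 0 = (I.pts v).card ∧
      (scanBall.den s).nat 43 0 = ((I.pts v).filter (· ∉ Z)).card ∧
      (scanBall.den s).real 14 0 = ∑ p ∈ I.pts v with p ∈ Z, α p := by
  simp only [scanBall, LProg.den_block_cons, LProg.den_block_singleton]
  set s' := (rset 14 (.ofNat (.lit 0))).den ((nset 43 (.lit 0)).den ((nset 42 (.lit 0)).den s))
    with hs'
  have hI' : HasInput I s' := h.congr rfl rfl rfl (State.setReal_real_ne _ (by decide))
  set f : Fin I.nD → ℕ := fun p => if p ∈ I.pts v then 1 else 0 with hf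
  set g : Fin I.nD → ℕ := fun p => if p ∈ I.pts v then (if p ∉ Z then 1 else 0) else 0 with hg
  set a : Fin I.nD → ℝ := fun p => if p ∈ I.pts v then (if p ∈ Z then α p else 0) else 0 with ha
  obtain ⟨k1, k2, k3⟩ := LProg.loop_spec (v := 26) (e := eD) (p := scanBody) (s := s') I.nD
    (fun i t => t.nat 42 0 = psum f i ∧ t.nat 43 0 = psum g i ∧ t.real 14 0 = psum a i)
    (by simp [hs', h.nD]) (by simp [hs', psum_zero]) (by
      rintro i t hi hv hn hr ⟨j1, j2, j3⟩
      have hIt : HasInput I t := hI'.congr (hn 0 (by decide)) (hn 1 (by decide)) (hn 4 (by decide))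
        (hr 1 (by decide))
      have h24 : t.nat 24 0 = v.1 := by rw [hn 24 (by decide)]; simpa [hs'] using h1
      have h25 : t.nat 25 0 = v.2 := by rw [hn 25 (by decide)]; simpa [hs'] using h2
      have hf' : t.nat 5 i = if (⟨i, hi⟩ : Fin I.nD) ∈ Z then 1 else 0 := by
        rw [hn 5 (by decide)]; simpa [hs'] using hZ ⟨i, hi⟩
      have hα' : (⟨i, hi⟩ : Fin I.nD) ∈ Z → t.real 2 i = α ⟨i, hi⟩ := fun hp => by
        rw [hr 2 (by decide)]; simpa [hs'] using hα _ hp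
      have hd1 := dist_eval hIt (i := nv 24) (p := nv 26) v.1 ⟨i, hi⟩ h24 hv
      have hd2 := dist_eval hIt (i := nv 24) (p := nv 25) v.1 v.2 h24 h25
      have hmem : Test.holds t (.realLe (dist (nv 24) (nv 26)) (dist (nv 24) (nv 25))) ↔
          (⟨i, hi⟩ : Fin I.nD) ∈ I.pts v := by rw [Test.holds, hd1, hd2, mem_pts]; rfl
      rw [psum_succ f hi, psum_succ g hi, psum_succ a hi, scanBody]
      by_cases hp : (⟨i, hi⟩ : Fin I.nD) ∈ I.pts v
      · rw [LProg.den_ite_pos (hmem.2 hp), LProg.den_block_cons, LProg.den_block_singleton]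
        by_cases hz : (⟨i, hi⟩ : Fin I.nD) ∈ Z
        · rw [LProg.den_ite_neg (by simp [hv, hf', hz])]
          simp [hf, hg, ha, hp, hz, j1, j2, j3, hv, hα']
        · rw [LProg.den_ite_pos (by simp [hv, hf', hz])]
          simp [hf, hg, ha, hp, hz, j1, j2, j3]
      · rw [LProg.den_ite_neg (fun hc => hp (hmem.1 hc))]
        simp [hf, hg, ha, hp, j1, j2, j3])
  refine ⟨k1.trans ?_, k2.trans ?_, k3.trans ?_⟩ <;> rw [psum_self]
  · simp [hf]
  · simp only [hg]
    rw [sum_ite_mem, univ_inter, card_filter]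
  · simp only [ha]
    rw [sum_ite_mem, univ_inter, sum_filter]

/-- The ball `v` can still become tight. -/
def Eligible (R : ℝ) (Z : Finset (Fin I.nD)) (v : I.Ball) : Prop :=
  Valid R v ∧ 1 ≤ ((I.pts v).filter (· ∉ Z)).card

/-- The time at which the ball `v` becomes tight. -/
noncomputable def tightTime (lam : ℝ) (Z : Finset (Fin I.nD)) (α : Fin I.nD → ℝ) (v : I.Ball) :
    ℝ :=
  (I.rad v + lam - ∑ j ∈ I.pts v with j ∈ Z, α j) / ((I.pts v).filter (· ∉ Z)).card

/-- The scalars `41, 44, 45` and `15` describe the first ball of `Q` to become tight. -/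
def BestBall (R lam : ℝ) (Z : Finset (Fin I.nD)) (α : Fin I.nD → ℝ) (Q : I.Ball → Prop)
    (s : State) : Prop :=
  (s.nat 41 0 = 0 ∧ ∀ v, Q v → ¬ Eligible R Z v) ∨
  (s.nat 41 0 = 1 ∧ ∃ v, Eligible R Z v ∧ s.nat 44 0 = v.1 ∧ s.nat 45 0 = v.2 ∧
    s.real 15 0 = tightTime lam Z α v ∧
    ∀ w, Q w → Eligible R Z w → tightTime lam Z α v ≤ tightTime lam Z α w)

/-- The data read by the search for the next tight ball. -/
structure PDInput (R lam : ℝ) (Z : Finset (Fin I.nD)) (α : Fin I.nD → ℝ) (s : State) : Prop where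
  input : HasInput I s
  frozen : Frozen s Z
  dual : ∀ p ∈ Z, s.real 2 p = α p
  R : s.real 10 0 = R
  lam : s.real 13 0 = lam

theorem PDInput.congr {R lam : ℝ} {Z : Finset (Fin I.nD)} {α : Fin I.nD → ℝ} {s t : State}
    (h : PDInput R lam Z α s) (h0 : t.nat 0 = s.nat 0) (h1 : t.nat 1 = s.nat 1)
    (h4 : t.nat 4 = s.nat 4) (hr1 : t.real 1 = s.real 1) (h5 : t.nat 5 = s.nat 5)
    (hr2 : t.real 2 = s.real 2) (hr10 : t.real 10 = s.real 10) (hr13 : t.real 13 = s.real 13) :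
    PDInput R lam Z α t := by
  refine ⟨h.input.congr h0 h1 h4 hr1, fun p => ?_, fun p hp => ?_, ?_, ?_⟩
  · rw [h5]; exact h.frozen p
  · rw [hr2]; exact h.dual p hp
  · rw [hr10]; exact h.R
  · rw [hr13]; exact h.lam

variable {R lam : ℝ} {Z : Finset (Fin I.nD)} {α : Fin I.nD → ℝ}

theorem tryBall_spec {s : State} (h : PDInput R lam Z α s) (v : I.Ball) (h1 : s.nat 24 0 = v.1)
    (h2 : s.nat 25 0 = v.2) {Q : I.Ball → Prop} (hb : BestBall R lam Z α Q s) :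
    BestBall R lam Z α (fun w => Q w ∨ w = v) (tryBall.den s) := by
  rw [tryBall, LProg.den_block_cons, LProg.den_block_singleton]
  obtain ⟨k1, k2, k3⟩ := scanBall_spec h.input h.frozen h.dual v h1 h2
  set t := scanBall.den s with ht
  have hn : ∀ {a}, a ∉ scanBall.natWrites → t.nat a = s.nat a := fun ha => scanBall.den_nat s ha
  have hr : ∀ {a}, a ∉ scanBall.realWrites → t.real a = s.real a := fun ha =>
    scanBall.den_real s ha
  have hIt : PDInput R lam Z α t := h.congr (hn (by decide)) (hn (by decide)) (hn (by decide))
    (hr (by decide)) (hn (by decide)) (hr (by decide)) (hr (by decide)) (hr (by decide))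
  have h24 : t.nat 24 0 = v.1 := by rw [hn (by decide), h1]
  have h25 : t.nat 25 0 = v.2 := by rw [hn (by decide), h2]
  have hd := dist_eval hIt.input (i := nv 24) (p := nv 25) v.1 v.2 h24 h25
  have hb' : BestBall R lam Z α Q t := by
    simpa only [BestBall, hn (a := 41) (by decide), hn (a := 44) (by decide),
      hn (a := 45) (by decide), hr (a := 15) (by decide)] using hb
  have hel : Test.holds t (.and (.realLe (dist (nv 24) (nv 25)) (rv 10))
      (.and (.natLe (.get 1 (nv 24)) (nv 42)) (.natLe (.lit 1) (nv 43)))) ↔ Eligible R Z v := by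
    simp only [Test.holds, hd]
    simp only [RExp.eval, NExp.eval, hIt.R, h24, hIt.input.L, k1, k2, Eligible, Valid, and_assoc]
    rfl
  by_cases hv : Eligible R Z v
  · rw [LProg.den_ite_pos (hel.2 hv), LProg.den_block_cons, LProg.den_block_singleton]
    set u := (rset 19 (.div (.sub (.add (dist (nv 24) (nv 25)) (rv 13)) (rv 14)) (nv 43))).den t
      with hu
    have hτ : u.real 19 0 = tightTime lam Z α v := by
      simp only [hu, LProg.den_setReal, RExp.eval, State.setReal_real] at hd ⊢
      rw [if_pos (by simp), hd]
      simp only [NExp.eval, hIt.lam, k2, k3]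
      rfl
    have hur : ∀ {a}, a ≠ 19 → u.real a = t.real a := fun ha => State.setReal_real_ne _ ha
    have hun : u.nat = t.nat := rfl
    rcases hb' with ⟨hb0, hbQ⟩ | ⟨hb1, w, hw, hw1, hw2, hw3, hw4⟩
    · rw [LProg.den_ite_neg (by simp [hun, hb0])]
      refine .inr ⟨by simp, v, hv, ?_, ?_, ?_, ?_⟩
      · simp [hun, h24]
      · simp [hun, h25]
      · simp [hτ]
      · rintro w (hw | rfl) hw'
        · exact absurd hw' (hbQ w hw)
        · exact le_rfl
    · by_cases hle : tightTime lam Z α w ≤ tightTime lam Z α v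
      · rw [LProg.den_ite_pos (by simp [hun, hb1, hτ, hur, hw3, hle])]
        refine .inr ⟨by simp [hun, hb1], w, hw, by simp [hun, hw1], by simp [hun, hw2],
          by simp [hur, hw3], ?_⟩
        rintro w' (hw' | rfl) hel'
        · exact hw4 w' hw' hel'
        · exact hle
      · rw [LProg.den_ite_neg (by simp [hun, hb1, hτ, hur, hw3, hle])]
        refine .inr ⟨by simp, v, hv, by simp [hun, h24], by simp [hun, h25], by simp [hτ], ?_⟩
        rintro w' (hw' | rfl) hel'
        · exact (not_le.1 hle).le.trans (hw4 w' hw' hel')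
        · exact le_rfl
  · rw [LProg.den_ite_neg (fun hc => hv (hel.1 hc)), LProg.den_skip]
    rcases hb' with ⟨hb0, hbQ⟩ | ⟨hb1, w, hw, hw1, hw2, hw3, hw4⟩
    · refine .inl ⟨hb0, ?_⟩
      rintro w (hw | rfl)
      exacts [hbQ w hw, hv]
    · refine .inr ⟨hb1, w, hw, hw1, hw2, hw3, ?_⟩
      rintro w' (hw' | rfl) hel'
      exacts [hw4 w' hw' hel', absurd hel' hv]

theorem BestBall.congr {Q Q' : I.Ball → Prop} {s t : State} (h : BestBall R lam Z α Q s)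
    (hQ : ∀ v, Q' v ↔ Q v) (h1 : t.nat 41 = s.nat 41) (h2 : t.nat 44 = s.nat 44)
    (h3 : t.nat 45 = s.nat 45) (h4 : t.real 15 = s.real 15) : BestBall R lam Z α Q' t := by
  simpa only [BestBall, h1, h2, h3, h4, hQ] using h

theorem findBall_spec {s : State} (h : PDInput R lam Z α s) :
    BestBall R lam Z α (fun _ => True) (findBall.den s) := by
  rw [findBall, LProg.den_block_cons, LProg.den_block_singleton]
  refine BestBall.congr (Q := fun v => v.1.1 < I.nF) (s := (LProg.loop 24 eF
    (.loop 25 eD tryBall)).den ((nset 41 (.lit 0)).den s)) ?_ (by simp) rfl rfl rfl rfl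
  refine LProg.loop_spec I.nF (fun i t => BestBall R lam Z α (fun v => v.1.1 < i) t)
    (by simp [h.input.nF]) (.inl ⟨by simp, by simp⟩) fun i t hi hv hn hr hJ => ?_
  have hIt : PDInput R lam Z α t := h.congr (hn 0 (by decide)) (hn 1 (by decide))
    (hn 4 (by decide)) (hr 1 (by decide)) (hn 5 (by decide)) (hr 2 (by decide))
    (hr 10 (by decide)) (hr 13 (by decide))
  refine BestBall.congr (Q := fun v => v.1.1 < i ∨ (v.1.1 = i ∧ v.2.1 < I.nD))
    (s := (LProg.loop 25 eD tryBall).den t) ?_ (fun v => by simp; omega)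
    (State.setNat_nat_ne _ (by decide)) (State.setNat_nat_ne _ (by decide))
    (State.setNat_nat_ne _ (by decide)) rfl
  refine LProg.loop_spec I.nD
    (fun j t => BestBall R lam Z α (fun v => v.1.1 < i ∨ (v.1.1 = i ∧ v.2.1 < j)) t)
    (by simp [hIt.input.nD]) (hJ.congr (by simp) (State.setNat_nat_ne _ (by decide))
      (State.setNat_nat_ne _ (by decide)) (State.setNat_nat_ne _ (by decide)) rfl)
    fun j u hj hv' hn' hr' hJ' => ?_
  have hIu : PDInput R lam Z α u := hIt.congr (hn' 0 (by decide)) (hn' 1 (by decide))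
    (hn' 4 (by decide)) (hr' 1 (by decide)) (hn' 5 (by decide)) (hr' 2 (by decide))
    (hr' 10 (by decide)) (hr' 13 (by decide))
  have := tryBall_spec hIu (⟨i, hi⟩, ⟨j, hj⟩) (by rw [hn' 24 (by decide)]; exact hv) hv' hJ'
  refine this.congr (fun v => ?_) (State.setNat_nat_ne _ (by decide))
    (State.setNat_nat_ne _ (by decide)) (State.setNat_nat_ne _ (by decide)) rfl
  rw [Prod.ext_iff, Fin.ext_iff, Fin.ext_iff]
  simp only
  omega

end Program
end LBkSRO

/-! ### Recording and freezing a ball; a complete run. -/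

namespace LBkSRO

open Finset RAM SetFamily

namespace Program

variable {I : LBkSRO} {R lam : ℝ} {Z : Finset (Fin I.nD)} {α : Fin I.nD → ℝ}

theorem freezeBall_spec {s : State} (h : PDInput R lam Z α s) (v : I.Ball) {τ : ℝ}
    (h1 : s.nat 41 0 = 1) (h2 : s.nat 44 0 = v.1) (h3 : s.nat 45 0 = v.2)
    (h4 : s.real 15 0 = τ) :
    PDInput R lam (Z ∪ I.pts v) (fun p => if p ∈ I.pts v ∧ p ∉ Z then τ else α p)
      (freezeBall.den s) := by
  have hfr : ∀ {a}, a ∉ freezeBall.natWrites → (freezeBall.den s).nat a = s.nat a := fun ha =>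
    freezeBall.den_nat s ha
  have hfr' : ∀ {a}, a ∉ freezeBall.realWrites → (freezeBall.den s).real a = s.real a := fun ha =>
    freezeBall.den_real s ha
  have hI := h.input.den freezeBall (by decide) (by decide) (by decide) (by decide)
  have hR : (freezeBall.den s).real 10 0 = R := by rw [hfr' (by decide), h.R]
  have hlam : (freezeBall.den s).real 13 0 = lam := by rw [hfr' (by decide), h.lam]
  have hden : freezeBall.den s = (LProg.loop 27 eD freezeBody).den s := by
    rw [freezeBall, LProg.den_ite_pos (by simp [h1])]
  rw [hden] at hI hR hlam ⊢
  set α' : Fin I.nD → ℝ := fun p => if p ∈ I.pts v ∧ p ∉ Z then τ else α p with hα'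
  obtain ⟨k1, k2⟩ := LProg.loop_spec (v := 27) (e := eD) (p := freezeBody) (s := s) I.nD
    (fun i t => (∀ p : Fin I.nD, t.nat 5 p = if p ∈ Z ∨ (p ∈ I.pts v ∧ p.1 < i) then 1 else 0) ∧
      ∀ p : Fin I.nD, p ∈ Z ∨ (p ∈ I.pts v ∧ p.1 < i) → t.real 2 p = α' p)
    (by simp [h.input.nD])
    ⟨fun p => by simpa using h.frozen p, fun p hp => by
      have hpZ : p ∈ Z := by simpa using hp
      simpa [hα', hpZ] using h.dual p hpZ⟩
    (by
      rintro i t hi hv hn hr ⟨j1, j2⟩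
      have hIt : HasInput I t := h.input.congr (hn 0 (by decide)) (hn 1 (by decide))
        (hn 4 (by decide)) (hr 1 (by decide))
      have h44 : t.nat 44 0 = v.1 := by rw [hn 44 (by decide), h2]
      have h45 : t.nat 45 0 = v.2 := by rw [hn 45 (by decide), h3]
      have h15 : t.real 15 0 = τ := by rw [hr 15 (by decide), h4]
      have hd1 := dist_eval hIt (i := nv 44) (p := nv 27) v.1 ⟨i, hi⟩ h44 hv
      have hd2 := dist_eval hIt (i := nv 44) (p := nv 45) v.1 v.2 h44 h45
      have ht5 : t.nat 5 i = if (⟨i, hi⟩ : Fin I.nD) ∈ Z then 1 else 0 := by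
        simpa using j1 ⟨i, hi⟩
      have hc : Test.holds t (.and (.realLe (dist (nv 44) (nv 27)) (dist (nv 44) (nv 45)))
          (.natLe (.get 5 (nv 27)) (.lit 0))) ↔
          (⟨i, hi⟩ : Fin I.nD) ∈ I.pts v ∧ (⟨i, hi⟩ : Fin I.nD) ∉ Z := by
        simp only [Test.holds, hd1, hd2, mem_pts]
        refine and_congr_right fun _ => ?_
        simp only [NExp.eval, hv, ht5]
        split_ifs with hz <;> simp [hz]
      have hstep : ∀ p : Fin I.nD, (p ∈ Z ∨ (p ∈ I.pts v ∧ p.1 < i + 1)) ↔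
          (p ∈ Z ∨ (p ∈ I.pts v ∧ p.1 < i)) ∨
            (p = ⟨i, hi⟩ ∧ p ∈ I.pts v ∧ p ∉ Z) := by
        intro p
        rw [lt_succ_iff_fin hi]
        tauto
      rw [freezeBody]
      by_cases hcc : (⟨i, hi⟩ : Fin I.nD) ∈ I.pts v ∧ (⟨i, hi⟩ : Fin I.nD) ∉ Z
      · rw [LProg.den_ite_pos (hc.2 hcc)]
        refine ⟨fun p => ?_, fun p hp => ?_⟩
        · by_cases hpi : p = ⟨i, hi⟩
          · subst hpi
            simp [hv, hcc.1]
          · have : p.1 ≠ i := fun h => hpi (Fin.ext h)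
            simp only [hstep, hpi, false_and, or_false, ← j1 p]
            simp [hv, this]
        · by_cases hpi : p = ⟨i, hi⟩
          · subst hpi
            simp [hv, hα', hcc.1, hcc.2, h15]
          · have : p.1 ≠ i := fun h => hpi (Fin.ext h)
            rw [hstep] at hp
            simp only [hpi, false_and, or_false] at hp
            rw [← j2 p hp]
            simp [hv, this]
      · rw [LProg.den_ite_neg fun h => hcc (hc.1 h), LProg.den_skip]
        have hstep' : ∀ p : Fin I.nD, (p ∈ Z ∨ (p ∈ I.pts v ∧ p.1 < i + 1)) ↔
            (p ∈ Z ∨ (p ∈ I.pts v ∧ p.1 < i)) := fun p => by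
          rw [hstep]
          refine or_iff_left ?_
          rintro ⟨rfl, h⟩
          exact hcc h
        refine ⟨fun p => ?_, fun p hp => ?_⟩
        · simp only [hstep', ← j1 p]
          simp
        · exact j2 p ((hstep' p).1 hp))
  refine ⟨hI, fun p => ?_, fun p hp => ?_, hR, hlam⟩
  · rw [k1 p]; simp
  · exact k2 p (by simpa using hp)

/-- The cells starting at `o` describe the items `A`. -/
def Slots (s : State) (o N : ℕ) (A : Finset ℕ) (b : ℕ → I.Ball) (t : ℕ → ℝ) : Prop :=
  ∀ q < N, s.nat 8 (o + q) = (if q ∈ A then 1 else 0) ∧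
    (q ∈ A → s.nat 6 (o + q) = (b q).1 ∧ s.nat 7 (o + q) = (b q).2 ∧ s.real 3 (o + q) = t q)

/-- Array `9` marks the items at which more than `m` clients are not covered by earlier items. -/
def EarlyMarks (s : State) (o N : ℕ) (A : Finset ℕ) (b : ℕ → I.Ball) : Prop :=
  ∀ q < N, s.nat 9 (o + q) = if q ∈ A ∧ I.m < unc (sets b) (A.filter (· < q)) then 1 else 0

/-- The state of the program after `n` steps of the primal-dual method. -/
def AtStep (R lam : ℝ) (n : ℕ) (I : LBkSRO) (s : State) : Prop :=
  ∃ (A : Finset ℕ) (b : ℕ → I.Ball) (t : ℕ → ℝ) (α : Fin I.nD → ℝ) (Z : Finset (Fin I.nD))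
    (θ : ℝ), PartialRun R lam n A b t α Z θ ∧ PDInput R lam Z α s ∧
    Slots s (I.nD + I.nD) n A b t ∧ EarlyMarks s (I.nD + I.nD) n A b

theorem recordBall_spec {s : State} (h : HasInput I s) {n : ℕ} (h22 : s.nat 22 0 = n) :
    (∀ j, (recordBall.den s).nat 8 j = if j = I.nD + I.nD + n then s.nat 41 0 else s.nat 8 j) ∧
    (∀ j, (recordBall.den s).nat 6 j = if j = I.nD + I.nD + n then s.nat 44 0 else s.nat 6 j) ∧
    (∀ j, (recordBall.den s).nat 7 j = if j = I.nD + I.nD + n then s.nat 45 0 else s.nat 7 j) ∧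
    (∀ j, (recordBall.den s).real 3 j =
      if j = I.nD + I.nD + n then s.real 15 0 else s.real 3 j) ∧
    (∀ j, (recordBall.den s).nat 9 j = if j = I.nD + I.nD + n then
      (if 1 ≤ s.nat 41 0 ∧ I.m + 1 ≤ s.nat 40 0 then 1 else 0) else s.nat 9 j) := by
  simp only [recordBall, LProg.den_block_cons, LProg.den_block_singleton]
  by_cases hc : 1 ≤ s.nat 41 0 ∧ I.m + 1 ≤ s.nat 40 0
  · rw [LProg.den_ite_pos (by simpa [h.m] using hc)]
    simp [h.nD, h22, hc]
  · rw [LProg.den_ite_neg (by simpa [h.m] using hc)]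
    rw [if_neg hc]
    simp [h.nD, h22]

theorem pdStep_spec {s : State} {n : ℕ} (h : AtStep R lam n I s) (h22 : s.nat 22 0 = n) :
    AtStep R lam (n + 1) I (pdStep.den s) := by
  obtain ⟨A, b, t, α, Z, θ, hrun, hin, hslots, hearly⟩ := h
  simp only [pdStep, LProg.den_block_cons, LProg.den_block_singleton]
  -- Frozen means covered by an earlier item, so the number of unfrozen clients decides whether the
  -- new item is early.
  have hZeq : A.biUnion (sets b) = Z := by
    ext p; rw [hrun.mem_iff]; simp
  have hcount := countUnfrozen_spec hin.input hin.frozen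
  set s₁ := countUnfrozen.den s with hs₁
  have hn1 : ∀ {a}, a ∉ countUnfrozen.natWrites → s₁.nat a = s.nat a := fun ha =>
    LProg.den_nat _ _ ha
  have hr1 : ∀ {a}, a ∉ countUnfrozen.realWrites → s₁.real a = s.real a := fun ha =>
    LProg.den_real _ _ ha
  have hin1 : PDInput R lam Z α s₁ := hin.congr (hn1 (by decide)) (hn1 (by decide))
    (hn1 (by decide)) (hr1 (by decide)) (hn1 (by decide)) (hr1 (by decide)) (hr1 (by decide))
    (hr1 (by decide))
  have hbest := findBall_spec hin1
  set s₂ := findBall.den s₁ with hs₂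
  have hn2 : ∀ {a}, a ∉ findBall.natWrites → s₂.nat a = s₁.nat a := fun ha =>
    LProg.den_nat _ _ ha
  have hr2 : ∀ {a}, a ∉ findBall.realWrites → s₂.real a = s₁.real a := fun ha =>
    LProg.den_real _ _ ha
  have hin2 : PDInput R lam Z α s₂ := hin1.congr (hn2 (by decide)) (hn2 (by decide))
    (hn2 (by decide)) (hr2 (by decide)) (hn2 (by decide)) (hr2 (by decide)) (hr2 (by decide))
    (hr2 (by decide))
  have h22' : s₂.nat 22 0 = n := by rw [hn2 (by decide), hn1 (by decide), h22]
  obtain ⟨r8, r6, r7, r3, r9⟩ := recordBall_spec hin2.input h22'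
  have h40 : s₂.nat 40 0 = unc (sets b) A := by
    rw [hn2 (by decide), hcount, ← hZeq, unc]
  set s₃ := recordBall.den s₂ with hs₃
  have hn3 : ∀ {a}, a ∉ recordBall.natWrites → s₃.nat a = s₂.nat a := fun ha =>
    LProg.den_nat _ _ ha
  have hr3 : ∀ {a}, a ∉ recordBall.realWrites → s₃.real a = s₂.real a := fun ha =>
    LProg.den_real _ _ ha
  have hin3 : PDInput R lam Z α s₃ := hin2.congr (hn3 (by decide)) (hn3 (by decide))
    (hn3 (by decide)) (hr3 (by decide)) (hn3 (by decide)) (hr3 (by decide)) (hr3 (by decide))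
    (hr3 (by decide))
  have hn4 : ∀ {a}, a ∉ freezeBall.natWrites → (freezeBall.den s₃).nat a = s₃.nat a := fun ha =>
    LProg.den_nat _ _ ha
  have hr4 : ∀ {a}, a ∉ freezeBall.realWrites → (freezeBall.den s₃).real a = s₃.real a :=
    fun ha => LProg.den_real _ _ ha
  have hnA : n ∉ A := fun hn => lt_irrefl n (hrun.lt n hn)
  have hold8 : ∀ q < n, (freezeBall.den s₃).nat 8 (I.nD + I.nD + q) =
      s.nat 8 (I.nD + I.nD + q) := fun q hq => by
    rw [hn4 (by decide), r8, if_neg (by omega), hn2 (by decide), hn1 (by decide)]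
  have hold6 : ∀ q < n, (freezeBall.den s₃).nat 6 (I.nD + I.nD + q) =
      s.nat 6 (I.nD + I.nD + q) := fun q hq => by
    rw [hn4 (by decide), r6, if_neg (by omega), hn2 (by decide), hn1 (by decide)]
  have hold7 : ∀ q < n, (freezeBall.den s₃).nat 7 (I.nD + I.nD + q) =
      s.nat 7 (I.nD + I.nD + q) := fun q hq => by
    rw [hn4 (by decide), r7, if_neg (by omega), hn2 (by decide), hn1 (by decide)]
  have hold9 : ∀ q < n, (freezeBall.den s₃).nat 9 (I.nD + I.nD + q) =
      s.nat 9 (I.nD + I.nD + q) := fun q hq => by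
    rw [hn4 (by decide), r9, if_neg (by omega), hn2 (by decide), hn1 (by decide)]
  have hold3 : ∀ q < n, (freezeBall.den s₃).real 3 (I.nD + I.nD + q) =
      s.real 3 (I.nD + I.nD + q) := fun q hq => by
    rw [hr4 (by decide), r3, if_neg (by omega), hr2 (by decide), hr1 (by decide)]
  have hnew8 : (freezeBall.den s₃).nat 8 (I.nD + I.nD + n) = s₂.nat 41 0 := by
    rw [hn4 (by decide), r8, if_pos rfl]
  have hnew9 : (freezeBall.den s₃).nat 9 (I.nD + I.nD + n) =
      if 1 ≤ s₂.nat 41 0 ∧ I.m + 1 ≤ s₂.nat 40 0 then 1 else 0 := by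
    rw [hn4 (by decide), r9, if_pos rfl]
  rcases hbest with ⟨hb0, hbQ⟩ | ⟨hb1, v, hv, hv1, hv2, hv3, hv4⟩
  · have hden : freezeBall.den s₃ = s₃ := by
      rw [freezeBall, LProg.den_ite_neg (by
        simp only [Test.holds, NExp.eval]
        rw [hn3 (by decide), hb0]; simp), LProg.den_skip]
    refine ⟨A, b, t, α, Z, θ, hrun.succ_of_forall fun w hw => ?_, by rw [hden]; exact hin3, fun q hq => ?_,
      fun q hq => ?_⟩
    · intro p hp
      by_contra hpZ
      exact hbQ w trivial ⟨hw, card_pos.2 ⟨p, mem_filter.2 ⟨hp, hpZ⟩⟩⟩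
    · rcases Nat.lt_succ_iff_lt_or_eq.1 hq with hq | rfl
      · rw [hold8 q hq, hold6 q hq, hold7 q hq, hold3 q hq]
        exact hslots q hq
      · exact ⟨by rw [hnew8, hb0, if_neg hnA], fun h => absurd h hnA⟩
    · rcases Nat.lt_succ_iff_lt_or_eq.1 hq with hq | rfl
      · rw [hold9 q hq]
        exact hearly q hq
      · rw [hnew9, hb0, if_neg (by simp), if_neg (fun h => hnA h.1)]
  · have hfz := freezeBall_spec hin3 v (τ := tightTime lam Z α v) (by rw [hn3 (by decide), hb1])
      (by rw [hn3 (by decide), hv1]) (by rw [hn3 (by decide), hv2]) (by rw [hr3 (by decide), hv3])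
    have hb' : ∀ q, q ≠ n → Function.update b n v q = b q := fun q hq =>
      Function.update_of_ne hq _ _
    have ht' : ∀ q, q ≠ n → Function.update t n (tightTime lam Z α v) q = t q := fun q hq =>
      Function.update_of_ne hq _ _
    refine ⟨_, _, _, _, _, _, hrun.succ (τ := tightTime lam Z α v) hv.1 hv.2 rfl (fun w hw hw' => hv4 w trivial ⟨hw, hw'⟩),
      hfz, fun q hq => ?_, fun q hq => ?_⟩
    · rcases Nat.lt_succ_iff_lt_or_eq.1 hq with hq | rfl
      · rw [hold8 q hq, hold6 q hq, hold7 q hq, hold3 q hq, hb' q hq.ne, ht' q hq.ne]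
        simp only [mem_insert, hq.ne, false_or]
        exact hslots q hq
      · refine ⟨by rw [hnew8, hb1, if_pos (mem_insert_self _ _)], fun _ => ?_⟩
        rw [Function.update_self, Function.update_self, hn4 (by decide), hn4 (by decide),
          hr4 (by decide), r6, r7, r3]
        simp [hv1, hv2, hv3]
    · have hfilter : ∀ q ≤ n, ((insert n A).filter (· < q)) = A.filter (· < q) := fun q hq => by
        rw [filter_insert, if_neg hq.not_gt]
      have hunc : ∀ q ≤ n, unc (sets (Function.update b n v)) (A.filter (· < q)) =
          unc (sets b) (A.filter (· < q)) := fun q hq => by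
        unfold unc
        rw [biUnion_congr rfl fun x hx => ?_]
        simp only [sets]
        rw [hb' x ((mem_filter.1 hx).2.trans_le hq).ne]
      rw [hfilter q (by omega), hunc q (by omega)]
      rcases Nat.lt_succ_iff_lt_or_eq.1 hq with hq | rfl
      · rw [hold9 q hq]
        simp only [mem_insert, hq.ne, false_or]
        exact hearly q hq
      · rw [hnew9, hb1, h40, filter_true_of_mem fun x hx => hrun.lt x hx]
        simp

/-- After a run of the primal-dual method its items and early items are in the scratch cells. -/
theorem primalDual_spec {s : State} (h : HasInput I s) (hR : s.real 10 0 = R)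
    (hlam : s.real 13 0 = lam) (hlam0 : 0 ≤ lam) (v₀ : I.Ball) :
    ∃ (A : Finset ℕ) (b : ℕ → I.Ball) (t : ℕ → ℝ) (α : Fin I.nD → ℝ),
      IsRun R lam A b t α ∧ (∀ q ∈ A, q < I.nD) ∧
      Slots (primalDual.den s) (I.nD + I.nD) I.nD A b t ∧
      EarlyMarks (primalDual.den s) (I.nD + I.nD) I.nD A b := by
  simp only [primalDual, LProg.den_block_cons, LProg.den_block_singleton]
  have hclear : ∀ p : Fin I.nD, (clearFrozen.den s).nat 5 p = 0 := by
    have := LProg.loop_spec (v := 21) (e := eD) (p := .setNat 5 (nv 21) (.lit 0)) (s := s) I.nD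
      (fun i t => ∀ p : Fin I.nD, p.1 < i → t.nat 5 p = 0) (by simp [h.nD]) (by simp) (by
        intro i t hi hv hn hr hJ p hp
        rcases Nat.lt_succ_iff_lt_or_eq.1 hp with hp | hp
        · simp [hv, hJ p hp]
        · simp [hv, hp])
    exact fun p => this p p.2
  set s₁ := clearFrozen.den s with hs₁
  have hin : PDInput R lam (∅ : Finset (Fin I.nD)) (fun _ => 0) s₁ := by
    refine ⟨h.den clearFrozen (by decide) (by decide) (by decide) (by decide), fun p => by
      simpa using hclear p, by simp, ?_, ?_⟩
    · rw [hs₁, LProg.den_real _ _ (by decide), hR]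
    · rw [hs₁, LProg.den_real _ _ (by decide), hlam]
  obtain ⟨A, b, t, α, Z, θ, h1, h2, h3, h4⟩ :=
    LProg.loop_spec (v := 22) (e := eD) (p := pdStep) (s := s₁) I.nD
    (fun n t => AtStep R lam n I t) (by simp [hin.input.nD])
    ⟨∅, fun _ => v₀, fun _ => 0, fun _ => 0, ∅, 0, PartialRun.zero hlam0 _ _ _,
      hin.congr (State.setNat_nat_ne _ (by decide)) (State.setNat_nat_ne _ (by decide))
        (State.setNat_nat_ne _ (by decide)) rfl (State.setNat_nat_ne _ (by decide)) rfl rfl rfl,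
      fun q hq => absurd hq (Nat.not_lt_zero q), fun q hq => absurd hq (Nat.not_lt_zero q)⟩
    (by
      intro i t hi hv hn hr hJ
      obtain ⟨A, b, t', α, Z, θ, h1, h2, h3, h4⟩ := pdStep_spec hJ hv
      exact ⟨A, b, t', α, Z, θ, h1,
        h2.congr (State.setNat_nat_ne _ (by decide)) (State.setNat_nat_ne _ (by decide))
        (State.setNat_nat_ne _ (by decide)) rfl (State.setNat_nat_ne _ (by decide)) rfl rfl rfl,
        fun q hq => by simpa using h3 q hq, fun q hq => by simpa using h4 q hq⟩)
  exact ⟨A, b, t, α, h1.isRun, h1.lt, h3, h4⟩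

end Program
end LBkSRO

/-! ### Correctness of the clustering program -/

namespace LBkSRO

open Finset RAM SetFamily

namespace Program

variable {I : LBkSRO}

/-- The number by which a label is represented. -/
def code : Option (Fin I.nF) → ℕ
  | none => 0
  | some i => (i : ℕ) + 1

@[simp] theorem code_none : code (none : Option (Fin I.nF)) = 0 := rfl
@[simp] theorem code_some (i : Fin I.nF) : code (some i) = (i : ℕ) + 1 := rfl

theorem code_inj {a b : Option (Fin I.nF)} : code a = code b ↔ a = b := by
  cases a <;> cases b <;> simp [Fin.ext_iff]

theorem one_le_code {a : Option (Fin I.nF)} : 1 ≤ code a ↔ a ≠ none := by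
  cases a <;> simp

/-- Array `11` holds the labels `σ`. -/
def Sig (s : State) (σ : Fin I.nD → Option (Fin I.nF)) : Prop :=
  ∀ p : Fin I.nD, s.nat 11 p = code (σ p)

theorem Sig.congr {s t : State} {σ : Fin I.nD → Option (Fin I.nF)} (h : Sig s σ)
    (h11 : t.nat 11 = s.nat 11) : Sig t σ := fun p => by rw [h11]; exact h p

theorem relabel_spec {s : State} (h : HasInput I s) {σ : Fin I.nD → Option (Fin I.nF)}
    (hσ : Sig s σ) {l : Option (Fin I.nF)} (i₀ : Fin I.nF) (h1 : s.nat 46 0 = i₀)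
    (h2 : s.nat 48 0 = code l) :
    Sig (relabel.den s) fun p => if σ p = l then some i₀ else σ p := by
  have := LProg.loop_spec (v := 31) (e := eD) (p := relabelBody) (s := s) I.nD
    (fun i t => Sig t fun p => if p.1 < i ∧ σ p = l then some i₀ else σ p)
    (by simp [h.nD]) (by simpa using hσ.congr (State.setNat_nat_ne _ (by decide))) (by
      intro i t hi hv hn hr hJ
      have h46 : t.nat 46 0 = i₀ := by rw [hn 46 (by decide), h1]
      have h48 : t.nat 48 0 = code l := by rw [hn 48 (by decide), h2]
      have h11 : t.nat 11 i = code (σ ⟨i, hi⟩) := by simpa using hJ ⟨i, hi⟩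
      have hc : Test.holds t (.and (.natLe (.get 11 (nv 31)) (nv 48))
          (.natLe (nv 48) (.get 11 (nv 31)))) ↔ σ ⟨i, hi⟩ = l := by
        simp only [Test.holds, NExp.eval, hv, h48, h11]
        rw [← le_antisymm_iff, code_inj]
      rw [relabelBody]
      intro p
      by_cases hl : σ ⟨i, hi⟩ = l
      · rw [LProg.den_ite_pos (hc.2 hl)]
        by_cases hp : p = ⟨i, hi⟩
        · subst hp
          simp [hv, hl, h46]
        · have hp' : p.1 ≠ i := fun h => hp (Fin.ext h)
          have := hJ p
          simp only [lt_succ_iff_fin hi, hp, or_false]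
          rw [← this]
          simp [hv, hp']
      · rw [LProg.den_ite_neg fun h => hl (hc.1 h), LProg.den_skip]
        refine (hJ p).trans (congrArg code ?_)
        refine if_congr ?_ rfl rfl
        rw [lt_succ_iff_fin hi]
        constructor
        · exact fun h => ⟨.inl h.1, h.2⟩
        · rintro ⟨h' | rfl, h⟩
          exacts [⟨h', h⟩, absurd h hl])
  intro p
  refine (this p).trans (congrArg code ?_)
  simp

open Classical in
-- The labels change while the loop reads them, but the invariant speaks of the original `σ`: a
-- cluster merged before carries the label `some v.1`, and relabelling that label does nothing.
theorem mergeClusters_spec {s : State} (h : HasInput I s) {σ : Fin I.nD → Option (Fin I.nF)}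
    (hσ : Sig s σ) (v : I.Ball) (h1 : s.nat 46 0 = v.1) (h2 : s.nat 47 0 = v.2) :
    Sig (mergeClusters.den s) fun p =>
      if σ p ≠ none ∧ ∃ p' ∈ I.pts v, σ p' = σ p then some v.1 else σ p := by
  have := LProg.loop_spec (v := 30) (e := eD) (p := mergeBody) (s := s) I.nD
    (fun i t => Sig t fun p =>
      if σ p ≠ none ∧ ∃ p' ∈ I.pts v, p'.1 < i ∧ σ p' = σ p then some v.1 else σ p)
    (by simp [h.nD]) (by simpa using hσ.congr (State.setNat_nat_ne _ (by decide))) (by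
      intro i t hi hv hn hr hJ
      have hIt : HasInput I t := h.congr (hn 0 (by decide)) (hn 1 (by decide))
        (hn 4 (by decide)) (hr 1 (by decide))
      have h46 : t.nat 46 0 = v.1 := by rw [hn 46 (by decide), h1]
      have h47 : t.nat 47 0 = v.2 := by rw [hn 47 (by decide), h2]
      have hd1 := dist_eval hIt (i := nv 46) (p := nv 30) v.1 ⟨i, hi⟩ h46 hv
      have hd2 := dist_eval hIt (i := nv 46) (p := nv 47) v.1 v.2 h46 h47
      set τ : Fin I.nD → Option (Fin I.nF) := fun p =>
        if σ p ≠ none ∧ ∃ p' ∈ I.pts v, p'.1 < i ∧ σ p' = σ p then some v.1 else σ p with hτ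
      have hτ0 : ∀ p, τ p ≠ none ↔ σ p ≠ none := by
        intro p
        simp only [hτ]
        split_ifs with hc
        · simp [hc.1]
        · rfl
      have hc : Test.holds t (.and (.realLe (dist (nv 46) (nv 30)) (dist (nv 46) (nv 47)))
          (.natLe (.lit 1) (.get 11 (nv 30)))) ↔
          (⟨i, hi⟩ : Fin I.nD) ∈ I.pts v ∧ σ ⟨i, hi⟩ ≠ none := by
        simp only [Test.holds, hd1, hd2, mem_pts, ← hτ0]
        rw [← one_le_code, ← hJ ⟨i, hi⟩]
        simp only [NExp.eval, hv]
        rfl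
      have hstep : ∀ p, (σ p ≠ none ∧ ∃ p' ∈ I.pts v, p'.1 < i + 1 ∧ σ p' = σ p) ↔
          (σ p ≠ none ∧ ∃ p' ∈ I.pts v, p'.1 < i ∧ σ p' = σ p) ∨
          (σ p ≠ none ∧ (⟨i, hi⟩ : Fin I.nD) ∈ I.pts v ∧ σ ⟨i, hi⟩ = σ p) := by
        intro p
        rw [← and_or_left]
        refine and_congr_right fun _ => ?_
        constructor
        · rintro ⟨p', h1, h2, h3⟩
          rcases (lt_succ_iff_fin hi).1 h2 with h2 | rfl
          exacts [.inl ⟨p', h1, h2, h3⟩, .inr ⟨h1, h3⟩]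
        · rintro (⟨p', h1, h2, h3⟩ | ⟨h1, h3⟩)
          exacts [⟨p', h1, by omega, h3⟩, ⟨_, h1, Nat.lt_succ_self i, h3⟩]
      rw [mergeBody]
      by_cases hcc : (⟨i, hi⟩ : Fin I.nD) ∈ I.pts v ∧ σ ⟨i, hi⟩ ≠ none
      · rw [LProg.den_ite_pos (hc.2 hcc), LProg.den_block_cons, LProg.den_block_singleton]
        have := relabel_spec (s := (nset 48 (.get 11 (nv 30))).den t) (σ := τ) (l := τ ⟨i, hi⟩)
          (hIt.congr (State.setNat_nat_ne _ (by decide)) (State.setNat_nat_ne _ (by decide))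
            (State.setNat_nat_ne _ (by decide)) rfl) (hJ.congr (State.setNat_nat_ne _ (by decide)))
          v.1 (by simpa using h46) (by simpa [hv] using hJ ⟨i, hi⟩)
        intro p
        refine (this p).trans (congrArg code ?_)
        simp only [hstep]
        by_cases hA : σ p ≠ none ∧ ∃ p' ∈ I.pts v, p'.1 < i ∧ σ p' = σ p
        · have : τ p = some v.1 := if_pos hA
          rw [this, if_pos (Or.inl hA)]
          simp
        · have hp : τ p = σ p := if_neg hA
          rw [hp]
          by_cases hB : σ ⟨i, hi⟩ = σ p
          · have hi' : τ ⟨i, hi⟩ = σ ⟨i, hi⟩ := if_neg fun h => hA (by rwa [hB] at h)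
            rw [hi', if_pos hB.symm, if_pos (Or.inr ⟨hB ▸ hcc.2, hcc.1, hB⟩)]
          · rw [if_neg (not_or.2 ⟨hA, fun h => hB h.2.2⟩)]
            split_ifs with hE
            · by_cases hC : σ ⟨i, hi⟩ ≠ none ∧ ∃ p' ∈ I.pts v, p'.1 < i ∧ σ p' = σ ⟨i, hi⟩
              · have : τ ⟨i, hi⟩ = some v.1 := if_pos hC
                rw [hE, this]
              · have : τ ⟨i, hi⟩ = σ ⟨i, hi⟩ := if_neg hC
                exact absurd (hE.trans this).symm hB
            · rfl
      · rw [LProg.den_ite_neg fun h => hcc (hc.1 h), LProg.den_skip]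
        intro p
        refine (hJ p).trans (congrArg code ?_)
        refine if_congr ?_ rfl rfl
        rw [hstep, or_iff_left]
        rintro ⟨h1, h2, h3⟩
        exact hcc ⟨h2, h3 ▸ h1⟩)
  intro p
  refine (this p).trans (congrArg code ?_)
  simp

open Classical in
theorem coverBall_spec {s : State} (h : HasInput I s) {σ : Fin I.nD → Option (Fin I.nF)}
    (hσ : Sig s σ) (v : I.Ball) (h1 : s.nat 46 0 = v.1) (h2 : s.nat 47 0 = v.2) :
    Sig (coverBall.den s) fun p => if p ∈ I.pts v then some v.1 else σ p := by
  have := LProg.loop_spec (v := 32) (e := eD) (p := coverBody) (s := s) I.nD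
    (fun i t => Sig t fun p => if p.1 < i ∧ p ∈ I.pts v then some v.1 else σ p)
    (by simp [h.nD]) (by simpa using hσ.congr (State.setNat_nat_ne _ (by decide))) (by
      intro i t hi hv hn hr hJ
      have hIt : HasInput I t := h.congr (hn 0 (by decide)) (hn 1 (by decide))
        (hn 4 (by decide)) (hr 1 (by decide))
      have h46 : t.nat 46 0 = v.1 := by rw [hn 46 (by decide), h1]
      have h47 : t.nat 47 0 = v.2 := by rw [hn 47 (by decide), h2]
      have hd1 := dist_eval hIt (i := nv 46) (p := nv 32) v.1 ⟨i, hi⟩ h46 hv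
      have hd2 := dist_eval hIt (i := nv 46) (p := nv 47) v.1 v.2 h46 h47
      have hc : Test.holds t (.realLe (dist (nv 46) (nv 32)) (dist (nv 46) (nv 47))) ↔
          (⟨i, hi⟩ : Fin I.nD) ∈ I.pts v := by
        rw [Test.holds, hd1, hd2, mem_pts]; rfl
      rw [coverBody]
      intro p
      by_cases hl : (⟨i, hi⟩ : Fin I.nD) ∈ I.pts v
      · rw [LProg.den_ite_pos (hc.2 hl)]
        by_cases hp : p = ⟨i, hi⟩
        · subst hp
          simp [hv, hl, h46]
        · have hp' : p.1 ≠ i := fun h => hp (Fin.ext h)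
          have := hJ p
          simp only [lt_succ_iff_fin hi, hp, or_false]
          rw [← this]
          simp [hv, hp']
      · rw [LProg.den_ite_neg fun h => hl (hc.1 h), LProg.den_skip]
        refine (hJ p).trans (congrArg code ?_)
        refine if_congr ?_ rfl rfl
        rw [lt_succ_iff_fin hi]
        constructor
        · exact fun h => ⟨.inl h.1, h.2⟩
        · rintro ⟨h' | rfl, h⟩
          exacts [⟨h', h⟩, absurd h hl])
  intro p
  refine (this p).trans (congrArg code ?_)
  simp

theorem mergeItem_spec {s : State} (h : HasInput I s) {σ : Fin I.nD → Option (Fin I.nF)}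
    (hσ : Sig s σ) (v : I.Ball) (h1 : s.nat 6 (s.nat 29 0) = v.1)
    (h2 : s.nat 7 (s.nat 29 0) = v.2) : Sig (mergeItem.den s) (merge v σ) := by
  classical
  simp only [mergeItem, LProg.den_block_cons, LProg.den_block_singleton]
  set t := (nset 47 (.get 7 (nv 29))).den ((nset 46 (.get 6 (nv 29))).den s) with ht
  have hIt : HasInput I t := h.congr rfl rfl rfl rfl
  have h46 : t.nat 46 0 = v.1 := by simpa [ht] using h1
  have h47 : t.nat 47 0 = v.2 := by simpa [ht] using h2
  have hm := mergeClusters_spec hIt (hσ.congr (t := t) rfl) v h46 h47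
  have := coverBall_spec (hIt.den mergeClusters (by decide) (by decide) (by decide) (by decide))
    hm v (by rw [LProg.den_nat _ _ (by decide), h46]) (by rw [LProg.den_nat _ _ (by decide), h47])
  intro p
  refine (this p).trans (congrArg code ?_)
  simp only [merge]
  by_cases hA : p ∈ I.pts v
  · rw [if_pos hA, if_pos (Or.inl hA)]
  · rw [if_neg hA]
    exact if_congr (or_iff_right hA).symm rfl rfl

theorem buildClusters_spec {s : State} (h : HasInput I s) {F : Finset ℕ} {b : ℕ → I.Ball}
    (hF : ∀ q < I.nD + I.nD + I.nD, 1 ≤ s.nat 10 q ↔ q ∈ F)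
    (hlt : ∀ q ∈ F, q < I.nD + I.nD + I.nD)
    (hb : ∀ q ∈ F, s.nat 6 q = (b q).1 ∧ s.nat 7 q = (b q).2) :
    ∃ σ, Sig (buildClusters.den s) σ ∧ IsClustering b F σ := by
  simp only [buildClusters, LProg.den_block_cons, LProg.den_block_singleton]
  have hclear : Sig (clearLabels.den s) fun _ => (none : Option (Fin I.nF)) := by
    have := LProg.loop_spec (v := 28) (e := eD) (p := .setNat 11 (nv 28) (.lit 0)) (s := s) I.nD
      (fun i t => ∀ p : Fin I.nD, p.1 < i → t.nat 11 p = 0) (by simp [h.nD]) (by simp) (by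
        intro i t hi hv hn hr hJ p hp
        rcases Nat.lt_succ_iff_lt_or_eq.1 hp with hp | hp
        · simp [hv, hJ p hp]
        · simp [hv, hp])
    exact fun p => this p p.2
  set s₁ := clearLabels.den s with hs₁
  have hn1 : ∀ {a}, a ∉ clearLabels.natWrites → s₁.nat a = s.nat a := fun ha =>
    LProg.den_nat _ _ ha
  have hI1 : HasInput I s₁ := h.den clearLabels (by decide) (by decide) (by decide) (by decide)
  have := LProg.loop_spec (v := 29) (e := .add (.add eD eD) eD) (p := buildBody) (s := s₁)
    (I.nD + I.nD + I.nD)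
    (fun i t => ∃ σ, Sig t σ ∧ IsClustering b (F.filter (· < i)) σ)
    (by simp [hI1.nD]) ⟨_, hclear.congr (State.setNat_nat_ne _ (by decide)), by
      simpa using isClustering_empty b⟩ (by
      rintro i t hi hv hn hr ⟨σ, h1, h2⟩
      have hIt : HasInput I t := hI1.congr (hn 0 (by decide)) (hn 1 (by decide))
        (hn 4 (by decide)) (hr 1 (by decide))
      have h10 : t.nat 10 = s.nat 10 := by rw [hn 10 (by decide), hn1 (by decide)]
      have h6 : t.nat 6 = s.nat 6 := by rw [hn 6 (by decide), hn1 (by decide)]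
      have h7 : t.nat 7 = s.nat 7 := by rw [hn 7 (by decide), hn1 (by decide)]
      have hfil : F.filter (· < i + 1) = if i ∈ F then insert i (F.filter (· < i)) else
          F.filter (· < i) := by
        split_ifs with hc <;> ext q <;> simp only [mem_filter, mem_insert] <;>
          rw [Nat.lt_succ_iff_lt_or_eq]
        · constructor
          · rintro ⟨a, a' | a'⟩
            exacts [.inr ⟨a, a'⟩, .inl a']
          · rintro (rfl | a)
            exacts [⟨hc, .inr rfl⟩, ⟨a.1, .inl a.2⟩]
        · constructor
          · rintro ⟨a, a' | rfl⟩
            exacts [⟨a, a'⟩, absurd a hc]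
          · exact fun a => ⟨a.1, .inl a.2⟩
      have hc : Test.holds t (.natLe (.lit 1) (.get 10 (nv 29))) ↔ i ∈ F := by
        simp only [Test.holds, NExp.eval, hv, h10]
        exact hF i hi
      rw [buildBody, hfil]
      by_cases hq : i ∈ F
      · rw [LProg.den_ite_pos (hc.2 hq), if_pos hq]
        exact ⟨_, mergeItem_spec hIt h1 (b i) (by rw [hv, h6, (hb i hq).1])
          (by rw [hv, h7, (hb i hq).2]), h2.merge i⟩
      · rw [LProg.den_ite_neg fun h => hq (hc.1 h), if_neg hq]
        exact ⟨σ, h1, h2⟩)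
  rwa [filter_true_of_mem hlt] at this

/-! ### Outliers, open facilities and cost of a clustering. -/

theorem countOutliers_spec {s : State} (h : HasInput I s) {σ : Fin I.nD → Option (Fin I.nF)}
    (hσ : Sig s σ) :
    (countOutliers.den s).nat 49 0 = (univ.filter fun p => σ p = none).card := by
  rw [countOutliers, LProg.den_block_cons, LProg.den_block_singleton]
  set f : Fin I.nD → ℕ := fun p => if σ p = none then 1 else 0 with hf
  refine (LProg.loop_spec I.nD (fun i t => t.nat 49 0 = psum f i) (by simp [h.nD])
    (by simp [psum_zero]) fun i t hi hv hn hr hJ => ?_).trans ?_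
  · have hf' : t.nat 11 i = code (σ ⟨i, hi⟩) := by
      rw [hn 11 (by decide)]; exact hσ ⟨i, hi⟩
    have hc : Test.holds t (.natLe (.get 11 (nv 33)) (.lit 0)) ↔ σ ⟨i, hi⟩ = none := by
      simp only [Test.holds, NExp.eval, hv, hf']
      rw [← not_iff_not, ← ne_eq (σ _), ← one_le_code]
      omega
    rw [psum_succ f hi, outlierBody]
    by_cases hp : σ ⟨i, hi⟩ = none
    · rw [LProg.den_ite_pos (hc.2 hp)]
      simp [hJ, hf, hp]
    · rw [LProg.den_ite_neg fun h => hp (hc.1 h)]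
      simp [hJ, hf, hp]
  · rw [psum_self, hf, card_filter]

theorem radius_eq_of_isGreatest {x : I.Solution} {i : Fin I.nF} {r : ℝ}
    (h : ∀ p, x.σ p = some i → I.d i p ≤ r) (h' : r = 0 ∨ ∃ p, x.σ p = some i ∧ r = I.d i p)
    (h0 : 0 ≤ r) : I.radius x i = r := by
  refine le_antisymm (Real.iSup_le (fun p => h p.1 p.2) h0) ?_
  rcases h' with rfl | ⟨p, hp, rfl⟩
  exacts [radius_nonneg x i, d_le_radius x hp]

theorem scanCluster_spec {s : State} (h : HasInput I s) {σ : Fin I.nD → Option (Fin I.nF)}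
    (hσ : Sig s σ) (i₀ : Fin I.nF) (h34 : s.nat 34 0 = i₀) :
    (scanCluster.den s).nat 51 0 = (if i₀ ∈ labels σ then 1 else 0) ∧
      (scanCluster.den s).real 17 0 = I.radius (solutionOf σ) i₀ := by
  simp only [scanCluster, LProg.den_block_cons, LProg.den_block_singleton]
  set s' := (rset 17 (.ofNat (.lit 0))).den ((nset 51 (.lit 0)).den s) with hs'
  have hI' : HasInput I s' := h.congr rfl rfl rfl (State.setReal_real_ne _ (by decide))
  have hσ' : Sig s' σ := hσ.congr rfl
  obtain ⟨k1, k2, k3, k4⟩ := LProg.loop_spec (v := 35) (e := eD) (p := clusterBody) (s := s') I.nD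
    (fun j t => t.nat 51 0 = (if ∃ p : Fin I.nD, p.1 < j ∧ σ p = some i₀ then 1 else 0) ∧
      0 ≤ t.real 17 0 ∧ (∀ p : Fin I.nD, p.1 < j → σ p = some i₀ → I.d i₀ p ≤ t.real 17 0) ∧
      (t.real 17 0 = 0 ∨ ∃ p, σ p = some i₀ ∧ t.real 17 0 = I.d i₀ p))
    (by simp [hI'.nD]) (by simp [hs']) (by
      rintro j t hj hv hn hr ⟨j1, j2, j3, j4⟩
      have hIt : HasInput I t := hI'.congr (hn 0 (by decide)) (hn 1 (by decide))
        (hn 4 (by decide)) (hr 1 (by decide))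
      have h34' : t.nat 34 0 = i₀ := by rw [hn 34 (by decide)]; simpa [hs'] using h34
      have h11 : t.nat 11 j = code (σ ⟨j, hj⟩) := by rw [hn 11 (by decide)]; exact hσ' ⟨j, hj⟩
      have hc : Test.holds t (.and (.natLe (.get 11 (nv 35)) (.add (nv 34) (.lit 1)))
          (.natLe (.add (nv 34) (.lit 1)) (.get 11 (nv 35)))) ↔ σ ⟨j, hj⟩ = some i₀ := by
        simp only [Test.holds, NExp.eval, hv, h11, h34']
        rw [← le_antisymm_iff, ← code_some, code_inj]
      rw [clusterBody]
      by_cases hp : σ ⟨j, hj⟩ = some i₀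
      · rw [LProg.den_ite_pos (hc.2 hp), LProg.den_block_cons, LProg.den_block_singleton]
        set t' := (nset 51 (.lit 1)).den t with ht'
        have hIt' : HasInput I t' := hIt.congr rfl rfl rfl rfl
        have hd := dist_eval hIt' (i := nv 34) (p := nv 35) i₀ ⟨j, hj⟩ (by simpa [ht'] using h34')
          (by simpa [ht'] using hv)
        have hc' : Test.holds t' (.realLe (dist (nv 34) (nv 35)) (rv 17)) ↔
            I.d i₀ ⟨j, hj⟩ ≤ t.real 17 0 := by
          rw [Test.holds, hd]; simp [ht']
        have hex : ∃ p : Fin I.nD, p.1 < j + 1 ∧ σ p = some i₀ := ⟨_, Nat.lt_succ_self j, hp⟩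
        rw [if_pos hex]
        by_cases hle : I.d i₀ ⟨j, hj⟩ ≤ t.real 17 0
        · rw [LProg.den_ite_pos (hc'.2 hle), LProg.den_skip]
          refine ⟨by simp [ht'], j2, fun p hp1 hp2 => ?_, j4⟩
          rcases (lt_succ_iff_fin hj).1 hp1 with hp1 | rfl
          exacts [j3 p hp1 hp2, hle]
        · rw [LProg.den_ite_neg fun h => hle (hc'.1 h)]
          have hval : ((rset 17 (dist (nv 34) (nv 35))).den t').real 17 0 = I.d i₀ ⟨j, hj⟩ := by
            rw [LProg.den_setReal, hd]; simp
          simp only [State.setNat_real, hval]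
          refine ⟨by simp [ht'], I.d_nonneg _ _, fun p hp1 hp2 => ?_, .inr ⟨_, hp, rfl⟩⟩
          rcases (lt_succ_iff_fin hj).1 hp1 with hp1 | rfl
          exacts [(j3 p hp1 hp2).trans (not_le.1 hle).le, le_rfl]
      · rw [LProg.den_ite_neg fun h => hp (hc.1 h), LProg.den_skip]
        have hstep : ∀ p : Fin I.nD, p.1 < j + 1 ∧ σ p = some i₀ ↔ p.1 < j ∧ σ p = some i₀ := by
          intro p
          rw [lt_succ_iff_fin hj]
          constructor
          · rintro ⟨h' | rfl, h⟩
            exacts [⟨h', h⟩, absurd h hp]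
          · exact fun h => ⟨.inl h.1, h.2⟩
        refine ⟨by simp only [hstep]; exact j1, j2, fun p hp1 hp2 => ?_, j4⟩
        exact j3 p ((hstep p).1 ⟨hp1, hp2⟩).1 hp2)
  refine ⟨by rw [k1]; simp [mem_labels], ?_⟩
  exact (radius_eq_of_isGreatest (x := solutionOf σ) (fun p hp => k3 p p.2 hp) k4 k2).symm

theorem evalClusters_spec {s : State} (h : HasInput I s) {σ : Fin I.nD → Option (Fin I.nF)}
    (hσ : Sig s σ) :
    (evalClusters.den s).nat 49 0 = (univ.filter fun p => σ p = none).card ∧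
      (evalClusters.den s).nat 50 0 = (labels σ).card ∧
      (evalClusters.den s).real 16 0 = I.cost (solutionOf σ) ∧
      ∀ i : Fin I.nF, (evalClusters.den s).nat 12 i = if i ∈ labels σ then 1 else 0 := by
  have h49 : (evalClusters.den s).nat 49 0 = (countOutliers.den s).nat 49 0 := by
    simp only [evalClusters, LProg.den_block_cons, LProg.den_block_singleton]
    rw [LProg.den_nat _ _ (by decide)]
    simp
  rw [h49, countOutliers_spec h hσ]
  refine ⟨rfl, ?_⟩
  simp only [evalClusters, LProg.den_block_cons, LProg.den_block_singleton]
  set s' := (rset 16 (.ofNat (.lit 0))).den ((nset 50 (.lit 0)).den (countOutliers.den s)) with hs'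
  have hI1 := h.den countOutliers (by decide) (by decide) (by decide) (by decide)
  have hI' : HasInput I s' := hI1.congr rfl rfl rfl (State.setReal_real_ne _ (by decide))
  have hσ' : Sig s' σ := (hσ.congr (t := countOutliers.den s)
    (LProg.den_nat _ _ (by decide))).congr rfl
  set f : Fin I.nF → ℕ := fun i => if i ∈ labels σ then 1 else 0 with hf
  set g : Fin I.nF → ℝ := fun i => if i ∈ labels σ then I.radius (solutionOf σ) i else 0 with hg
  have hrad : ∀ i, I.radius (solutionOf σ) i = g i := by
    intro i
    simp only [hg]
    split_ifs with hi
    · rfl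
    · refine radius_eq_of_isGreatest (fun p hp => absurd (mem_labels.2 ⟨p, hp⟩) hi) (.inl rfl) le_rfl
  obtain ⟨k1, k2, k3⟩ := LProg.loop_spec (v := 34) (e := eF) (p := evalBody) (s := s') I.nF
    (fun i t => t.nat 50 0 = psum f i ∧ t.real 16 0 = psum g i ∧
      ∀ i' : Fin I.nF, i'.1 < i → t.nat 12 i' = f i')
    (by simp [hI'.nF]) (by simp [hs', psum_zero]) (by
      rintro i t hi hv hn hr ⟨j1, j2, j3⟩
      have hIt : HasInput I t := hI'.congr (hn 0 (by decide)) (hn 1 (by decide))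
        (hn 4 (by decide)) (hr 1 (by decide))
      obtain ⟨c1, c2⟩ := scanCluster_spec hIt (hσ'.congr (hn 11 (by decide))) ⟨i, hi⟩ hv
      simp only [evalBody, LProg.den_block_cons, LProg.den_block_singleton]
      have hv' : (scanCluster.den t).nat 34 0 = i := by rw [LProg.den_nat _ _ (by decide), hv]
      have h50 : (scanCluster.den t).nat 50 0 = psum f i := by
        rw [LProg.den_nat _ _ (by decide), j1]
      have h16 : (scanCluster.den t).real 16 0 = psum g i := by
        rw [LProg.den_real _ _ (by decide), j2]
      rw [hrad] at c2
      refine ⟨?_, ?_, fun i' hi' => ?_⟩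
      · rw [psum_succ f hi]
        simp [h50, c1, hf]
      · rw [psum_succ g hi]
        simp [h16, c2]
      · rcases (lt_succ_iff_fin hi).1 hi' with hi'' | rfl
        · have h12 : (scanCluster.den t).nat 12 i' = f i' := by
            rw [LProg.den_nat _ _ (by decide), j3 i' hi'']
          simp [hv', h12, hi''.ne]
        · simp [hv', c1, hf])
  refine ⟨k1.trans ?_, k2.trans ?_, fun i => k3 i i.2⟩ <;> rw [psum_self]
  · simp [hf]
  · rw [LBkSRO.cost]
    simp only [hg]
    rw [sum_ite_mem, univ_inter]
    rfl

end Program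
end LBkSRO

/-! ### Correctness of the bisection -/

namespace LBkSRO

open Finset RAM SetFamily

variable {I : LBkSRO}

theorem IsClustering.of_image {b : ℕ → I.Ball} {F : Finset ℕ} {f : ℕ → ℕ}
    {σ : Fin I.nD → Option (Fin I.nF)} (h : IsClustering b (F.image f) σ) :
    IsClustering (b ∘ f) F σ where
  covered p := by simpa using h.covered p
  const q hq := h.const (f q) (mem_image_of_mem f hq)
  conn g hg := h.conn g fun q hq => by
    obtain ⟨x, hx, rfl⟩ := mem_image.1 hq
    exact hg x hx
  center p i hp := by
    obtain ⟨q, hq, h1, h2⟩ := h.center p i hp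
    obtain ⟨x, hx, rfl⟩ := mem_image.1 hq
    exact ⟨x, hx, h1, h2⟩

/-- The items at which more than `m` clients are not covered by items of smaller index. -/
noncomputable def initials (b : ℕ → I.Ball) (A : Finset ℕ) : Finset ℕ :=
  A.filter fun q => I.m < unc (sets b) (A.filter (· < q))

/-- Within one run the times do not decrease with the index, so the order by key is the order by
index, in which the program marks early items. -/
theorem IsRun.early_eq {R lam : ℝ} {A : Finset ℕ} {b : ℕ → I.Ball} {t : ℕ → ℝ}
    {α : Fin I.nD → ℝ} (h : IsRun R lam A b t α) :
    early (sets b) (key t) I.m A = initials b A := by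
  refine filter_congr fun q hq => ?_
  have : pre (key t) A q = A.filter (· < q) := by
    refine filter_congr fun x hx => ?_
    rw [key_lt_key]
    constructor
    · rintro (hlt | hlt)
      · by_contra hc
        rcases (not_lt.1 hc).eq_or_lt with rfl | hc
        · exact lt_irrefl _ hlt
        · exact hlt.not_ge (h.time_mono q hq x hx hc)
      · exact hlt.2
    · intro hlt
      rcases (h.time_mono x hx q hq hlt).lt_or_eq with h' | h'
      exacts [.inl h', .inr ⟨h', hlt⟩]
  rw [this]

section Image

variable {b b' : ℕ → I.Ball} {A : Finset ℕ} {f : ℕ → ℕ}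

theorem biUnion_sets_image (hb : ∀ q ∈ A, b' (f q) = b q) :
    (A.image f).biUnion (sets b') = A.biUnion (sets b) := by
  rw [image_biUnion]
  exact biUnion_congr rfl fun q hq => by simp only [sets, hb q hq]

theorem initials_image (hf : StrictMono f) (hb : ∀ q ∈ A, b' (f q) = b q) :
    initials b' (A.image f) = (initials b A).image f := by
  have key : ∀ q, (A.image f).filter (· < f q) = (A.filter (· < q)).image f := by
    intro q
    rw [filter_image]
    simp only [hf.lt_iff_lt]
  rw [initials, filter_image, initials]
  congr 1
  refine filter_congr fun q hq => ?_
  rw [key, unc, biUnion_sets_image fun x hx => hb x (mem_filter.1 hx).1, unc]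

theorem compsGE_image (hb : ∀ q ∈ A, b' (f q) = b q) {n : ℕ} :
    CompsGE (sets b') (A.image f) n ↔ CompsGE (sets b) A n := by
  simp only [CompsGE, biUnion_sets_image hb, forall_mem_image]
  refine exists_congr fun g => and_congr_left fun _ => forall₂_congr fun q hq => ?_
  simp only [sets, hb q hq]

theorem compsGE_initials_image (hf : StrictMono f) (hb : ∀ q ∈ A, b' (f q) = b q) {n : ℕ} :
    CompsGE (sets b') (initials b' (A.image f)) n ↔ CompsGE (sets b) (initials b A) n := by
  rw [initials_image hf hb, compsGE_image (A := initials b A) fun q hq => hb q (mem_filter.1 hq).1]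

end Image

/-- Only facilities with a client contribute, and there are at most `I.nD` of these. -/
theorem cost_le_mul {y : I.Solution} {R : ℝ} (hR0 : 0 ≤ R)
    (hR : ∀ i ∈ y.S, I.radius y i ≤ R) : I.cost y ≤ I.nD * R := by
  classical
  set T := y.S.filter fun i => ∃ p, y.σ p = some i with hT
  have h1 : I.cost y = ∑ i ∈ T, I.radius y i := by
    rw [cost, hT, sum_filter_of_ne]
    intro i hi hne
    by_contra hc
    have : IsEmpty {j : Fin I.nD // y.σ j = some i} := ⟨fun p => hc ⟨p.1, p.2⟩⟩
    exact hne (Real.iSup_of_isEmpty _)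
  have h2 : T.card ≤ I.nD := by
    have : (T.image some) ⊆ univ.image y.σ := by
      intro a ha
      obtain ⟨i, hi, rfl⟩ := mem_image.1 ha
      obtain ⟨p, hp⟩ := (mem_filter.1 hi).2
      exact mem_image.2 ⟨p, mem_univ _, hp⟩
    calc T.card = (T.image some).card := (card_image_of_injective _ (Option.some_injective _)).symm
      _ ≤ (univ.image y.σ).card := card_le_card this
      _ ≤ (univ : Finset (Fin I.nD)).card := card_image_le
      _ = I.nD := by simp
  calc I.cost y ≤ T.card • R := by
        rw [h1]; exact sum_le_card_nsmul _ _ _ fun i hi => hR i (mem_filter.1 hi).1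
    _ = T.card * R := nsmul_eq_mul _ _
    _ ≤ I.nD * R := mul_le_mul_of_nonneg_right (by exact_mod_cast h2) hR0

/-! ### Stored runs and the bracket of opening costs. -/

namespace Program

variable {R lam : ℝ}

theorem Slots.congr {s t : State} {o N : ℕ} {A : Finset ℕ} {b : ℕ → I.Ball} {τ : ℕ → ℝ}
    (h : Slots s o N A b τ) (h6 : t.nat 6 = s.nat 6) (h7 : t.nat 7 = s.nat 7)
    (h8 : t.nat 8 = s.nat 8) (h3 : t.real 3 = s.real 3) : Slots t o N A b τ := by
  simpa only [Slots, h6, h7, h8, h3] using h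

theorem copyRun_spec {s : State} (h : HasInput I s) {o : ℕ} (h52 : s.nat 52 0 = o)
    (ho : o ≤ I.nD + I.nD) :
    (∀ j, (copyRun.den s).nat 6 j =
      s.nat 6 (if o ≤ j ∧ j < o + I.nD then I.nD + I.nD + (j - o) else j)) ∧
    (∀ j, (copyRun.den s).nat 7 j =
      s.nat 7 (if o ≤ j ∧ j < o + I.nD then I.nD + I.nD + (j - o) else j)) ∧
    (∀ j, (copyRun.den s).nat 8 j =
      s.nat 8 (if o ≤ j ∧ j < o + I.nD then I.nD + I.nD + (j - o) else j)) ∧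
    (∀ j, (copyRun.den s).real 3 j =
      s.real 3 (if o ≤ j ∧ j < o + I.nD then I.nD + I.nD + (j - o) else j)) := by
  refine LProg.loop_spec (v := 37) (e := eD) (p := copyBody) (s := s) I.nD
    (fun i t => (∀ j, t.nat 6 j =
      s.nat 6 (if o ≤ j ∧ j < o + i then I.nD + I.nD + (j - o) else j)) ∧
    (∀ j, t.nat 7 j = s.nat 7 (if o ≤ j ∧ j < o + i then I.nD + I.nD + (j - o) else j)) ∧
    (∀ j, t.nat 8 j = s.nat 8 (if o ≤ j ∧ j < o + i then I.nD + I.nD + (j - o) else j)) ∧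
    (∀ j, t.real 3 j = s.real 3 (if o ≤ j ∧ j < o + i then I.nD + I.nD + (j - o) else j)))
    (by simp [h.nD]) ?_ ?_
  · have : ∀ j, ¬ (o ≤ j ∧ j < o + 0) := fun j => by omega
    simp only [this, if_false]
    simp
  · rintro i t hi hv hn hr ⟨j6, j7, j8, j3⟩
    have hD : t.nat 0 1 = I.nD := by rw [hn 0 (by decide), h.nD]
    have ho' : t.nat 52 0 = o := by rw [hn 52 (by decide), h52]
    have hsrc : ∀ j, (if j = o + i then I.nD + I.nD + i else
        if o ≤ j ∧ j < o + i then I.nD + I.nD + (j - o) else j) =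
        if o ≤ j ∧ j < o + (i + 1) then I.nD + I.nD + (j - o) else j := by
      intro j
      split_ifs <;> omega
    -- As `o ≤ I.nD + I.nD`, the source cell has not been overwritten yet.
    have hfix : (if o ≤ I.nD + I.nD + i ∧ I.nD + I.nD + i < o + i then
        I.nD + I.nD + (I.nD + I.nD + i - o) else I.nD + I.nD + i) = I.nD + I.nD + i :=
      if_neg (by omega)
    have e6 : t.nat 6 (I.nD + I.nD + i) = s.nat 6 (I.nD + I.nD + i) := by rw [j6, hfix]
    have e7 : t.nat 7 (I.nD + I.nD + i) = s.nat 7 (I.nD + I.nD + i) := by rw [j7, hfix]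
    have e8 : t.nat 8 (I.nD + I.nD + i) = s.nat 8 (I.nD + I.nD + i) := by rw [j8, hfix]
    have e3 : t.real 3 (I.nD + I.nD + i) = s.real 3 (I.nD + I.nD + i) := by rw [j3, hfix]
    simp only [copyBody, LProg.den_block_cons, LProg.den_block_singleton]
    refine ⟨fun j => ?_, fun j => ?_, fun j => ?_, fun j => ?_⟩ <;> rw [← hsrc] <;>
      by_cases hj : j = o + i
    · simp [hv, hD, ho', hj, e6]
    · rw [if_neg hj, ← j6]; simp [hv, hD, ho', hj]
    · simp [hv, hD, ho', hj, e7]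
    · rw [if_neg hj, ← j7]; simp [hv, hD, ho', hj]
    · simp [hv, hD, ho', hj, e8]
    · rw [if_neg hj, ← j8]; simp [hv, hD, ho', hj]
    · simp [hv, hD, ho', hj, e3]
    · rw [if_neg hj, ← j3]; simp [hv, hD, ho', hj]

/-- A run of the primal-dual method is stored from cell `o` on. The property `Q` is satisfied by
the assertion that its initial items have more than `k` components. -/
def HasRun (I : LBkSRO) (R lam : ℝ) (o : ℕ) (Q : Prop → Prop) (s : State) : Prop :=
  ∃ (A : Finset ℕ) (b : ℕ → I.Ball) (t : ℕ → ℝ) (α : Fin I.nD → ℝ),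
    IsRun R lam A b t α ∧ (∀ q ∈ A, q < I.nD) ∧ Slots s o I.nD A b t ∧
    Q (CompsGE (sets b) (initials b A) (I.k + 1))

theorem HasRun.congr {o : ℕ} {Q : Prop → Prop} {s t : State} (h : HasRun I R lam o Q s)
    (h6 : t.nat 6 = s.nat 6) (h7 : t.nat 7 = s.nat 7) (h8 : t.nat 8 = s.nat 8)
    (h3 : t.real 3 = s.real 3) : HasRun I R lam o Q t := by
  obtain ⟨A, b, τ, α, h1, h2, h3', h4⟩ := h
  exact ⟨A, b, τ, α, h1, h2, h3'.congr h6 h7 h8 h3, h4⟩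

theorem HasRun.copy {o : ℕ} {Q : Prop → Prop} {s : State} (h : HasInput I s)
    (h52 : s.nat 52 0 = o) (ho : o ≤ I.nD + I.nD)
    (hr : HasRun I R lam (I.nD + I.nD) Q s) : HasRun I R lam o Q (copyRun.den s) := by
  obtain ⟨A, b, τ, α, h1, h2, h3, h4⟩ := hr
  obtain ⟨c6, c7, c8, c3⟩ := copyRun_spec h h52 ho
  refine ⟨A, b, τ, α, h1, h2, fun q hq => ?_, h4⟩
  rw [c6, c7, c8, c3, if_pos ⟨by omega, by omega⟩, Nat.add_sub_cancel_left]
  exact h3 q hq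

theorem HasRun.copy_of_disjoint {o o' : ℕ} {Q : Prop → Prop} {s : State} (h : HasInput I s)
    (h52 : s.nat 52 0 = o) (ho : o ≤ I.nD + I.nD) (hoo : o' + I.nD ≤ o ∨ o + I.nD ≤ o')
    (hr : HasRun I R lam o' Q s) : HasRun I R lam o' Q (copyRun.den s) := by
  obtain ⟨A, b, τ, α, h1, h2, h3, h4⟩ := hr
  obtain ⟨c6, c7, c8, c3⟩ := copyRun_spec h h52 ho
  refine ⟨A, b, τ, α, h1, h2, fun q hq => ?_, h4⟩
  rw [c6, c7, c8, c3, if_neg (by omega)]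
  exact h3 q hq

theorem selectEarly_spec {s : State} (h : HasInput I s) :
    ∀ q < I.nD + I.nD + I.nD,
      (1 ≤ (selectEarly.den s).nat 10 q ↔ I.nD + I.nD ≤ q ∧ 1 ≤ s.nat 9 q) := by
  refine LProg.loop_spec (v := 36) (e := .add (.add eD eD) eD) (p := earlyBody) (s := s)
    (I.nD + I.nD + I.nD)
    (fun i t => ∀ q < i, (1 ≤ t.nat 10 q ↔ I.nD + I.nD ≤ q ∧ 1 ≤ s.nat 9 q))
    (by simp [h.nD]) (by simp) ?_
  intro i t hi hv hn hr hJ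
  have hD : t.nat 0 1 = I.nD := by rw [hn 0 (by decide), h.nD]
  have h9 : t.nat 9 = s.nat 9 := hn 9 (by decide)
  have hc : Test.holds t (.and (.natLe (.add eD eD) (nv 36)) (.natLe (.lit 1) (.get 9 (nv 36)))) ↔
      I.nD + I.nD ≤ i ∧ 1 ≤ s.nat 9 i := by
    simp [hD, hv, h9]
  rw [earlyBody]
  intro q hq
  by_cases hcc : I.nD + I.nD ≤ i ∧ 1 ≤ s.nat 9 i
  · rw [LProg.den_ite_pos (hc.2 hcc)]
    rcases Nat.lt_succ_iff_lt_or_eq.1 hq with hq | rfl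
    · simpa [hv, hq.ne] using hJ q hq
    · simpa [hv] using hcc
  · rw [LProg.den_ite_neg fun h => hcc (hc.1 h)]
    rcases Nat.lt_succ_iff_lt_or_eq.1 hq with hq | rfl
    · simpa [hv, hq.ne] using hJ q hq
    · simpa [hv] using hcc

/-- Counts the components of the initial items of the run in the scratch cells. -/
theorem initials_count {s : State} (h : HasInput I s) {A : Finset ℕ} {b : ℕ → I.Ball}
    {t : ℕ → ℝ} (hA : ∀ q ∈ A, q < I.nD) (hs : Slots s (I.nD + I.nD) I.nD A b t)
    (he : EarlyMarks s (I.nD + I.nD) I.nD A b) :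
    (evalClusters.den (buildClusters.den (selectEarly.den s))).nat 50 0 ≤ I.k ↔
      ¬ CompsGE (sets b) (initials b A) (I.k + 1) := by
  set F := (initials b A).image (I.nD + I.nD + ·) with hF
  set b' : ℕ → I.Ball := fun q => b (q - (I.nD + I.nD)) with hb'
  have hini : ∀ {q}, q ∈ initials b A → q < I.nD ∧ q ∈ A := fun hq =>
    ⟨hA _ (mem_filter.1 hq).1, (mem_filter.1 hq).1⟩
  have hI1 := h.den selectEarly (by decide) (by decide) (by decide) (by decide)
  obtain ⟨σ, hσ, hcl⟩ := buildClusters_spec hI1 (F := F) (b := b') (fun q hq => by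
      rw [selectEarly_spec h q hq]
      constructor
      · rintro ⟨h1, h2⟩
        obtain ⟨x, rfl⟩ := Nat.exists_eq_add_of_le h1
        rw [he x (by omega)] at h2
        split_ifs at h2 with hc
        · exact mem_image.2 ⟨x, mem_filter.2 hc, rfl⟩
        · omega
      · intro hq
        obtain ⟨x, hx, rfl⟩ := mem_image.1 hq
        refine ⟨Nat.le_add_right _ _, ?_⟩
        rw [he x (hini hx).1, if_pos (mem_filter.1 hx)])
    (fun q hq => by
      obtain ⟨x, hx, rfl⟩ := mem_image.1 hq
      have := (hini hx).1
      omega)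
    (fun q hq => by
      obtain ⟨x, hx, rfl⟩ := mem_image.1 hq
      obtain ⟨h1, h2, -⟩ := (hs x (hini hx).1).2 (hini hx).2
      rw [LProg.den_nat _ _ (by decide), LProg.den_nat _ _ (by decide)]
      simp only [hb', Nat.add_sub_cancel_left]
      exact ⟨h1, h2⟩)
  have hbb : b' ∘ (I.nD + I.nD + ·) = b := by
    funext q
    simp [hb']
  have hcl' := hcl.of_image
  rw [hbb] at hcl'
  rw [(evalClusters_spec (hI1.den buildClusters (by decide) (by decide) (by decide) (by decide))
    hσ).2.1, hcl'.compsGE_iff]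
  omega

/-- The opening costs `11` and `12` with their runs. -/
structure Bracket (I : LBkSRO) (R : ℝ) (G : Prop) (δ : ℝ) (s : State) : Prop where
  input : HasInput I s
  bound : s.real 10 0 = R
  nonneg : 0 ≤ s.real 11 0
  diff : s.real 12 0 - s.real 11 0 = δ
  diff_nonneg : 0 ≤ δ
  lower : HasRun I R (s.real 11 0) 0 (fun c => c ∨ s.real 11 0 = 0) s
  upper : HasRun I R (s.real 12 0) I.nD (fun c => G → ¬ c) s

theorem Bracket.congr {G : Prop} {δ : ℝ} {s t : State} (h : Bracket I R G δ s)
    (hin : HasInput I t) (h10 : t.real 10 = s.real 10) (h11 : t.real 11 = s.real 11)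
    (h12 : t.real 12 = s.real 12) (h6 : t.nat 6 = s.nat 6) (h7 : t.nat 7 = s.nat 7)
    (h8 : t.nat 8 = s.nat 8) (h3 : t.real 3 = s.real 3) : Bracket I R G δ t := by
  refine ⟨hin, ?_, ?_, ?_, h.diff_nonneg, ?_, ?_⟩
  · rw [h10, h.bound]
  · rw [h11]; exact h.nonneg
  · rw [h11, h12]; exact h.diff
  · rw [h11]; exact h.lower.congr h6 h7 h8 h3
  · rw [h12]; exact h.upper.congr h6 h7 h8 h3

end Program
end LBkSRO

/-! ### The bisection step and the starting bracket. -/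

namespace LBkSRO

open Finset RAM SetFamily

namespace Program

variable {I : LBkSRO} {R lam : ℝ}

theorem primalDual_frame {s : State} (h : HasInput I s) :
    ∀ j < I.nD + I.nD, (primalDual.den s).nat 6 j = s.nat 6 j ∧
      (primalDual.den s).nat 7 j = s.nat 7 j ∧ (primalDual.den s).nat 8 j = s.nat 8 j ∧
      (primalDual.den s).real 3 j = s.real 3 j := by
  simp only [primalDual, LProg.den_block_cons, LProg.den_block_singleton]
  have hI1 := h.den clearFrozen (by decide) (by decide) (by decide) (by decide)
  refine LProg.loop_spec (v := 22) (e := eD) (p := pdStep) I.nD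
    (fun _ t => ∀ j < I.nD + I.nD, t.nat 6 j = s.nat 6 j ∧ t.nat 7 j = s.nat 7 j ∧
      t.nat 8 j = s.nat 8 j ∧ t.real 3 j = s.real 3 j) (by simp [hI1.nD]) ?_ ?_
  · intro j _
    have h6 : (clearFrozen.den s).nat 6 = s.nat 6 := LProg.den_nat _ _ (by decide)
    have h7 : (clearFrozen.den s).nat 7 = s.nat 7 := LProg.den_nat _ _ (by decide)
    have h8 : (clearFrozen.den s).nat 8 = s.nat 8 := LProg.den_nat _ _ (by decide)
    have h3 : (clearFrozen.den s).real 3 = s.real 3 := LProg.den_real _ _ (by decide)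
    simp [h6, h7, h8, h3]
  · intro i t hi hv hn hr hJ j hj
    have hIt : HasInput I t := hI1.congr (hn 0 (by decide)) (hn 1 (by decide))
      (hn 4 (by decide)) (hr 1 (by decide))
    have hI2 := (hIt.den countUnfrozen (by decide) (by decide) (by decide) (by decide)).den
      findBall (by decide) (by decide) (by decide) (by decide)
    set u := findBall.den (countUnfrozen.den t) with hu
    have h22 : u.nat 22 0 = i := by
      rw [hu, LProg.den_nat _ _ (by decide), LProg.den_nat _ _ (by decide), hv]
    obtain ⟨r8, r6, r7, r3, -⟩ := recordBall_spec hI2 h22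
    have hne : j ≠ I.nD + I.nD + i := by omega
    have hden : pdStep.den t = freezeBall.den (recordBall.den u) := rfl
    have e6 : (pdStep.den t).nat 6 j = t.nat 6 j := by
      rw [hden, LProg.den_nat freezeBall _ (by decide), r6, if_neg hne, hu,
        LProg.den_nat _ _ (by decide), LProg.den_nat _ _ (by decide)]
    have e7 : (pdStep.den t).nat 7 j = t.nat 7 j := by
      rw [hden, LProg.den_nat freezeBall _ (by decide), r7, if_neg hne, hu,
        LProg.den_nat _ _ (by decide), LProg.den_nat _ _ (by decide)]
    have e8 : (pdStep.den t).nat 8 j = t.nat 8 j := by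
      rw [hden, LProg.den_nat freezeBall _ (by decide), r8, if_neg hne, hu,
        LProg.den_nat _ _ (by decide), LProg.den_nat _ _ (by decide)]
    have e3 : (pdStep.den t).real 3 j = t.real 3 j := by
      rw [hden, LProg.den_real freezeBall _ (by decide), r3, if_neg hne, hu,
        LProg.den_real _ _ (by decide), LProg.den_real _ _ (by decide)]
    obtain ⟨j6, j7, j8, j3⟩ := hJ j hj
    rw [← j6, ← j7, ← j8, ← j3, ← e6, ← e7, ← e8, ← e3]
    exact ⟨rfl, rfl, rfl, rfl⟩

theorem HasRun.primalDual {o : ℕ} {Q : Prop → Prop} {s : State} (h : HasInput I s)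
    (ho : o + I.nD ≤ I.nD + I.nD) (hr : HasRun I R lam o Q s) :
    HasRun I R lam o Q (primalDual.den s) := by
  obtain ⟨A, b, τ, α, h1, h2, h3, h4⟩ := hr
  refine ⟨A, b, τ, α, h1, h2, fun q hq => ?_, h4⟩
  obtain ⟨e6, e7, e8, e3⟩ := primalDual_frame h (o + q) (by omega)
  rw [e6, e7, e8, e3]
  exact h3 q hq

theorem HasRun.mono {o : ℕ} {Q Q' : Prop → Prop} {s : State} (h : HasRun I R lam o Q s)
    (hQ : ∀ c, Q c → Q' c) : HasRun I R lam o Q' s := by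
  obtain ⟨A, b, τ, α, h1, h2, h3, h4⟩ := h
  exact ⟨A, b, τ, α, h1, h2, h3, hQ _ h4⟩

/-- The part of the bisection step which counts components. -/
def probe : LProg := block [selectEarly, buildClusters, evalClusters]

theorem hasRun_probe {s : State} (h : HasInput I s) (hR : s.real 10 0 = R)
    (hlam : s.real 13 0 = lam) (hlam0 : 0 ≤ lam) (v₀ : I.Ball) :
    HasRun I R lam (I.nD + I.nD)
      (fun c => (probe.den (primalDual.den s)).nat 50 0 ≤ I.k ↔ ¬ c)
      (probe.den (primalDual.den s)) := by
  obtain ⟨A, b, t, α, h1, h2, h3, h4⟩ := primalDual_spec h hR hlam hlam0 v₀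
  refine ⟨A, b, t, α, h1, h2, ?_, ?_⟩
  · exact h3.congr (LProg.den_nat _ _ (by decide)) (LProg.den_nat _ _ (by decide))
      (LProg.den_nat _ _ (by decide)) (LProg.den_real _ _ (by decide))
  · exact initials_count (h.den primalDual (by decide) (by decide) (by decide) (by decide)) h2 h3 h4

/-- The midpoint replaces the end whose side of the threshold it falls on. The property of the upper
run is conditional on `G`, since for a wrong guess of `R` the initial upper run may have too many
components. -/
theorem bisect_spec {G : Prop} {δ : ℝ} {s : State} (h : Bracket I R G δ s) (v₀ : I.Ball) :
    Bracket I R G (δ / 2) (bisect.den s) := by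
  set s₁ := (rset 13 (.div (.add (rv 11) (rv 12)) (.lit 2))).den s with hs₁
  have hI1 : HasInput I s₁ := h.input.congr rfl rfl rfl rfl
  set lam := (s.real 11 0 + s.real 12 0) / 2 with hlam
  have h13 : s₁.real 13 0 = lam := by simp [hs₁, hlam]
  have hlam0 : 0 ≤ lam := by
    have := h.nonneg; have := h.diff; have := h.diff_nonneg
    rw [hlam]; linarith
  have hrun := hasRun_probe hI1 (R := R) (by simpa [hs₁] using h.bound) h13 hlam0 v₀
  have hlow : HasRun I R (s.real 11 0) 0 (fun c => c ∨ s.real 11 0 = 0)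
      (probe.den (primalDual.den s₁)) :=
    (HasRun.primalDual hI1 (by omega) (h.lower.congr (t := s₁) rfl rfl rfl rfl)).congr
      (LProg.den_nat _ _ (by decide)) (LProg.den_nat _ _ (by decide))
      (LProg.den_nat _ _ (by decide)) (LProg.den_real _ _ (by decide))
  have hupp : HasRun I R (s.real 12 0) I.nD (fun c => G → ¬ c)
      (probe.den (primalDual.den s₁)) :=
    (HasRun.primalDual hI1 (by omega) (h.upper.congr (t := s₁) rfl rfl rfl rfl)).congr
      (LProg.den_nat _ _ (by decide)) (LProg.den_nat _ _ (by decide))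
      (LProg.den_nat _ _ (by decide)) (LProg.den_real _ _ (by decide))
  set u := probe.den (primalDual.den s₁) with hu
  have hIu : HasInput I u := (hI1.den primalDual (by decide) (by decide) (by decide)
    (by decide)).den probe (by decide) (by decide) (by decide) (by decide)
  have hur : ∀ {a}, a ∉ primalDual.realWrites → a ∉ probe.realWrites → u.real a = s₁.real a :=
    fun h1 h2 => by rw [hu, LProg.den_real _ _ h2, LProg.den_real _ _ h1]
  have u10 : u.real 10 0 = R := by
    rw [hur (by decide) (by decide)]; simpa [hs₁] using h.bound
  have u11 : u.real 11 0 = s.real 11 0 := by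
    rw [hur (by decide) (by decide)]; simp [hs₁]
  have u12 : u.real 12 0 = s.real 12 0 := by
    rw [hur (by decide) (by decide)]; simp [hs₁]
  have u13 : u.real 13 0 = lam := by rw [hur (by decide) (by decide), h13]
  have hdiff := h.diff
  have hδ := h.diff_nonneg
  have hden : bisect.den s = copyRun.den ((LProg.ite (.natLe (nv 50) eK)
    (block [nset 52 eD, rset 12 (rv 13)]) (block [nset 52 (.lit 0), rset 11 (rv 13)])).den u) := rfl
  rw [hden]
  have hcr : ∀ (w : State) {a}, a ∉ copyRun.realWrites → (copyRun.den w).real a = w.real a :=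
    fun w _ ha => LProg.den_real _ _ ha
  by_cases hc : u.nat 50 0 ≤ I.k
  · rw [LProg.den_ite_pos (by simpa [hIu.k] using hc)]
    set w := (block [nset 52 eD, rset 12 (rv 13)]).den u with hw
    have hIw : HasInput I w := hIu.congr rfl rfl rfl rfl
    have hwr : ∀ {a}, a ≠ 12 → w.real a = u.real a := fun ha => State.setReal_real_ne _ ha
    have w52 : w.nat 52 0 = I.nD := by simp [hw, hIu.nD]
    have w12 : w.real 12 0 = lam := by simp [hw, u13]
    refine ⟨hIw.den copyRun (by decide) (by decide) (by decide) (by decide), ?_, ?_, ?_, by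
      positivity, ?_, ?_⟩
    · rw [hcr _ (by decide), hwr (by decide), u10]
    · rw [hcr _ (by decide), hwr (by decide), u11]; exact h.nonneg
    · rw [hcr _ (by decide), hcr _ (by decide), hwr (a := 11) (by decide), u11, w12, hlam]
      linarith
    · rw [hcr _ (by decide), hwr (by decide), u11]
      exact HasRun.copy_of_disjoint hIw w52 (by omega) (by omega)
        (hlow.congr (t := w) rfl rfl rfl rfl)
    · rw [hcr _ (by decide), w12]
      exact HasRun.copy hIw w52 (by omega)
        ((hrun.mono fun c h _ => h.1 hc).congr (t := w) rfl rfl rfl rfl)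
  · rw [LProg.den_ite_neg (by simpa [hIu.k] using hc)]
    set w := (block [nset 52 (.lit 0), rset 11 (rv 13)]).den u with hw
    have hIw : HasInput I w := hIu.congr rfl rfl rfl rfl
    have hwr : ∀ {a}, a ≠ 11 → w.real a = u.real a := fun ha => State.setReal_real_ne _ ha
    have w52 : w.nat 52 0 = 0 := by simp [hw]
    have w11 : w.real 11 0 = lam := by simp [hw, u13]
    refine ⟨hIw.den copyRun (by decide) (by decide) (by decide) (by decide), ?_, ?_, ?_, by
      positivity, ?_, ?_⟩
    · rw [hcr _ (by decide), hwr (by decide), u10]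
    · rw [hcr _ (by decide), w11]; exact hlam0
    · rw [hcr _ (by decide), hcr _ (by decide), hwr (a := 12) (by decide), u12, w11, hlam]
      linarith
    · rw [hcr _ (by decide), w11]
      exact HasRun.copy hIw w52 (by omega)
        ((hrun.mono fun c h => .inl (not_not.1 fun hn => hc (h.2 hn))).congr (t := w)
          rfl rfl rfl rfl)
    · rw [hcr _ (by decide), hwr (by decide), u12]
      exact HasRun.copy_of_disjoint hIw w52 (by omega) (by omega)
        (hupp.congr (t := w) rfl rfl rfl rfl)

/-- The initial distance between the two opening costs. -/
noncomputable def startGap (I : LBkSRO) (R : ℝ) : ℝ :=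
  if R ≤ 0 then 1 else R * I.nD * I.nD + R

theorem startGap_pos (I : LBkSRO) (R : ℝ) : 0 < startGap I R := by
  rw [startGap]
  split_ifs with h
  · exact one_pos
  · have := not_le.1 h; positivity

theorem hasRun_scratch {s : State} (h : HasInput I s) (hR : s.real 10 0 = R)
    (hlam : s.real 13 0 = lam) (hlam0 : 0 ≤ lam) (v₀ : I.Ball) {Q : Prop → Prop}
    (hQ : ∀ (A : Finset ℕ) (b : ℕ → I.Ball) (t : ℕ → ℝ) (α : Fin I.nD → ℝ),
      IsRun R lam A b t α → Q (CompsGE (sets b) (initials b A) (I.k + 1))) :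
    HasRun I R lam (I.nD + I.nD) Q (primalDual.den s) := by
  obtain ⟨A, b, t, α, h1, h2, h3, h4⟩ := primalDual_spec h hR hlam hlam0 v₀
  exact ⟨A, b, t, α, h1, h2, h3, hQ A b t α h1⟩

theorem initLower_spec {s : State} (h : HasInput I s) (hR : s.real 10 0 = R) (v₀ : I.Ball) :
    HasInput I (initLower.den s) ∧ (initLower.den s).real 10 0 = R ∧
      (initLower.den s).real 11 0 = 0 ∧
      HasRun I R 0 0 (fun c => c ∨ (0 : ℝ) = 0) (initLower.den s) := by
  refine ⟨h.den _ (by decide) (by decide) (by decide) (by decide), ?_, ?_, ?_⟩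
  · rw [LProg.den_real _ _ (by decide), hR]
  · simp only [initLower, LProg.den_block_cons, LProg.den_block_singleton]
    rw [LProg.den_real copyRun _ (by decide), LProg.den_setNat, State.setNat_real,
      LProg.den_real primalDual _ (by decide)]
    simp
  · change HasRun I R 0 0 (fun c => c ∨ (0 : ℝ) = 0) (copyRun.den ((nset 52 (.lit 0)).den
      (primalDual.den ((rset 13 (rv 11)).den ((rset 11 (.ofNat (.lit 0))).den s)))))
    set s₁ := (rset 13 (rv 11)).den ((rset 11 (.ofNat (.lit 0))).den s) with hs₁
    have hI1 : HasInput I s₁ := h.congr rfl rfl rfl rfl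
    have hrun := hasRun_scratch hI1 (R := R) (lam := 0) (by simpa [hs₁] using hR)
      (by simp [hs₁]) le_rfl v₀ (Q := fun c => c ∨ (0 : ℝ) = 0) fun _ _ _ _ _ => .inr rfl
    exact HasRun.copy ((hI1.den primalDual (by decide) (by decide) (by decide) (by decide)).congr
      (State.setNat_nat_ne _ (by decide)) (State.setNat_nat_ne _ (by decide))
      (State.setNat_nat_ne _ (by decide)) rfl) (by simp) (by omega)
      (hrun.congr (State.setNat_nat_ne _ (by decide)) (State.setNat_nat_ne _ (by decide))
      (State.setNat_nat_ne _ (by decide)) rfl)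

/-- The starting gap exceeds `I.nD * I.cost y`: for `R > 0` because the cost is at most `I.nD * R`,
for `R = 0` because the cost is 0. So `not_compsGE_of_large` applies to the upper end. -/
theorem init_spec {s : State} (h : HasInput I s) (hR : s.real 10 0 = R) (hR0 : 0 ≤ R)
    (hm : I.m < I.nD) (v₀ : I.Ball) {y : I.Solution} :
    Bracket I R (I.Feasible y ∧ ∀ i ∈ y.S, I.radius y i ≤ R) (startGap I R)
      (initUpper.den (initLower.den s)) := by
  obtain ⟨hI, h10, h11, hlow⟩ := initLower_spec h hR v₀
  set s₀ := initLower.den s with hs₀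
  simp only [initUpper, LProg.den_block_cons, LProg.den_block_singleton]
  set s₁ := (LProg.ite (.realLe (rv 10) (.ofNat (.lit 0))) (rset 12 (.ofNat (.lit 1)))
    (rset 12 (.add (.mul (.mul (rv 10) eD) eD) (rv 10)))).den s₀ with hs₁
  have h12 : s₁.real 12 0 = startGap I R := by
    rw [hs₁, startGap]
    split_ifs with hc
    · rw [LProg.den_ite_pos (by simpa [h10] using hc)]; simp
    · rw [LProg.den_ite_neg (by simpa [h10] using hc)]; simp [h10, hI.nD]
  have hs₁n : s₁.nat = s₀.nat := by
    rw [hs₁]; by_cases hc : s₀.real 10 0 ≤ 0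
    · rw [LProg.den_ite_pos (by simpa using hc)]; rfl
    · rw [LProg.den_ite_neg (by simpa using hc)]; rfl
  have hs₁r : ∀ {a}, a ≠ 12 → s₁.real a = s₀.real a := fun ha => LProg.den_real _ _ (by
    simp [LProg.realWrites, ha])
  set s₂ := (rset 13 (rv 12)).den s₁ with hs₂
  have hI2 : HasInput I s₂ := hI.congr (by simp only [← hs₁n]; rfl) (by simp only [← hs₁n]; rfl)
    (by simp only [← hs₁n]; rfl) (by rw [← hs₁r (by decide)]; rfl)
  have h2r : ∀ {a}, a ≠ 13 → s₂.real a = s₁.real a := fun ha => State.setReal_real_ne _ ha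
  have hlow2 : HasRun I R 0 0 (fun c => c ∨ (0 : ℝ) = 0) s₂ := hlow.congr
    (by simp only [← hs₁n]; rfl) (by simp only [← hs₁n]; rfl) (by simp only [← hs₁n]; rfl)
    (by rw [h2r (by decide), hs₁r (by decide)])
  have hrun := hasRun_scratch hI2 (R := R) (lam := startGap I R)
    (by rw [h2r (by decide), hs₁r (by decide), h10]) (by simp [hs₂, h12]) (startGap_pos I R).le v₀
    (Q := fun c => (I.Feasible y ∧ ∀ i ∈ y.S, I.radius y i ≤ R) → ¬ c) (by
      rintro A b t α hA ⟨hy, hyR⟩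
      rw [← hA.early_eq]
      refine not_compsGE_of_large hy hyR hm ?_ hA
      have hcost := cost_le_mul hR0 hyR
      rw [startGap]
      split_ifs with hc
      · have : R = 0 := le_antisymm hc hR0
        rw [this, mul_zero] at hcost
        rw [le_antisymm hcost (cost_nonneg y)]; simp
      · have := mul_le_mul_of_nonneg_left hcost (Nat.cast_nonneg (α := ℝ) I.nD)
        have := not_le.1 hc
        nlinarith)
  have hlow3 := hlow2.primalDual hI2 (by omega)
  have hI3 := hI2.den primalDual (by decide) (by decide) (by decide) (by decide)
  set s₃ := primalDual.den s₂ with hs₃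
  have h3r : ∀ {a}, a ∉ primalDual.realWrites → s₃.real a = s₂.real a := fun ha =>
    LProg.den_real _ _ ha
  set s₄ := (nset 52 eD).den s₃ with hs₄
  have hI4 : HasInput I s₄ := hI3.congr rfl rfl rfl rfl
  have h4r : s₄.real = s₃.real := rfl
  have h52 : s₄.nat 52 0 = I.nD := by simp [hs₄, hI3.nD]
  have hcr : ∀ {a}, a ∉ copyRun.realWrites → (copyRun.den s₄).real a = s₄.real a :=
    fun ha => LProg.den_real _ _ ha
  have e11 : (copyRun.den s₄).real 11 0 = 0 := by
    rw [hcr (by decide), h4r, h3r (by decide), h2r (by decide), hs₁r (by decide), h11]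
  have e12 : (copyRun.den s₄).real 12 0 = startGap I R := by
    rw [hcr (by decide), h4r, h3r (by decide), h2r (by decide), h12]
  refine ⟨hI4.den copyRun (by decide) (by decide) (by decide) (by decide), ?_, ?_, ?_,
    (startGap_pos I R).le, ?_, ?_⟩
  · rw [hcr (by decide), h4r, h3r (by decide), h2r (by decide), hs₁r (by decide), h10]
  · rw [e11]
  · rw [e11, e12, sub_zero]
  · rw [e11]
    exact HasRun.copy_of_disjoint hI4 h52 (by omega) (by omega)
      (hlow3.congr (t := s₄) rfl rfl rfl rfl)
  · rw [e12]
    exact HasRun.copy hI4 h52 (by omega) (hrun.congr (t := s₄) rfl rfl rfl rfl)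

theorem bisectLoop_spec {G : Prop} {δ : ℝ} {s : State} (h : Bracket I R G δ s) (v₀ : I.Ball) :
    Bracket I R G (δ / 2 ^ (7 * I.nD)) (bisectLoop.den s) := by
  refine LProg.loop_spec (v := 70) (7 * I.nD) (fun i t => Bracket I R G (δ / 2 ^ i) t)
    (by simp [h.input.nD]; ring) ?_ fun i t hi hv hn hr hJ => ?_
  · rw [pow_zero, div_one]
    exact h.congr (h.input.congr rfl rfl rfl rfl) rfl rfl rfl rfl rfl rfl rfl
  · have hb := bisect_spec hJ v₀
    rw [pow_succ, ← div_div]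
    exact hb.congr (hb.input.congr (State.setNat_nat_ne _ (by decide))
      (State.setNat_nat_ne _ (by decide)) (State.setNat_nat_ne _ (by decide)) rfl) rfl rfl rfl
      (State.setNat_nat_ne _ (by decide)) (State.setNat_nat_ne _ (by decide))
      (State.setNat_nat_ne _ (by decide)) rfl

/-- With x = 2^n the claim becomes 3n(n² + 1) ≤ x⁶, which follows from n < x and 2 ≤ x. -/
theorem gap_le (hD : 0 < I.nD) (hR : 0 < R) :
    I.nD * (startGap I R / 2 ^ (7 * I.nD) * 2 ^ I.nD) ≤ R / 3 := by
  have h1 : startGap I R = R * (I.nD * I.nD + 1) := by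
    rw [startGap, if_neg hR.not_ge]; ring
  set n := I.nD with hn
  have h2 : (n : ℝ) < 2 ^ n := by exact_mod_cast Nat.lt_two_pow_self
  have h2' : (2 : ℝ) ≤ 2 ^ n := by
    calc (2 : ℝ) = 2 ^ 1 := (pow_one _).symm
      _ ≤ 2 ^ n := pow_le_pow_right₀ one_le_two hD
  rw [h1, mul_comm 7, pow_mul]
  set x : ℝ := 2 ^ n with hx
  have hx0 : 0 < x := by positivity
  have hn0 : (0 : ℝ) ≤ n := Nat.cast_nonneg n
  have h3 : 3 * (n * (n * n + 1)) ≤ x ^ 6 := by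
    have h4 : (n : ℝ) * n ≤ x * x := mul_le_mul h2.le h2.le hn0 hx0.le
    have h5 : (n : ℝ) * (n * n + 1) ≤ x * (x * x + 1) :=
      mul_le_mul h2.le (by linarith) (by positivity) hx0.le
    have h6 : (4 : ℝ) ≤ x ^ 2 := by nlinarith
    have h7 : x * (x * x + 1) ≤ x ^ 2 * x ^ 2 := by
      have : x ≤ x ^ 3 / 4 := by nlinarith
      nlinarith [pow_pos hx0 3]
    nlinarith [pow_pos hx0 4]
  have h8 : (n : ℝ) * (R * (n * n + 1) / x ^ 7 * x) = R * (n * (n * n + 1)) / x ^ 6 := by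
    field_simp
  rw [h8, div_le_div_iff₀ (by positivity) (by norm_num)]
  nlinarith

end Program
end LBkSRO

/-! ### Correctness of the search for a cheap solution -/

namespace LBkSRO

open Finset RAM SetFamily

namespace Program

variable {I : LBkSRO} {R : ℝ}

/-- The items of two runs. -/
structure Items (R : ℝ) (s : State) (A : Finset ℕ) (b : ℕ → I.Ball) (t : ℕ → ℝ) : Prop where
  slots : Slots s 0 (I.nD + I.nD) A b t
  lt : ∀ q ∈ A, q < I.nD + I.nD
  valid : ∀ q ∈ A, Valid R (b q)

/-- The second run is shifted by `I.nD`, matching its cells in memory; the two windows recover the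
runs. -/
theorem exists_items {s : State} {l₁ l₂ : ℝ} {Q₁ Q₂ : Prop → Prop} (hD : 0 < I.nD)
    (h₁ : HasRun I R l₁ 0 Q₁ s) (h₂ : HasRun I R l₂ I.nD Q₂ s) :
    ∃ (A : Finset ℕ) (b : ℕ → I.Ball) (t : ℕ → ℝ) (α₁ α₂ : Fin I.nD → ℝ), Items R s A b t ∧
      IsRun R l₁ (window A 0 (I.nD - 1)) b t α₁ ∧
      IsRun R l₂ (window A I.nD (I.nD + I.nD - 1)) b t α₂ ∧
      Q₁ (CompsGE (sets b) (early (sets b) (key t) I.m (window A 0 (I.nD - 1))) (I.k + 1)) ∧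
      Q₂ (CompsGE (sets b) (early (sets b) (key t) I.m (window A I.nD (I.nD + I.nD - 1)))
        (I.k + 1)) := by
  obtain ⟨A₁, b₁, t₁, α₁, r₁, lt₁, s₁, q₁⟩ := h₁
  obtain ⟨A₂, b₂, t₂, α₂, r₂, lt₂, s₂, q₂⟩ := h₂
  set A := A₁.image id ∪ A₂.image (I.nD + ·) with hA
  set b : ℕ → I.Ball := fun q => if q < I.nD then b₁ q else b₂ (q - I.nD) with hb
  set t : ℕ → ℝ := fun q => if q < I.nD then t₁ q else t₂ (q - I.nD) with ht
  have hb1 : ∀ q ∈ A₁, b (id q) = b₁ q := fun q hq => if_pos (lt₁ q hq)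
  have ht1 : ∀ q ∈ A₁, t (id q) = t₁ q := fun q hq => if_pos (lt₁ q hq)
  have hb2 : ∀ q ∈ A₂, b (I.nD + q) = b₂ q := fun q _ => by simp [hb]
  have ht2 : ∀ q ∈ A₂, t (I.nD + q) = t₂ q := fun q _ => by simp [ht]
  have hf2 : StrictMono (I.nD + · : ℕ → ℕ) := fun x y h => Nat.add_lt_add_left h _
  have hmem : ∀ q, q ∈ A ↔ q ∈ A₁ ∨ ∃ x ∈ A₂, I.nD + x = q := by simp [hA]
  have w1 : window A 0 (I.nD - 1) = A₁.image id := by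
    ext q
    simp only [window, mem_filter, hmem, image_id]
    constructor
    · rintro ⟨h | ⟨x, hx, rfl⟩, -, h2⟩
      · exact h
      · omega
    · exact fun h => ⟨.inl h, Nat.zero_le _, by have := lt₁ q h; omega⟩
  have w2 : window A I.nD (I.nD + I.nD - 1) = A₂.image (I.nD + ·) := by
    ext q
    simp only [window, mem_filter, hmem, mem_image]
    constructor
    · rintro ⟨h | h, h1, h2⟩
      · have := lt₁ q h; omega
      · exact h
    · rintro ⟨x, hx, rfl⟩
      have := lt₂ x hx
      exact ⟨.inr ⟨x, hx, rfl⟩, by omega, by omega⟩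
  have R1 : IsRun R l₁ (A₁.image id) b t α₁ := r₁.map strictMono_id hb1 ht1
  have R2 : IsRun R l₂ (A₂.image (I.nD + ·)) b t α₂ := r₂.map hf2 hb2 ht2
  refine ⟨A, b, t, α₁, α₂, ⟨fun q hq => ?_, fun q hq => ?_, fun q hq => ?_⟩, w1 ▸ R1, w2 ▸ R2,
    ?_, ?_⟩
  · rw [zero_add]
    by_cases hlt : q < I.nD
    · have hq : q ∈ A ↔ q ∈ A₁ := by
        rw [hmem]
        refine or_iff_left ?_
        rintro ⟨x, -, rfl⟩
        omega
      have := s₁ q hlt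
      rw [zero_add] at this
      simpa only [hq, hb, ht, if_pos hlt] using this
    · obtain ⟨x, rfl⟩ := Nat.exists_eq_add_of_le (not_lt.1 hlt)
      have hq : I.nD + x ∈ A ↔ x ∈ A₂ := by
        rw [hmem]
        constructor
        · rintro (h | ⟨x', hx', h⟩)
          · exact absurd (lt₁ _ h) hlt
          · rwa [← Nat.add_left_cancel h]
        · exact fun h => .inr ⟨x, h, rfl⟩
      simpa only [hq, hb, ht, if_neg hlt, Nat.add_sub_cancel_left] using s₂ x (by omega)
  · rcases (hmem q).1 hq with h | ⟨x, hx, rfl⟩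
    · have := lt₁ q h; omega
    · have := lt₂ x hx; omega
  · rcases (hmem q).1 hq with h | ⟨x, hx, rfl⟩
    · have := hb1 q h; rw [id] at this; rw [this]; exact r₁.valid q h
    · rw [hb2 x hx]; exact r₂.valid x hx
  · rw [w1, R1.early_eq, compsGE_initials_image strictMono_id hb1]; exact q₁
  · rw [w2, R2.early_eq, compsGE_initials_image hf2 hb2]; exact q₂

theorem Items.congr {s u : State} {A : Finset ℕ} {b : ℕ → I.Ball} {t : ℕ → ℝ}
    (h : Items R s A b t) (h6 : u.nat 6 = s.nat 6) (h7 : u.nat 7 = s.nat 7)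
    (h8 : u.nat 8 = s.nat 8) (h3 : u.real 3 = s.real 3) : Items R u A b t :=
  ⟨h.slots.congr h6 h7 h8 h3, h.lt, h.valid⟩

theorem selectCandidate_spec {s : State} (h : HasInput I s) :
    ∀ q < I.nD + I.nD + I.nD, (1 ≤ (selectCandidate.den s).nat 10 q ↔
      (1 ≤ s.nat 8 q ∧ q < I.nD + I.nD) ∧
      (s.nat 60 0 ≤ q ∧ q ≤ s.nat 61 0 ∧ (s.real 3 q < s.real 3 (s.nat 62 0) ∨
        s.real 3 q = s.real 3 (s.nat 62 0) ∧ q < s.nat 62 0) ∨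
        q = s.nat 63 0 ∨ q = s.nat 64 0)) := by
  set P : ℕ → Prop := fun q => (1 ≤ s.nat 8 q ∧ q < I.nD + I.nD) ∧
      (s.nat 60 0 ≤ q ∧ q ≤ s.nat 61 0 ∧ (s.real 3 q < s.real 3 (s.nat 62 0) ∨
        s.real 3 q = s.real 3 (s.nat 62 0) ∧ q < s.nat 62 0) ∨
        q = s.nat 63 0 ∨ q = s.nat 64 0) with hP
  refine LProg.loop_spec (v := 38) (e := .add (.add eD eD) eD) (p := candidateBody) (s := s)
    (I.nD + I.nD + I.nD) (fun i t => ∀ q < i, (1 ≤ t.nat 10 q ↔ P q))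
    (by simp [h.nD]) (by simp) ?_
  intro i t hi hv hn hr hJ
  have hD : t.nat 0 1 = I.nD := by rw [hn 0 (by decide), h.nD]
  have h8 : t.nat 8 = s.nat 8 := hn 8 (by decide)
  have h3 : t.real 3 = s.real 3 := hr 3 (by decide)
  have hc : Test.holds t
      (.and (.and (.natLe (.lit 1) (.get 8 (nv 38))) (.not (.natLe (.add eD eD) (nv 38))))
      (.not (.and (.not (.and (.and (.natLe (nv 60) (nv 38)) (.natLe (nv 38) (nv 61)))
          (.and (.realLe (.get 3 (nv 38)) (.get 3 (nv 62)))
            (.not (.and (.realLe (.get 3 (nv 62)) (.get 3 (nv 38))) (.natLe (nv 62) (nv 38)))))))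
        (.and (.not (.and (.natLe (nv 38) (nv 63)) (.natLe (nv 63) (nv 38))))
          (.not (.and (.natLe (nv 38) (nv 64)) (.natLe (nv 64) (nv 38)))))))) ↔ P i := by
    have hlex : ∀ (x y : ℝ) (j : ℕ), (x ≤ y ∧ ¬ (y ≤ x ∧ j ≤ i)) ↔ (x < y ∨ x = y ∧ i < j) := by
      intro x y j
      rcases lt_trichotomy x y with hxy | rfl | hxy
      · simp [hxy, hxy.le, hxy.not_ge]
      · simp
      · simp [hxy.not_ge, hxy.ne', hxy.not_gt]
    simp only [Test.holds, NExp.eval, RExp.eval, hv, hD, h8, h3, hn 60 (by decide),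
      hn 61 (by decide), hn 62 (by decide), hn 63 (by decide), hn 64 (by decide), hlex,
      ← le_antisymm_iff, hP, not_le, and_assoc]
    refine and_congr_right fun _ => and_congr_right fun _ => ?_
    rw [not_and_or, not_not, not_and_or, not_not, not_not]
  rw [candidateBody]
  intro q hq
  by_cases hcc : P i
  · rw [LProg.den_ite_pos (hc.2 hcc)]
    rcases Nat.lt_succ_iff_lt_or_eq.1 hq with hq | rfl
    · simpa [hv, hq.ne] using hJ q hq
    · simpa [hv] using hcc
  · rw [LProg.den_ite_neg fun h => hcc (hc.1 h)]
    rcases Nat.lt_succ_iff_lt_or_eq.1 hq with hq | rfl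
    · simpa [hv, hq.ne] using hJ q hq
    · simpa [hv] using hcc

/-- The output is a feasible solution of cost `18`, if scalar `53` says so. -/
def Best (I : LBkSRO) (s : State) : Prop :=
  s.nat 53 0 = 0 ∨
    s.nat 53 0 = 1 ∧ ∃ x, I.Feasible x ∧ I.Presents s x ∧ s.real 18 0 = I.cost x

/-- A solution of cost at most `c` has been found. -/
def UpTo (c : ℝ) (s : State) : Prop := s.nat 53 0 = 1 ∧ s.real 18 0 ≤ c

theorem Best.congr {s t : State} (h : Best I s) (h2 : t.nat 2 = s.nat 2) (h3 : t.nat 3 = s.nat 3)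
    (h53 : t.nat 53 = s.nat 53) (hr : t.real 18 = s.real 18) : Best I t := by
  simpa only [Best, Presents, h2, h3, h53, hr] using h

theorem UpTo.congr {c : ℝ} {s t : State} (h : UpTo c s) (h53 : t.nat 53 = s.nat 53)
    (hr : t.real 18 = s.real 18) : UpTo c t := by
  simpa only [UpTo, h53, hr] using h

theorem copySolution_spec {s : State} (h : HasInput I s) {σ : Fin I.nD → Option (Fin I.nF)}
    (hσ : Sig s σ) (h12 : ∀ i : Fin I.nF, s.nat 12 i = if i ∈ labels σ then 1 else 0) :
    I.Presents (copySolution.den s) (solutionOf σ) := by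
  simp only [copySolution, LProg.den_block_cons, LProg.den_block_singleton]
  have h1 := LProg.loop_spec (v := 39) (e := eD) (p := .setNat 3 (nv 39) (.get 11 (nv 39)))
    (s := s) I.nD (fun i t => ∀ p : Fin I.nD, p.1 < i → t.nat 3 p = code (σ p))
    (by simp [h.nD]) (by simp) (by
      intro i t hi hv hn hr hJ p hp
      have h11 : t.nat 11 = s.nat 11 := hn 11 (by decide)
      rcases (lt_succ_iff_fin hi).1 hp with hp | rfl
      · simpa [hv, hp.ne] using hJ p hp
      · simpa [hv, h11] using hσ ⟨i, hi⟩)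
  have hI1 := h.den (.loop 39 eD (.setNat 3 (nv 39) (.get 11 (nv 39)))) (by decide) (by decide)
    (by decide) (by decide)
  have e12 : ((LProg.loop 39 eD (.setNat 3 (nv 39) (.get 11 (nv 39)))).den s).nat 12 = s.nat 12 :=
    LProg.den_nat _ _ (by decide)
  set s₁ := (LProg.loop 39 eD (.setNat 3 (nv 39) (.get 11 (nv 39)))).den s with hs₁
  have h2 := LProg.loop_spec (v := 65) (e := eF) (p := .setNat 2 (nv 65) (.get 12 (nv 65)))
    (s := s₁) I.nF
    (fun i t => ∀ j : Fin I.nF, j.1 < i → t.nat 2 j = if j ∈ labels σ then 1 else 0)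
    (by simp [hI1.nF]) (by simp) (by
      intro i t hi hv hn hr hJ p hp
      have ht : t.nat 12 = s.nat 12 := by rw [hn 12 (by decide), e12]
      rcases (lt_succ_iff_fin hi).1 hp with hp | rfl
      · simpa [hv, hp.ne] using hJ p hp
      · simpa [hv, ht] using h12 ⟨i, hi⟩)
  refine ⟨fun i => h2 i i.2, fun j => ?_⟩
  rw [LProg.den_nat _ _ (by decide), h1 j j.2]
  show code (σ j) = match σ j with
    | none => 0
    | some i => (i : ℕ) + 1
  cases σ j <;> rfl

theorem updateBest_spec {s : State} (h : HasInput I s) {σ : Fin I.nD → Option (Fin I.nF)}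
    (hσ : Sig s σ) (h49 : s.nat 49 0 = (univ.filter fun p => σ p = none).card)
    (h50 : s.nat 50 0 = (labels σ).card) (h16 : s.real 16 0 = I.cost (solutionOf σ))
    (h12 : ∀ i : Fin I.nF, s.nat 12 i = if i ∈ labels σ then 1 else 0)
    (hfeas : (labels σ).card ≤ I.k → (univ.filter fun p => σ p = none).card ≤ I.m →
      I.Feasible (solutionOf σ)) (hB : Best I s) :
    Best I (updateBest.den s) ∧ ∀ c, (UpTo c s → UpTo c (updateBest.den s)) ∧
      ((labels σ).card ≤ I.k → (univ.filter fun p => σ p = none).card ≤ I.m →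
        I.cost (solutionOf σ) ≤ c → UpTo c (updateBest.den s)) := by
  have hc : Test.holds s (.and (.and (.natLe (nv 49) eM) (.natLe (nv 50) eK))
      (.not (.and (.natLe (.lit 1) (nv 53)) (.realLe (rv 18) (rv 16))))) ↔
      ((univ.filter fun p => σ p = none).card ≤ I.m ∧ (labels σ).card ≤ I.k) ∧
        ¬ (1 ≤ s.nat 53 0 ∧ s.real 18 0 ≤ I.cost (solutionOf σ)) := by
    simp only [Test.holds, NExp.eval, RExp.eval, h49, h50, h16, h.m, h.k]
  rw [updateBest]
  by_cases hcc : ((univ.filter fun p => σ p = none).card ≤ I.m ∧ (labels σ).card ≤ I.k) ∧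
        ¬ (1 ≤ s.nat 53 0 ∧ s.real 18 0 ≤ I.cost (solutionOf σ))
  · rw [LProg.den_ite_pos (hc.2 hcc)]
    simp only [LProg.den_block_cons, LProg.den_block_singleton]
    set s₁ := (rset 18 (rv 16)).den ((nset 53 (.lit 1)).den s) with hs₁
    have hP := copySolution_spec (s := s₁) (h.congr rfl rfl rfl rfl)
      (hσ.congr rfl) (by simpa [hs₁] using h12)
    have h53 : (copySolution.den s₁).nat 53 0 = 1 := by
      rw [LProg.den_nat _ _ (by decide)]; simp [hs₁]
    have h18 : (copySolution.den s₁).real 18 0 = I.cost (solutionOf σ) := by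
      rw [LProg.den_real _ _ (by decide)]; simp [hs₁, h16]
    refine ⟨.inr ⟨h53, _, hfeas hcc.1.2 hcc.1.1, hP, h18⟩, fun c => ⟨fun hu => ⟨h53, ?_⟩,
      fun _ _ hle => ⟨h53, by rw [h18]; exact hle⟩⟩⟩
    rw [h18]
    by_contra hlt
    exact hcc.2 ⟨hu.1.ge, hu.2.trans (not_le.1 hlt).le⟩
  · rw [LProg.den_ite_neg fun h => hcc (hc.1 h), LProg.den_skip]
    refine ⟨hB, fun c => ⟨id, fun hk hm hle => ?_⟩⟩
    have : 1 ≤ s.nat 53 0 ∧ s.real 18 0 ≤ I.cost (solutionOf σ) := by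
      by_contra hn
      exact hcc ⟨⟨hm, hk⟩, hn⟩
    refine ⟨?_, this.2.trans hle⟩
    rcases hB with h0 | h1
    · omega
    · exact h1.1

/-- `x ∈ A` is required because only then does the time cell of `x` hold `t x`; extra indices
outside `A` are discarded by the presence flag. -/
theorem tryCandidate_spec {s : State} (h : HasInput I s) {A : Finset ℕ} {b : ℕ → I.Ball}
    {t : ℕ → ℝ} (hit : Items R s A b t) (hB : Best I s) :
    Best I (tryCandidate.den s) ∧ ∀ c, (UpTo c s → UpTo c (tryCandidate.den s)) ∧
      ∀ a a' x e₁ e₂, s.nat 60 0 = a → s.nat 61 0 = a' → s.nat 62 0 = x → s.nat 63 0 = e₁ →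
        s.nat 64 0 = e₂ → x ∈ A → unc (sets b) (candidate A t a a' x e₁ e₂) ≤ I.m →
        ¬ CompsGE (sets b) (candidate A t a a' x e₁ e₂) (I.k + 1) →
        (∀ σ, IsClustering b (candidate A t a a' x e₁ e₂) σ → I.cost (solutionOf σ) ≤ c) →
        UpTo c (tryCandidate.den s) := by
  classical
  simp only [tryCandidate, LProg.den_block_cons, LProg.den_block_singleton]
  have hsel := selectCandidate_spec h
  set P : ℕ → Prop := fun q => (s.nat 60 0 ≤ q ∧ q ≤ s.nat 61 0 ∧
    (s.real 3 q < s.real 3 (s.nat 62 0) ∨ s.real 3 q = s.real 3 (s.nat 62 0) ∧ q < s.nat 62 0) ∨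
        q = s.nat 63 0 ∨ q = s.nat 64 0) with hP
  set F := A.filter P with hF
  have hI1 := h.den selectCandidate (by decide) (by decide) (by decide) (by decide)
  have hslot : ∀ q < I.nD + I.nD, s.nat 8 q = (if q ∈ A then 1 else 0) ∧
      (q ∈ A → s.nat 6 q = (b q).1 ∧ s.nat 7 q = (b q).2 ∧ s.real 3 q = t q) := fun q hq => by
    simpa using hit.slots q hq
  obtain ⟨σ, hσ, hcl⟩ := buildClusters_spec hI1 (F := F) (b := b) (fun q hq => by
      rw [hsel q hq, hF, mem_filter]
      refine and_congr_left fun _ => ?_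
      constructor
      · rintro ⟨h1, h2⟩
        rw [(hslot q h2).1] at h1
        by_contra hc
        rw [if_neg hc] at h1
        omega
      · intro hq
        refine ⟨?_, hit.lt q hq⟩
        rw [(hslot q (hit.lt q hq)).1, if_pos hq])
    (fun q hq => by have := hit.lt q (mem_filter.1 hq).1; omega)
    (fun q hq => by
      have hqA := (mem_filter.1 hq).1
      obtain ⟨h6, h7, -⟩ := (hslot q (hit.lt q hqA)).2 hqA
      rw [LProg.den_nat _ _ (by decide), LProg.den_nat _ _ (by decide)]
      exact ⟨h6, h7⟩)
  have hI2 := hI1.den buildClusters (by decide) (by decide) (by decide) (by decide)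
  obtain ⟨e49, e50, e16, e12⟩ := evalClusters_spec hI2 hσ
  set u := evalClusters.den (buildClusters.den (selectCandidate.den s)) with hu
  have hI3 : HasInput I u := hI2.den evalClusters (by decide) (by decide) (by decide) (by decide)
  have hun : ∀ {a}, a ∉ selectCandidate.natWrites → a ∉ buildClusters.natWrites →
      a ∉ evalClusters.natWrites → u.nat a = s.nat a := fun h1 h2 h3 => by
    rw [hu, LProg.den_nat _ _ h3, LProg.den_nat _ _ h2, LProg.den_nat _ _ h1]
  have hur : u.real 18 = s.real 18 := by
    rw [hu, LProg.den_real _ _ (by decide), LProg.den_real _ _ (by decide),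
      LProg.den_real _ _ (by decide)]
  have h53 : u.nat 53 = s.nat 53 := hun (by decide) (by decide) (by decide)
  obtain ⟨k1, k2⟩ := updateBest_spec hI3 (hσ.congr (LProg.den_nat _ _ (by decide))) e49 e50 e16 e12
    (fun hk hm => hcl.feasible (fun q hq => hit.valid q (mem_filter.1 hq).1) hk hm)
    (hB.congr (hun (by decide) (by decide) (by decide)) (hun (by decide) (by decide) (by decide))
      h53 hur)
  refine ⟨k1, fun c => ⟨fun hc => (k2 c).1 (hc.congr h53 hur), ?_⟩⟩
  rintro _ _ _ _ _ rfl rfl rfl rfl rfl hx hunc hcomp hcost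
  have hFc : F = candidate A t (s.nat 60 0) (s.nat 61 0) (s.nat 62 0) (s.nat 63 0)
      (s.nat 64 0) := by
    rw [hF, candidate]
    refine filter_congr fun q hq => ?_
    simp only [hP]
    rw [((hslot q (hit.lt q hq)).2 hq).2.2, ((hslot _ (hit.lt _ hx)).2 hx).2.2]
  rw [← hFc] at hunc hcomp hcost
  refine (k2 c).2 ?_ ?_ (hcost σ hcl)
  · rw [hcl.compsGE_iff] at hcomp; omega
  · rw [← hcl.unc_eq]; exact hunc

end Program
end LBkSRO

/-! ### The approximation guarantee -/

namespace LBkSRO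

open Finset RAM SetFamily

namespace Program

variable {I : LBkSRO} {R : ℝ}

/-- The program `p` preserves `Inv` and `G`, and establishes `G` if started in a state of `C`. -/
def Improves (Inv G C : State → Prop) (p : LProg) : Prop :=
  ∀ s, Inv s → Inv (p.den s) ∧ (G s → G (p.den s)) ∧ (C s → G (p.den s))

/-- Iteration `i₀` establishes `G`, and the later ones preserve it. Applied five times, this handles
the nested search without five nested invariants. -/
theorem Improves.loop {Inv G C C' : State → Prop} {p : LProg} (h : Improves Inv G C p) {v : ℕ}
    {e : NExp} {N i₀ : ℕ} (hi₀ : i₀ < N) (hN : ∀ s, Inv s → e.eval s = N)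
    (hInv : ∀ s x, Inv s → Inv (s.setNat v 0 x)) (hG : ∀ s x, G s → G (s.setNat v 0 x))
    (hC : ∀ s t, (∀ a, a ∉ v :: p.natWrites → t.nat a = s.nat a) → t.nat v 0 = i₀ →
      C' s → C t) : Improves Inv G C' (.loop v e p) := by
  intro s hs
  obtain ⟨k1, k2, k3⟩ := LProg.loop_spec (v := v) (e := e) (p := p) (s := s) N
    (fun i t => Inv t ∧ (G s → G t) ∧ (i₀ < i → C' s → G t)) (hN s hs)
    ⟨hInv _ _ hs, hG _ _, fun h => absurd h (Nat.not_lt_zero _)⟩ (by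
      rintro i t hi hv hn hr ⟨j1, j2, j3⟩
      obtain ⟨a1, a2, a3⟩ := h t j1
      refine ⟨hInv _ _ a1, fun hg => hG _ _ (a2 (j2 hg)), fun hlt hc => hG _ _ ?_⟩
      rcases Nat.lt_succ_iff_lt_or_eq.1 hlt with hlt | rfl
      · exact a2 (j3 hlt hc)
      · exact a3 (hC s t hn hv hc))
  exact ⟨k1, k2, k3 hi₀⟩

/-- `H` says that the guess of `R` is right. Without it the search must still preserve the
invariants and the best solution so far. -/
theorem search_spec {s : State} {A : Finset ℕ} {b : ℕ → I.Ball} {t : ℕ → ℝ} {c : ℝ} {H : Prop}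
    {a a' x e₁ e₂ : ℕ} (h : HasInput I s) (hit : Items R s A b t) (hB : Best I s)
    (ha : a < I.nD + I.nD) (ha' : a' < I.nD + I.nD) (hx : x < I.nD + I.nD)
    (he₁ : e₁ < I.nD + I.nD) (he₂ : e₂ < I.nD + I.nD)
    (hH : H → x ∈ A ∧ unc (sets b) (candidate A t a a' x e₁ e₂) ≤ I.m ∧
        ¬ CompsGE (sets b) (candidate A t a a' x e₁ e₂) (I.k + 1) ∧
        ∀ σ, IsClustering b (candidate A t a a' x e₁ e₂) σ → I.cost (solutionOf σ) ≤ c) :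
    HasInput I (search.den s) ∧ Best I (search.den s) ∧ (UpTo c s → UpTo c (search.den s)) ∧
      (H → UpTo c (search.den s)) := by
  set Inv : State → Prop := fun s => HasInput I s ∧ Items R s A b t ∧ Best I s with hInv
  have hset : ∀ v : ℕ, 60 ≤ v → ∀ s y, Inv s → Inv (s.setNat v 0 y) := by
    intro v hv s y ⟨h1, h2, h3⟩
    have hne : ∀ {a}, a < 60 → (s.setNat v 0 y).nat a = s.nat a := fun ha =>
      State.setNat_nat_ne _ (by omega)
    exact ⟨h1.congr (hne (by omega)) (hne (by omega)) (hne (by omega)) rfl,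
      h2.congr (hne (by omega)) (hne (by omega)) (hne (by omega)) rfl,
      h3.congr (hne (by omega)) (hne (by omega)) (hne (by omega)) rfl⟩
  have hsetG : ∀ v : ℕ, 60 ≤ v → ∀ s y, UpTo c s → UpTo c (s.setNat v 0 y) := by
    intro v hv s y hs
    exact hs.congr (State.setNat_nat_ne _ (by omega)) rfl
  have hN : ∀ s, Inv s → eDD.eval s = I.nD + I.nD := fun s hs => by simp [hs.1.nD]
  have h0 : Improves Inv (UpTo c) (fun s => H ∧ s.nat 60 0 = a ∧ s.nat 61 0 = a' ∧
      s.nat 62 0 = x ∧ s.nat 63 0 = e₁ ∧ s.nat 64 0 = e₂) tryCandidate := by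
    rintro s ⟨h1, h2, h3⟩
    obtain ⟨k1, k2⟩ := tryCandidate_spec h1 h2 h3
    refine ⟨⟨h1.den _ (by decide) (by decide) (by decide) (by decide),
      h2.congr (LProg.den_nat _ _ (by decide)) (LProg.den_nat _ _ (by decide))
        (LProg.den_nat _ _ (by decide)) (LProg.den_real _ _ (by decide)), k1⟩, (k2 c).1, ?_⟩
    rintro ⟨hc, c1, c2, c3, c4, c5⟩
    obtain ⟨d1, d2, d3, d4⟩ := hH hc
    exact (k2 c).2 a a' x e₁ e₂ c1 c2 c3 c4 c5 d1 d2 d3 d4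
  have h1 : Improves Inv (UpTo c) (fun s => H ∧ s.nat 60 0 = a ∧ s.nat 61 0 = a' ∧
      s.nat 62 0 = x ∧ s.nat 63 0 = e₁) (.loop 64 eDD tryCandidate) := by
    refine h0.loop he₂ hN (hset 64 (by omega)) (hsetG 64 (by omega)) ?_
    rintro s t ht hv ⟨hc, c1, c2, c3, c4⟩
    rw [ht 60 (by decide), ht 61 (by decide), ht 62 (by decide), ht 63 (by decide)]
    exact ⟨hc, c1, c2, c3, c4, hv⟩
  have h2 : Improves Inv (UpTo c) (fun s => H ∧ s.nat 60 0 = a ∧ s.nat 61 0 = a' ∧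
      s.nat 62 0 = x) (.loop 63 eDD (.loop 64 eDD tryCandidate)) := by
    refine h1.loop he₁ hN (hset 63 (by omega)) (hsetG 63 (by omega)) ?_
    rintro s t ht hv ⟨hc, c1, c2, c3⟩
    rw [ht 60 (by decide), ht 61 (by decide), ht 62 (by decide)]
    exact ⟨hc, c1, c2, c3, hv⟩
  have h3 : Improves Inv (UpTo c) (fun s => H ∧ s.nat 60 0 = a ∧ s.nat 61 0 = a')
      (.loop 62 eDD (.loop 63 eDD (.loop 64 eDD tryCandidate))) := by
    refine h2.loop hx hN (hset 62 (by omega)) (hsetG 62 (by omega)) ?_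
    rintro s t ht hv ⟨hc, c1, c2⟩
    rw [ht 60 (by decide), ht 61 (by decide)]
    exact ⟨hc, c1, c2, hv⟩
  have h4 : Improves Inv (UpTo c) (fun s => H ∧ s.nat 60 0 = a)
      (.loop 61 eDD (.loop 62 eDD (.loop 63 eDD (.loop 64 eDD tryCandidate)))) := by
    refine h3.loop ha' hN (hset 61 (by omega)) (hsetG 61 (by omega)) ?_
    rintro s t ht hv ⟨hc, c1⟩
    rw [ht 60 (by decide)]
    exact ⟨hc, c1, hv⟩
  have h5 : Improves Inv (UpTo c) (fun _ => H) search := by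
    refine h4.loop ha hN (hset 60 (by omega)) (hsetG 60 (by omega)) ?_
    rintro s t ht hv hc
    exact ⟨hc, hv⟩
  obtain ⟨⟨k1, -, k2⟩, k3, k4⟩ := h5 s ⟨h, hit, hB⟩
  exact ⟨k1, k2, k3, k4⟩

theorem round_spec {s : State} (h : HasInput I s) (hB : Best I s) (hR : s.real 10 0 = R)
    (hR0 : 0 ≤ R) (hm : I.m < I.nD) (v₀ : I.Ball) {y : I.Solution} (hy : I.Feasible y) :
    HasInput I (round.den s) ∧ Best I (round.den s) ∧
      (UpTo (12 * I.cost y) s → UpTo (12 * I.cost y) (round.den s)) ∧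
      ((∀ i ∈ y.S, I.radius y i ≤ R) → R ≤ I.cost y → UpTo (12 * I.cost y) (round.den s)) := by
  have hbr := bisectLoop_spec (init_spec h hR hR0 hm v₀ (y := y)) v₀
  have hden : round.den s = search.den (bisectLoop.den (initUpper.den (initLower.den s))) := rfl
  rw [hden]
  set u := bisectLoop.den (initUpper.den (initLower.den s)) with hu
  have hun : ∀ {a}, a ∉ initLower.natWrites → a ∉ initUpper.natWrites →
      a ∉ bisectLoop.natWrites → u.nat a = s.nat a := fun h1 h2 h3 => by
    rw [hu, LProg.den_nat _ _ h3, LProg.den_nat _ _ h2, LProg.den_nat _ _ h1]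
  have hur : u.real 18 = s.real 18 := by
    rw [hu, LProg.den_real _ _ (by decide), LProg.den_real _ _ (by decide),
      LProg.den_real _ _ (by decide)]
  have h53 : u.nat 53 = s.nat 53 := hun (by decide) (by decide) (by decide)
  have hBu : Best I u := hB.congr (hun (by decide) (by decide) (by decide))
    (hun (by decide) (by decide) (by decide)) h53 hur
  have hD : 0 < I.nD := by omega
  obtain ⟨A, b, t, α₁, α₂, hit, r₁, r₂, q₁, q₂⟩ := exists_items hD hbr.lower hbr.upper
  set H : Prop := (∀ i ∈ y.S, I.radius y i ≤ R) ∧ R ≤ I.cost y with hH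
  have hex : ∃ a a' x e₁ e₂, a < I.nD + I.nD ∧ a' < I.nD + I.nD ∧ x < I.nD + I.nD ∧
      e₁ < I.nD + I.nD ∧ e₂ < I.nD + I.nD ∧
      (H → x ∈ A ∧ unc (sets b) (candidate A t a a' x e₁ e₂) ≤ I.m ∧
        ¬ CompsGE (sets b) (candidate A t a a' x e₁ e₂) (I.k + 1) ∧
        ∀ σ, IsClustering b (candidate A t a a' x e₁ e₂) σ →
          I.cost (solutionOf σ) ≤ 12 * I.cost y) := by
    by_cases hc : H
    · obtain ⟨a, a', x, e₁, e₂, ha, ha', hx, he₁, he₂, k⟩ := exists_candidate hy hR0 hc.1 hc.2 hm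
        hbr.nonneg (sub_nonneg.1 (hbr.diff ▸ hbr.diff_nonneg)) (fun hne => by
          rw [hbr.diff]
          exact gap_le hD (lt_of_le_of_ne hR0 (Ne.symm hne))) hit.valid r₁ r₂ q₁ (q₂ ⟨hy, hc.1⟩)
      exact ⟨a, a', x, e₁, e₂, ha, ha', hit.lt x hx, hit.lt e₁ he₁, hit.lt e₂ he₂, fun _ => ⟨hx, k⟩⟩
    · exact ⟨0, 0, 0, 0, 0, by omega, by omega, by omega, by omega, by omega, fun h => absurd h hc⟩
  obtain ⟨a, a', x, e₁, e₂, ha, ha', hx, he₁, he₂, k⟩ := hex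
  obtain ⟨k1, k2, k3, k4⟩ := search_spec hbr.input hit hBu ha ha' hx he₁ he₂ k
  exact ⟨k1, k2, fun hs => k3 (hs.congr h53 hur), fun h1 h2 => k4 ⟨h1, h2⟩⟩

theorem allRounds_spec {s : State} (h : HasInput I s) (hB : Best I s) (hm : I.m < I.nD)
    {y : I.Solution} (hy : I.Feasible y) :
    Best I (allRounds.den s) ∧ UpTo (12 * I.cost y) (allRounds.den s) := by
  -- The right guess is the largest radius of `y`, a facility-client distance. If the maximising
  -- facility has no clients, all radii are 0 and the cluster of some other client supplies the
  -- ball.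
  obtain ⟨v, hv1, hv2⟩ : ∃ v : I.Ball, (∀ i ∈ y.S, I.radius y i ≤ I.rad v) ∧
      I.rad v ≤ I.cost y := by
    obtain ⟨p, hp⟩ : ∃ p, y.σ p ≠ none := by
      by_contra hc
      push Not at hc
      have := hy.outliers
      rw [filter_true_of_mem fun p _ => hc p] at this
      simp at this
      omega
    obtain ⟨i₁, hi₁⟩ := Option.ne_none_iff_exists'.1 hp
    obtain ⟨i, hi, hmax⟩ := exists_max_image y.S (I.radius y) ⟨i₁, hy.assigned p i₁ hi₁⟩
    have hle : I.radius y i ≤ I.cost y :=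
      single_le_sum (f := I.radius y) (fun j _ => radius_nonneg y j) hi
    by_cases hne : ∃ j, y.σ j = some i
    · obtain ⟨j, hj⟩ := hne
      obtain ⟨v, -, -, hv, -⟩ := exists_ball_of_feasible hy le_rfl hj
      exact ⟨v, fun i' hi' => hv ▸ hmax i' hi', hv ▸ hle⟩
    · have hz : I.radius y i = 0 := by
        have : IsEmpty {j : Fin I.nD // y.σ j = some i} := ⟨fun j => hne ⟨j.1, j.2⟩⟩
        exact Real.iSup_of_isEmpty _
      obtain ⟨v, -, -, hv, -⟩ := exists_ball_of_feasible hy le_rfl hi₁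
      have hz₁ : I.rad v = 0 := by
        rw [hv]
        exact le_antisymm (hz ▸ hmax i₁ (hy.assigned p i₁ hi₁)) (radius_nonneg y i₁)
      exact ⟨v, fun i' hi' => by rw [hz₁, ← hz]; exact hmax i' hi', hz₁ ▸ cost_nonneg y⟩
  set c := 12 * I.cost y with hc
  obtain ⟨-, k2, k3⟩ := LProg.loop_spec (v := 67) (e := eF) (p := .loop 68 eD roundBody) (s := s)
    I.nF (fun i t => HasInput I t ∧ Best I t ∧ (v.1.1 < i → UpTo c t)) (by simp [h.nF])
    ⟨h.congr rfl rfl rfl rfl, hB.congr rfl rfl rfl rfl, fun h => absurd h (Nat.not_lt_zero _)⟩ (by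
      rintro i t hi hv - - ⟨j1, j2, j3⟩
      obtain ⟨l1, l2, l3⟩ := LProg.loop_spec (v := 68) (e := eD) (p := roundBody) (s := t) I.nD
        (fun j u => HasInput I u ∧ Best I u ∧
          (v.1.1 < i ∨ v.1.1 = i ∧ v.2.1 < j → UpTo c u)) (by simp [j1.nD])
        ⟨j1.congr rfl rfl rfl rfl, j2.congr rfl rfl rfl rfl, fun h =>
          (j3 (by omega)).congr rfl rfl⟩ (by
          rintro j u hj hv' hn' - ⟨m1, m2, m3⟩
          have hd := dist_eval m1 (i := nv 67) (p := nv 68) ⟨i, hi⟩ ⟨j, hj⟩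
            ((congrFun (hn' 67 (by decide)) 0).trans hv) hv'
          set w := (rset 10 (dist (nv 67) (nv 68))).den u with hw
          have h10 : w.real 10 0 = I.rad (⟨i, hi⟩, ⟨j, hj⟩) := by
            rw [hw, LProg.den_setReal, hd]; simp [rad]
          obtain ⟨n1, n2, n3, n4⟩ := round_spec (s := w)
            (m1.congr rfl rfl rfl (State.setReal_real_ne _ (by decide)))
            (m2.congr rfl rfl rfl (State.setReal_real_ne _ (by decide))) h10 (rad_nonneg _) hm v hy
          have hden : roundBody.den u = round.den w := rfl
          rw [hden]
          refine ⟨n1.congr (State.setNat_nat_ne _ (by decide)) (State.setNat_nat_ne _ (by decide))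
            (State.setNat_nat_ne _ (by decide)) rfl, n2.congr (State.setNat_nat_ne _ (by decide))
            (State.setNat_nat_ne _ (by decide)) (State.setNat_nat_ne _ (by decide)) rfl,
            fun hlt => UpTo.congr (s := round.den w) ?_ (State.setNat_nat_ne _ (by decide)) rfl⟩
          by_cases hvv : v = (⟨i, hi⟩, ⟨j, hj⟩)
          · exact n4 (hvv ▸ hv1) (hvv ▸ hv2)
          · refine n3 ((m3 ?_).congr rfl (State.setReal_real_ne _ (by decide)))
            have : ¬ (v.1.1 = i ∧ v.2.1 = j) := fun h => hvv (Prod.ext (Fin.ext h.1) (Fin.ext h.2))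
            omega)
      exact ⟨l1.congr (State.setNat_nat_ne _ (by decide)) (State.setNat_nat_ne _ (by decide))
            (State.setNat_nat_ne _ (by decide)) rfl, l2.congr (State.setNat_nat_ne _ (by decide))
            (State.setNat_nat_ne _ (by decide)) (State.setNat_nat_ne _ (by decide)) rfl,
            fun hlt => (l3 (by have := v.2.2; omega)).congr
              (State.setNat_nat_ne _ (by decide)) rfl⟩)
  exact ⟨k2, k3 v.1.2⟩

theorem initRows_spec (I : LBkSRO) (ε : ℝ) : HasInput I (initRows.den (I.input ε)) := by
  have hrow := LProg.loop_spec (v := 20) (e := eF)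
    (p := .setNat 4 (.add (nv 20) (.lit 1)) (.add (.get 4 (nv 20)) (.add eF eD)))
    -- Iteration `i` writes cell `i + 1`; cell 0 is correct from the start.
    (s := I.input ε) I.nF (fun i t => ∀ j ≤ i, t.nat 4 j = j * (I.nF + I.nD))
    (by simp [input]) (by simp [input]) (by
      intro i t hi hv hn hr hJ j hj
      have h0 : t.nat 0 = (I.input ε).nat 0 := hn 0 (by decide)
      have hF : t.nat 0 0 = I.nF := by rw [h0]; simp [input]
      have hD : t.nat 0 1 = I.nD := by rw [h0]; simp [input]
      rcases hj.lt_or_eq with hj | rfl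
      · have : j ≠ i + 1 := by omega
        simpa [hv, this] using hJ j (by omega)
      · simp [hv, hJ i le_rfl, hF, hD]; ring)
  have hn : ∀ {a}, a ∉ initRows.natWrites → (initRows.den (I.input ε)).nat a =
      (I.input ε).nat a := fun ha => LProg.den_nat _ _ ha
  have hr : (initRows.den (I.input ε)).real 1 = (I.input ε).real 1 :=
    LProg.den_real _ _ (by decide)
  refine ⟨?_, ?_, ?_, ?_, fun i => ?_, fun i => hrow i i.2.le, fun i p => ?_⟩
  · rw [hn (by decide)]; simp [input]
  · rw [hn (by decide)]; simp [input]
  · rw [hn (by decide)]; simp [input]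
  · rw [hn (by decide)]; simp [input]
  · rw [hn (by decide)]; simp [input]
  · have hlt : I.nF + p < I.nF + I.nD := by omega
    have hdiv : (i * (I.nF + I.nD) + I.nF + p) / (I.nF + I.nD) = i := by
      rw [add_assoc, Nat.mul_comm, Nat.mul_add_div (by omega), Nat.div_eq_of_lt hlt, add_zero]
    have hmod : (i * (I.nF + I.nD) + I.nF + p) % (I.nF + I.nD) = I.nF + p := by
      rw [add_assoc, Nat.mul_comm, Nat.mul_add_mod, Nat.mod_eq_of_lt hlt]
    have h1 : I.point i = some (.inl i) := by simp [point]
    have h2 : I.point (I.nF + p) = some (.inr p) := by simp [point]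
    rw [hr]
    simp only [input, size, hdiv, hmod, h1, h2]
    simp [d]

/-- The final state does not depend on `y`, so one output is compared with every feasible solution,
and no optimal one has to be chosen. -/
theorem main_spec (I : LBkSRO) (ε : ℝ) (h : ∃ y : I.Solution, I.Feasible y) :
    ∃ x : I.Solution, I.Presents (main.den (I.input ε)) x ∧ I.Feasible x ∧
      ∀ y : I.Solution, I.Feasible y → I.cost x ≤ 12 * I.cost y := by
  have hI := initRows_spec I ε
  simp only [main, LProg.den_block_cons, LProg.den_block_singleton]
  set s := initRows.den (I.input ε) with hs
  have hc : Test.holds s (.natLe eD eM) ↔ I.nD ≤ I.m := by simp [hI.nD, hI.m]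
  have hs0 : ∀ a, 5 ≤ a ∨ a = 2 ∨ a = 3 → a ≠ 20 → s.nat a = fun _ => 0 := by
    intro a ha ha'
    rw [hs, LProg.den_nat _ _ (by
      simp [initRows, LProg.natWrites]; omega)]
    funext i
    simp only [input]
    rw [if_neg (by omega), if_neg (by omega)]
  by_cases hm : I.nD ≤ I.m
  · rw [LProg.den_ite_pos (hc.2 hm), LProg.den_skip]
    refine ⟨⟨∅, fun _ => none⟩, ⟨fun i => ?_, fun j => ?_⟩, ⟨by simp, by simp, by simp,
      by simpa using hm⟩, fun y _ => ?_⟩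
    · rw [hs0 2 (by omega) (by omega)]; simp
    · rw [hs0 3 (by omega) (by omega)]
    · have : I.cost ⟨∅, fun _ => none⟩ = 0 := by simp [cost]
      rw [this]
      have := cost_nonneg y
      positivity
  · rw [LProg.den_ite_neg fun h => hm (hc.1 h)]
    have hall := fun (y : I.Solution) (hy : I.Feasible y) => allRounds_spec hI
      (.inl (by rw [hs0 53 (by omega) (by omega)])) (not_le.1 hm) hy
    obtain ⟨y₀, hy₀⟩ := h
    obtain ⟨hB, hU⟩ := hall y₀ hy₀
    rcases hB with h0 | ⟨-, x, hx1, hx2, hx3⟩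
    · exact absurd (hU.1.symm.trans h0) one_ne_zero
    · exact ⟨x, hx2, hx1, fun y hy => hx3 ▸ (hall y hy).2.2⟩

end Program
end LBkSRO

theorem theorem2 :
    ∃ (P : RAM.Prog) (C : ℕ), ∀ (ε : ℝ), 0 < ε → ∀ I : LBkSRO,
      ∃ (T : ℕ) (s : RAM.State),
        RAM.Exec P (I.input ε) T s ∧
        T ≤ (max I.size 2) ^ (C * ⌈1 / ε⌉₊) ∧
        ((∃ y : I.Solution, I.Feasible y) →
          ∃ x : I.Solution, I.Presents s x ∧ I.Feasible x ∧
            ∀ y : I.Solution, I.Feasible y → I.cost x ≤ (12.365 + C * ε) * I.cost y) := by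
  obtain ⟨K, d, hKd⟩ := LBkSRO.Program.main.time_le_pow
  refine ⟨LBkSRO.Program.main.compile, K + d, fun ε hε I => ?_⟩
  set N := max I.size 2 with hN
  have hN2 : 2 ≤ N := le_max_right _ _
  have hsize : I.nF + I.nD ≤ N := le_max_left _ _
  obtain ⟨T, hexec, hT⟩ := RAM.LProg.exec_compile LBkSRO.Program.main LBkSRO.Program.main_ok
    LBkSRO.Program.main_writes N (I.input ε) (by omega) (by simp [LBkSRO.input]; omega)
    (by simp [LBkSRO.input]; omega)
  refine ⟨T, _, hexec, ?_, fun h => ?_⟩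
  · have hceil : 1 ≤ ⌈1 / ε⌉₊ := Nat.one_le_ceil_iff.2 (by positivity)
    calc T ≤ K * N ^ d := hT.trans (hKd N (by omega))
      -- `K ≤ 2 ^ K ≤ N ^ K` moves the constant factor into the exponent, which is why `K + d`
      -- serves as the constant.
      _ ≤ N ^ K * N ^ d := Nat.mul_le_mul_right _
          (Nat.lt_two_pow_self.le.trans (Nat.pow_le_pow_left hN2 K))
      _ = N ^ (K + d) := (pow_add _ _ _).symm
      _ ≤ N ^ ((K + d) * ⌈1 / ε⌉₊) :=
          Nat.pow_le_pow_right (by omega) (Nat.le_mul_of_pos_right _ hceil)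
  · obtain ⟨x, hx1, hx2, hx3⟩ := LBkSRO.Program.main_spec I ε h
    refine ⟨x, hx1, hx2, fun y hy => (hx3 y hy).trans ?_⟩
    refine mul_le_mul_of_nonneg_right ?_ (LBkSRO.cost_nonneg y)
    have : 0 ≤ ((K + d : ℕ) : ℝ) * ε := by positivity
    linarith
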